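/- **S-machines.** An $S$-machine $S$ with $N\ge 1$ parts consists of finite data: state letters $Q=Q_1\sqcup\dots\sqcup Q_N$ with all $Q_i$ non-empty, tape alphabets $Y_1,\dots,Y_{N}$ with $Y_N=\emptyset$ (indices are counted modulo $N$, so $Y_0=Y_N$, $Q_{N+1}=Q_1$), and a finite set $\Theta^+$ of positive rules $\theta=[U_1\to V_1,\dots,U_N\to V_N]$, where $U_i=v_{i-1}k_iu_i$, $V_i=v_{i-1}'k_i'u_i'$ with $k_i,k_i'\in Q_i$, $u_i,u_i'\in F(Y_i)$, $v_{i-1},v_{i-1}'\in F(Y_{i-1})$; each rule comes with subsets $Y_i(\theta)\subseteq Y_i$ (by default $Y_i(\theta)=Y_i$; the notation $U_i\stackrel{\ell}{\to}V_i$ means $Y_i(\theta)=\emptyset$). Different rules may be given by the same words. The inverse rule is $\theta^{-1}=[V_1\to U_1,\dots]$ with the same $Y_i(\theta^{-1})=Y_i(\theta)$, and $\Theta=\Theta^+\sqcup\Theta^-$ is the set of all rules and inverse rules. A reduced word $W=q_1w_1q_2\cdots w_{m-1}q_m$ ($m\ge1$, $q_j\in Q^{\pm1}$, $w_j$ group words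 in tape letters) is *admissible* for $\theta\in\Theta$ if each $q_j^{\pm 1}$ is the state letter of the corresponding $U_i$; if each two consecutive letters $q_j,q_{j+1}$ satisfy $q_{j+1}\in Q_{i+1}\cup Q_i^{-1}$ when $q_j\in Q_i$, and $q_{j+1}\in Q_i\cup Q_{i-1}^{-1}$ when $q_j\in Q_i^{-1}$; and if, in the free group, $w_j=x\,y\,z$, where $x$ (resp. $z$) is the tape word standing to the right (resp. left) of the state letter in the word $U^{\pm1}$ corresponding to $q_j$ (resp. $q_{j+1}$), and $y$ is a group word over $Y_g(\theta)$, $Y_g$ being the tape alphabet between the two parts ($g=i$, resp. $g=i-1$, in the two cases above). The result $\theta\cdot W$ is obtained by replacing the state letters and the words $x,z$ by those of $V^{\pm1}$, keeping $y$, and reducing. A word is admissible if it is admissible for some rule. The *base* of $W$ is the word in $Q_1^{\pm1},\dots,Q_N^{\pm1}$ obtained from $W$ by deleting tape letters and replacing each state letter by its part; *base words* are words in this alphabet. $|W|$ is the number of letters of $W$. A *computation* $W_0\to_{\theta_1}W_1\to\dots\to_{\theta_t}W_t$ has $W_{j}=\theta_{j}\cdot W_{j-1}$ and reduced history $\theta_1\cdots\theta_t$;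 its *width* is $\max_j|W_j|$. **Adding machine.** For a set $A$ with copies $A_0,A_1$, the machine $Z(A)$ has parts $\{L\},\{p(1),p(2),p(3)\},\{R\}$, tape alphabets $A_0\cup A_1$ and $A_0$ and, for $a\in A$, positive rules (with $L\to L$, $R\to R$ in each) $r_1(a)\colon p(1)\to a_1^{-1}p(1)a_0$; $r_{12}(a)\colon p(1)\to a_0^{-1}a_1p(2)$; $r_2(a)\colon p(2)\to a_0p(2)a_0^{-1}$; $r_{21}\colon p(2)\to p(1)$, with no tape letters permitted between $p$ and $R$; $r_{13}\colon p(1)\to p(3)$, with no tape letters permitted between $L$ and $p$; $r_3(a)\colon p(3)\to a_0p(3)a_0^{-1}$, with only $A_0$ permitted between $L$ and $p$. **Composition.** Let $S$ be an $S$-machine with parts $K_1,\dots,K_N$. The machine $S\circ Z$ has the $2N-1$ parts $K_1,P_1,K_2,P_2,\dots,P_{N-1},K_N$, where $P_i=\{p_i\}\cup\{p_i(\theta,1),p_i(\theta,2),p_i(\theta,3):\theta\in\Theta\}$; the tape alphabet between $K_i$ and $P_i$ is $Y_{i,0}\cup Y_{i,1}$ (two copies of $Y_i$), that between $P_i$ and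 $K_{i+1}$ is $Y_{i,0}$. For $\theta\in\Theta$ write $k_i'$ for the state letters of its right-hand sides. The positive rules are: (a) for each $\theta\in\Theta^+$, $\theta=[k_1u_1\to k_1'u_1',\,v_1k_2u_2\to v_1'k_2'u_2',\dots]$, the rule $\bar\theta=[k_iu_i\to k_i'u_i',\ v_jp_j\stackrel{\ell}{\to}v_j'p_j(\theta,1)]$, all tape words being taken in the copies $Y_{i,0}$, with $Y_i(\theta)\subseteq Y_{i,0}$ permitted between $K_i$ and $P_i$; (b) for each $\theta\in\Theta$, $1\le i\le N-1$ and each positive rule $\tau$ of $Z(Y_i)$, the rule that acts as $\tau$ on the parts $K_i,P_i,K_{i+1}$, with $k_i',\,p_i(\theta,j),\,k_{i+1}'$ in place of $L,\,p(j),\,R$, together with $k_s'\to k_s'$ for all $s$, $p_s(\theta,3)\stackrel{\ell}{\to}p_s(\theta,3)$ for $s<i$, and $p_s(\theta,1)\stackrel{\ell}{\to}p_s(\theta,1)$ for $s>i$, where only $Y_{s,0}$ is permitted between $K_s$ and $P_s$ for $s\ne i$; (c) for each $\theta\in\Theta$, the rule $\zeta(\theta)=[k_i'\to k_i',\ p_j(\theta,3)\stackrel{\ell}{\to}p_j]$.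 **Covered and narrow words.** For a set $\mathcal B$ of base words of $S\circ Z$, a base word is *$\mathcal B$-covered* if it has the form $xvx$ for a letter $x$ and every letter of it belongs to a subword from $\mathcal B$. A base word is *$\mathcal B$-narrow* if it has no $\mathcal B$-covered subwords. **Lemma.** For every $S$-machine $S$ there exist a finite set $\mathcal B$ of base words of $S\circ Z$ and constants $K_0$, $C$ such that (*) every $\mathcal B$-narrow base word has length smaller than $K_0$; moreover, every base word of length at least $K_0$ has a $\mathcal B$-covered subword in which any two consecutive letters lie in a common subword from $\mathcal B$; (**) for every admissible word $W$ of $S\circ Z$ with base in $\mathcal B$, the width of every computation $W=W_0\to W_1\to\dots\to W_t$ of $S\circ Z$ is at most $C(|W|+|W_t|+\log_2 t)$ (where $\log_2 0$ is read as $0$ for the empty computation). -/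

import Mathlib

/-- Group words (elements of the free group) written in the letters of `s` only. -/
def wordsOver {A : Type} (s : Set A) : Subgroup (FreeGroup A) :=
  Subgroup.closure (FreeGroup.of '' s)

/-- A component `v_{i-1} k_i u_i` of one side of a rule: a state letter `k_i` with a group word
`v_{i-1}` in tape letters on its left and a group word `u_i` in tape letters on its right. -/
structure SPart (Q A : Type) where
  left : FreeGroup A
  state : Q
  right : FreeGroup A

/-- The component `P` may stand at place `i` of a rule: its state letter lies in `Q_i`, its left word
is over `Y_{i-1}` and its right word is over `Y_i`. Indices are counted cyclically. -/
def SPart.Fits {n : ℕ} {Q A : Type} (part : Q → Fin (n + 1)) (tape : Fin (n + 1) → Set A)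
    (P : SPart Q A) (i : Fin (n + 1)) : Prop :=
  part P.state = i ∧ P.left ∈ wordsOver (tape (i - 1)) ∧ P.right ∈ wordsOver (tape i)

/-- An `S`-machine with `n + 1` parts of state letters, numbered cyclically by `0, …, n`.
The set of letters `tape i` is the tape alphabet allowed between `Q_i` and `Q_{i+1}`; the one between
the last part and the first part is empty. The type `R` is the set of positive rules; the rule `r` is
`[src r 0 → tgt r 0, …, src r n → tgt r n]`, together with the sets `dom r i` of those letters of
`tape i` that may stand, apart from the words mentioned in the rule, between `Q_i` and `Q_{i+1}`. -/
structure SMachine (n : ℕ) where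
  Q : Type
  A : Type
  R : Type
  finite_Q : Finite Q
  finite_A : Finite A
  finite_R : Finite R
  part : Q → Fin (n + 1)
  part_surjective : Function.Surjective part
  tape : Fin (n + 1) → Set A
  tape_last : tape (Fin.last n) = ∅
  src : R → Fin (n + 1) → SPart Q A
  tgt : R → Fin (n + 1) → SPart Q A
  dom : R → Fin (n + 1) → Set A
  src_fits : ∀ r i, (src r i).Fits part tape i
  tgt_fits : ∀ r i, (tgt r i).Fits part tape i
  dom_subset : ∀ r i, dom r i ⊆ tape i

namespace SMachine

variable {n : ℕ} (M : SMachine n)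

/-- All rules: `(r, true)` is the positive rule `r`, `(r, false)` is its inverse. -/
abbrev Rule : Type := M.R × Bool

variable {M}

/-- The inverse rule. -/
def Rule.inv (ρ : M.Rule) : M.Rule := (ρ.1, !ρ.2)

/-- The left hand sides `U_i` of a positive or negative rule. -/
def Rule.lhs (ρ : M.Rule) (i : Fin (n + 1)) : SPart M.Q M.A :=
  if ρ.2 then M.src ρ.1 i else M.tgt ρ.1 i

/-- The right hand sides `V_i` of a positive or negative rule. -/
def Rule.rhs (ρ : M.Rule) (i : Fin (n + 1)) : SPart M.Q M.A :=
  if ρ.2 then M.tgt ρ.1 i else M.src ρ.1 i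

variable (M)

/-- State letters with exponents: `(q, true)` is `q` and `(q, false)` is `q⁻¹`. -/
abbrev Letter : Type := M.Q × Bool

/-- Letters of base words: `(i, true)` is `Q_i` and `(i, false)` is `Q_i⁻¹`. -/
abbrev _root_.BaseLetter (n : ℕ) : Type := Fin (n + 1) × Bool

/-- The index of the tape alphabet to be used immediately after a letter `Q_i` or `Q_i⁻¹`. -/
def _root_.BaseLetter.gapAfter {n : ℕ} (x : BaseLetter n) : Fin (n + 1) :=
  if x.2 then x.1 else x.1 - 1

/-- The index of the tape alphabet to be used immediately before a letter `Q_i` or `Q_i⁻¹`. -/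
def _root_.BaseLetter.gapBefore {n : ℕ} (x : BaseLetter n) : Fin (n + 1) :=
  if x.2 then x.1 - 1 else x.1

variable {M}

/-- The base of a one-letter word. -/
def Letter.base (a : M.Letter) : BaseLetter n := (M.part a.1, a.2)

/-- The tape word on the right of the state letter in `P` (exponent `1`) or in the inverse of `P`
(exponent `-1`). -/
def _root_.SPart.after {Q A : Type} (P : SPart Q A) (ε : Bool) : FreeGroup A :=
  if ε then P.right else P.left⁻¹

/-- The tape word on the left of the state letter in `P` (exponent `1`) or in the inverse of `P`
(exponent `-1`). -/
def _root_.SPart.before {Q A : Type} (P : SPart Q A) (ε : Bool) : FreeGroup A :=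
  if ε then P.left else P.right⁻¹

variable (M)

/-- A word `q_1 u_1 q_2 u_2 … u_{m-1} q_m` with `m ≥ 1`, where the `q_i` are state letters with
exponents and the `u_i` are (reduced) group words in tape letters. -/
structure Word where
  head : M.Letter
  tail : List (FreeGroup M.A × M.Letter)

variable {M}

/-- The number `|W|` of letters of `W`. -/
noncomputable def Word.length (W : M.Word) : ℕ :=
  1 + (W.tail.map fun x => @FreeGroup.norm _ (Classical.decEq _) x.1 + 1).sum

/-- The base of `W`. -/
def Word.base (W : M.Word) : List (BaseLetter n) :=
  W.head.base :: W.tail.map fun x => x.2.base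

/-- The rule `ρ` turns the state letter `a` into `b`, with the same exponent. -/
def LetterStep (ρ : M.Rule) (a b : M.Letter) : Prop :=
  a.1 = (ρ.lhs (M.part a.1)).state ∧ b = ((ρ.rhs (M.part a.1)).state, a.2)

/-- `TailStep ρ a l l'`: the rule `ρ` turns `l` into `l'`, where `l` is what follows an occurrence of
the state letter `a` in a reduced word. The tape word between consecutive letters `a` and `b` must be
`u y v`, where `u` and `v` are the tape words that the left hand side of the rule attaches to `a` and
to `b`, and `y` is a group word over the set of letters that the rule permits there; it is replaced
by `u' y v'`, with the corresponding words of the right hand side. -/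
inductive TailStep (ρ : M.Rule) : M.Letter → List (FreeGroup M.A × M.Letter) →
    List (FreeGroup M.A × M.Letter) → Prop
  | nil (a : M.Letter) : TailStep ρ a [] []
  | cons (a b b' : M.Letter) (y : FreeGroup M.A) (w w' : FreeGroup M.A)
      (l l' : List (FreeGroup M.A × M.Letter))
      (adjacent : a.base.gapAfter = b.base.gapBefore)
      (reduced : ¬ (w = 1 ∧ b = (a.1, !a.2)))
      (permitted : y ∈ wordsOver (M.dom ρ.1 a.base.gapAfter))
      (old : w = (ρ.lhs (M.part a.1)).after a.2 * y * (ρ.lhs (M.part b.1)).before b.2)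
      (letter : LetterStep ρ b b')
      (new : w' = (ρ.rhs (M.part a.1)).after a.2 * y * (ρ.rhs (M.part b.1)).before b.2)
      (rest : TailStep ρ b l l') :
      TailStep ρ a ((w, b) :: l) ((w', b') :: l')

/-- The word `W` is admissible for `ρ`, and `ρ · W = W'`. -/
def Step (ρ : M.Rule) (W W' : M.Word) : Prop :=
  LetterStep ρ W.head W'.head ∧ TailStep ρ W.head W.tail W'.tail

/-- The word `W` is admissible for some rule. -/
def Admissible (W : M.Word) : Prop :=
  ∃ (ρ : M.Rule) (W' : M.Word), Step ρ W W'

/-- `W 0 → W 1 → … → W t` is a computation of length `t` with history `h 0, h 1, …, h (t - 1)`.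
The history is a reduced word. -/
def IsComputation (t : ℕ) (W : ℕ → M.Word) (h : ℕ → M.Rule) : Prop :=
  (∀ i, i < t → Step (h i) (W i) (W (i + 1))) ∧
    ∀ i, i + 1 < t → h (i + 1) ≠ (h i).inv

/-- The width of the computation `W 0 → … → W t`: the length of its longest word. -/
noncomputable def width (t : ℕ) (W : ℕ → M.Word) : ℕ :=
  (Finset.range (t + 1)).sup fun j => (W j).length

end SMachine

/-- The three `p`-letters `p(1)`, `p(2)`, `p(3)` of the adding machine. -/
inductive Phase : Type
  | one
  | two
  | three

instance : Finite Phase :=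
  Finite.of_injective
    (fun x : Phase => match x with | .one => (0 : Fin 3) | .two => 1 | .three => 2)
    (by intro x y; cases x <;> cases y <;> simp)

/-- The positive rules of the adding machine `Z(s)`. -/
inductive ZRule {A : Type} (s : Set A) : Type
  | r1 (a : s)
  | r12 (a : s)
  | r2 (a : s)
  | r21
  | r13
  | r3 (a : s)

namespace ZRule

variable {A : Type} {s : Set A}

/-- The letter `a_0`, as a group word. -/
def a0 (a : s) : FreeGroup (A × Fin 2) := FreeGroup.of (a.1, 0)

/-- The letter `a_1`, as a group word. -/
def a1 (a : s) : FreeGroup (A × Fin 2) := FreeGroup.of (a.1, 1)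

/-- The `p`-letter on the left hand side; all these rules have the form
`[L → L, p(i) → w p(j) w', R → R]`. -/
def source : ZRule s → Phase
  | r1 _ => .one
  | r12 _ => .one
  | r2 _ => .two
  | r21 => .two
  | r13 => .one
  | r3 _ => .three

/-- The `p`-letter on the right hand side. -/
def target : ZRule s → Phase
  | r1 _ => .one
  | r12 _ => .two
  | r2 _ => .two
  | r21 => .one
  | r13 => .three
  | r3 _ => .three

/-- The word inserted on the left of the `p`-letter. -/
def left : ZRule s → FreeGroup (A × Fin 2)
  | r1 a => (a1 a)⁻¹
  | r12 a => (a0 a)⁻¹ * a1 a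
  | r2 a => a0 a
  | r21 => 1
  | r13 => 1
  | r3 a => a0 a

/-- The word inserted on the right of the `p`-letter. -/
def right : ZRule s → FreeGroup (A × Fin 2)
  | r1 a => a0 a
  | r12 _ => 1
  | r2 a => (a0 a)⁻¹
  | r21 => 1
  | r13 => 1
  | r3 a => (a0 a)⁻¹

/-- The letters permitted between `L` and the `p`-letter. -/
def domLeft : ZRule s → Set (A × Fin 2)
  | r13 => ∅
  | r3 _ => {y | y.1 ∈ s ∧ y.2 = 0}
  | _ => {y | y.1 ∈ s}

/-- The letters permitted between the `p`-letter and `R`. -/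
def domRight : ZRule s → Set (A × Fin 2)
  | r21 => ∅
  | _ => {y | y.1 ∈ s ∧ y.2 = 0}

theorem finite [Finite A] : Finite (ZRule s) := by
  let f : ZRule s → Fin 6 × Option s := fun z => match z with
    | r1 a => (0, some a)
    | r12 a => (1, some a)
    | r2 a => (2, some a)
    | r21 => (3, none)
    | r13 => (4, none)
    | r3 a => (5, some a)
  refine Finite.of_injective f ?_
  intro x y h
  cases x <;> cases y <;> simp_all [f]

theorem left_mem (z : ZRule s) : z.left ∈ wordsOver {y : A × Fin 2 | y.1 ∈ s} := by
  have h0 : ∀ a : s, a0 a ∈ wordsOver {y : A × Fin 2 | y.1 ∈ s} := fun a =>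
    Subgroup.subset_closure ⟨_, a.2, rfl⟩
  have h1 : ∀ a : s, a1 a ∈ wordsOver {y : A × Fin 2 | y.1 ∈ s} := fun a =>
    Subgroup.subset_closure ⟨_, a.2, rfl⟩
  cases z with
  | r1 a => exact inv_mem (h1 a)
  | r12 a => exact mul_mem (inv_mem (h0 a)) (h1 a)
  | r2 a => exact h0 a
  | r21 => exact one_mem _
  | r13 => exact one_mem _
  | r3 a => exact h0 a

theorem right_mem (z : ZRule s) : z.right ∈ wordsOver {y : A × Fin 2 | y.1 ∈ s ∧ y.2 = 0} := by
  have h0 : ∀ a : s, a0 a ∈ wordsOver {y : A × Fin 2 | y.1 ∈ s ∧ y.2 = 0} := fun a =>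
    Subgroup.subset_closure ⟨_, ⟨a.2, rfl⟩, rfl⟩
  cases z with
  | r1 a => exact h0 a
  | r12 a => exact one_mem _
  | r2 a => exact inv_mem (h0 a)
  | r21 => exact one_mem _
  | r13 => exact one_mem _
  | r3 a => exact inv_mem (h0 a)

theorem domLeft_subset (z : ZRule s) : z.domLeft ⊆ {y | y.1 ∈ s} := by
  cases z <;> simp [domLeft]

theorem domRight_subset (z : ZRule s) : z.domRight ⊆ {y | y.1 ∈ s ∧ y.2 = 0} := by
  cases z <;> simp [domRight]

end ZRule

/-- The sequence `f 0, g 0, f 1, g 1, …, g (n - 1), f n`. -/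
def interleave {n : ℕ} {β : Type} (f : Fin (n + 1) → β) (g : Fin n → β) (j : Fin (2 * n + 1)) : β :=
  if h : j.1 % 2 = 0 then f ⟨j.1 / 2, by omega⟩ else g ⟨j.1 / 2, by omega⟩

/-- The place of the `i`-th `k`-part among `K_0, P_0, K_1, P_1, …, P_{n-1}, K_n`. -/
def kPlace {n : ℕ} (i : Fin (n + 1)) : Fin (2 * n + 1) := ⟨2 * i.1, by omega⟩

/-- The place of the `i`-th `p`-part among `K_0, P_0, K_1, P_1, …, P_{n-1}, K_n`. -/
def pPlace {n : ℕ} (i : Fin n) : Fin (2 * n + 1) := ⟨2 * i.1 + 1, by have := i.isLt; omega⟩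

theorem interleave_kPlace {n : ℕ} {β : Type} (f : Fin (n + 1) → β) (g : Fin n → β)
    (i : Fin (n + 1)) : interleave f g (kPlace i) = f i := by
  simp [interleave, kPlace]

theorem interleave_pPlace {n : ℕ} {β : Type} (f : Fin (n + 1) → β) (g : Fin n → β)
    (i : Fin n) : interleave f g (pPlace i) = g i := by
  have h2 : (2 * i.1 + 1) / 2 = i.1 := by omega
  simp [interleave, pPlace, h2]

theorem place_cases {n : ℕ} (j : Fin (2 * n + 1)) :
    (∃ i : Fin (n + 1), j = kPlace i) ∨ ∃ i : Fin n, j = pPlace i := by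
  rcases Nat.even_or_odd' j.1 with ⟨c, hc | hc⟩
  · exact Or.inl ⟨⟨c, by omega⟩, Fin.ext hc⟩
  · exact Or.inr ⟨⟨c, by omega⟩, Fin.ext hc⟩

theorem pPlace_sub_one {n : ℕ} (i : Fin n) : pPlace i - 1 = kPlace i.castSucc := by
  rw [sub_eq_iff_eq_add]
  apply Fin.ext
  have hi := i.isLt
  have h1 : 1 % (2 * n + 1) = 1 := Nat.mod_eq_of_lt (by omega)
  have h2 : (2 * i.1 + 1) % (2 * n + 1) = 2 * i.1 + 1 := Nat.mod_eq_of_lt (by omega)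
  simp [pPlace, kPlace, Fin.val_add, h1, h2]

namespace SMachine

variable {n : ℕ} (S : SMachine n)

/-- The state letters of the composition: those of `S`, the letters `p_i`, and the letters
`p_i(θ, 1)`, `p_i(θ, 2)`, `p_i(θ, 3)` for all rules `θ` of `S`. -/
inductive CompState : Type
  | k (q : S.Q)
  | p (i : Fin n)
  | pz (i : Fin n) (θ : S.Rule) (x : Phase)

/-- The positive rules of the composition: `basic θ` for the positive rules `θ` of `S`, the rules
`adding θ i z` of the machine `Z_i(θ)`, and the transition rules. -/
inductive CompRule : Type
  | basic (θ : S.R)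
  | adding (θ : S.Rule) (i : Fin n) (z : ZRule (S.tape i.castSucc))
  | transition (θ : S.Rule)

variable {S}

/-- The part to which a state letter of the composition belongs. -/
def CompState.place : CompState S → Fin (2 * n + 1)
  | .k q => kPlace (S.part q)
  | .p i => pPlace i
  | .pz i _ _ => pPlace i

variable (S)

/-- The tape alphabets of the composition: `Y_{i,0} ∪ Y_{i,1}` between `K_i` and `P_i`, and `Y_{i,0}`
between `P_i` and `K_{i+1}`. The letter `(y, j)` is the copy of `y` in `Y_{i,j}`. -/
def compTape : Fin (2 * n + 1) → Set (S.A × Fin 2) :=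
  interleave (fun i => {y | y.1 ∈ S.tape i}) (fun i => {y | y.1 ∈ S.tape i.castSucc ∧ y.2 = 0})

variable {S}

/-- A word over `Y_i` as a word over `Y_{i,0}`. -/
def lift0 {A : Type} : FreeGroup A →* FreeGroup (A × Fin 2) := FreeGroup.map fun y => (y, 0)

/-- A component that consists of a state letter only. -/
def bare {Q A : Type} (q : Q) : SPart Q A := ⟨1, q, 1⟩

/-- The letter `k_i'` of the right hand side of the rule `θ`. -/
def CompState.after (θ : S.Rule) (i : Fin (n + 1)) : CompState S := .k (θ.rhs i).state

/-- The `p`-letter at place `j` while `Z_i(θ)` is working and its own `p`-letter is `p_i(θ, x)`. -/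
def CompState.working (θ : S.Rule) (i : Fin n) (x : Phase) (j : Fin n) : CompState S :=
  if j < i then .pz j θ .three else if j = i then .pz i θ x else .pz j θ .one

/-- Left hand sides of the positive rules of the composition. -/
def CompRule.src : CompRule S → Fin (2 * n + 1) → SPart (CompState S) (S.A × Fin 2)
  | .basic θ => interleave
      (fun i => ⟨1, .k (S.src θ i).state, lift0 (S.src θ i).right⟩)
      (fun i => ⟨lift0 (S.src θ i.succ).left, .p i, 1⟩)
  | .adding θ i z => interleave
      (fun j => bare (.after θ j))
      (fun j => bare (.working θ i z.source j))
  | .transition θ => interleave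
      (fun i => bare (.after θ i))
      (fun i => bare (.pz i θ .three))

/-- Right hand sides of the positive rules of the composition. -/
def CompRule.tgt : CompRule S → Fin (2 * n + 1) → SPart (CompState S) (S.A × Fin 2)
  | .basic θ => interleave
      (fun i => ⟨1, .k (S.tgt θ i).state, lift0 (S.tgt θ i).right⟩)
      (fun i => ⟨lift0 (S.tgt θ i.succ).left, .pz i (θ, true) .one, 1⟩)
  | .adding θ i z => interleave
      (fun j => bare (.after θ j))
      (fun j => ⟨if j = i then z.left else 1, .working θ i z.target j,
        if j = i then z.right else 1⟩)
  | .transition θ => interleave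
      (fun i => bare (.after θ i))
      (fun i => bare (.p i))

/-- The tape letters permitted by the positive rules of the composition. -/
def CompRule.dom : CompRule S → Fin (2 * n + 1) → Set (S.A × Fin 2)
  | .basic θ => interleave (fun i => {y | y.1 ∈ S.dom θ i ∧ y.2 = 0}) (fun _ => ∅)
  | .adding _ i z => interleave
      (fun j => if j = i.castSucc then z.domLeft else {y | y.1 ∈ S.tape j ∧ y.2 = 0})
      (fun j => if j = i then z.domRight else ∅)
  | .transition _ => interleave (fun i => {y | y.1 ∈ S.tape i}) (fun _ => ∅)

theorem CompState.place_working (θ : S.Rule) (i : Fin n) (x : Phase) (j : Fin n) :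
    (CompState.working θ i x j).place = pPlace j := by
  unfold working
  split_ifs with h1 h2
  · rfl
  · rw [h2]; rfl
  · rfl

theorem Rule.part_rhs (θ : S.Rule) (i : Fin (n + 1)) : S.part (θ.rhs i).state = i := by
  unfold Rule.rhs
  split_ifs
  · exact (S.tgt_fits _ _).1
  · exact (S.src_fits _ _).1

theorem lift0_mem {A : Type} {s : Set A} {t : Set (A × Fin 2)} (hst : ∀ a ∈ s, (a, 0) ∈ t)
    {w : FreeGroup A} (hw : w ∈ wordsOver s) : lift0 w ∈ wordsOver t := by
  have : wordsOver s ≤ (wordsOver t).comap lift0 := by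
    refine (Subgroup.closure_le _).2 ?_
    rintro _ ⟨a, ha, rfl⟩
    exact Subgroup.subset_closure ⟨_, hst a ha, by simp [lift0]⟩
  exact this hw

theorem fits_k {q : CompState S} {i : Fin (n + 1)} (hq : q.place = kPlace i)
    {u : FreeGroup S.A} (hu : u ∈ wordsOver (S.tape i)) :
    (⟨1, q, lift0 u⟩ : SPart (CompState S) (S.A × Fin 2)).Fits CompState.place S.compTape
      (kPlace i) := by
  refine ⟨hq, one_mem _, ?_⟩
  rw [compTape, interleave_kPlace]
  exact lift0_mem (fun a ha => ha) hu

theorem fits_p {q : CompState S} {i : Fin n} (hq : q.place = pPlace i)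
    {v w : FreeGroup (S.A × Fin 2)} (hv : v ∈ wordsOver {y | y.1 ∈ S.tape i.castSucc})
    (hw : w ∈ wordsOver {y | y.1 ∈ S.tape i.castSucc ∧ y.2 = 0}) :
    (⟨v, q, w⟩ : SPart (CompState S) (S.A × Fin 2)).Fits CompState.place S.compTape
      (pPlace i) := by
  refine ⟨hq, ?_, ?_⟩
  · rw [pPlace_sub_one, compTape, interleave_kPlace]; exact hv
  · rw [compTape, interleave_pPlace]; exact hw

theorem fits_bare {q : CompState S} {j : Fin (2 * n + 1)} (hq : q.place = j) :
    (bare q : SPart (CompState S) (S.A × Fin 2)).Fits CompState.place S.compTape j :=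
  ⟨hq, one_mem _, one_mem _⟩

theorem succ_sub_one (i : Fin n) : i.succ - 1 = i.castSucc := by
  rw [sub_eq_iff_eq_add]; simp

theorem CompRule.src_fits (r : CompRule S) (j : Fin (2 * n + 1)) :
    (r.src j).Fits CompState.place S.compTape j := by
  rcases place_cases j with ⟨i, rfl⟩ | ⟨i, rfl⟩
  · cases r with
    | basic θ =>
      simp only [src, interleave_kPlace]
      exact fits_k (q := .k (S.src θ i).state) (congrArg kPlace (S.src_fits θ i).1)
        (S.src_fits θ i).2.2
    | adding θ l z =>
      simp only [src, interleave_kPlace]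
      exact fits_bare (congrArg kPlace (Rule.part_rhs θ i))
    | transition θ =>
      simp only [src, interleave_kPlace]
      exact fits_bare (congrArg kPlace (Rule.part_rhs θ i))
  · cases r with
    | basic θ =>
      simp only [src, interleave_pPlace]
      refine fits_p rfl (lift0_mem (fun a ha => ha) ?_) (one_mem _)
      have := (S.src_fits θ i.succ).2.1
      rwa [succ_sub_one] at this
    | adding θ l z =>
      simp only [src, interleave_pPlace]
      exact fits_bare (CompState.place_working _ _ _ _)
    | transition θ =>
      simp only [src, interleave_pPlace]
      exact fits_bare rfl

theorem CompRule.tgt_fits (r : CompRule S) (j : Fin (2 * n + 1)) :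
    (r.tgt j).Fits CompState.place S.compTape j := by
  rcases place_cases j with ⟨i, rfl⟩ | ⟨i, rfl⟩
  · cases r with
    | basic θ =>
      simp only [tgt, interleave_kPlace]
      exact fits_k (q := .k (S.tgt θ i).state) (congrArg kPlace (S.tgt_fits θ i).1)
        (S.tgt_fits θ i).2.2
    | adding θ l z =>
      simp only [tgt, interleave_kPlace]
      exact fits_bare (congrArg kPlace (Rule.part_rhs θ i))
    | transition θ =>
      simp only [tgt, interleave_kPlace]
      exact fits_bare (congrArg kPlace (Rule.part_rhs θ i))
  · cases r with
    | basic θ =>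
      simp only [tgt, interleave_pPlace]
      refine fits_p rfl (lift0_mem (fun a ha => ha) ?_) (one_mem _)
      have := (S.tgt_fits θ i.succ).2.1
      rwa [succ_sub_one] at this
    | adding θ l z =>
      simp only [tgt, interleave_pPlace]
      refine fits_p (CompState.place_working _ _ _ _) ?_ ?_
      · split_ifs with h
        · rw [h]; exact z.left_mem
        · exact one_mem _
      · split_ifs with h
        · rw [h]; exact z.right_mem
        · exact one_mem _
    | transition θ =>
      simp only [tgt, interleave_pPlace]
      exact fits_bare rfl

theorem CompRule.dom_subset (r : CompRule S) (j : Fin (2 * n + 1)) :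
    r.dom j ⊆ S.compTape j := by
  rcases place_cases j with ⟨i, rfl⟩ | ⟨i, rfl⟩
  · cases r with
    | basic θ =>
      simp only [dom, compTape, interleave_kPlace]
      exact fun y hy => S.dom_subset θ i hy.1
    | adding θ l z =>
      simp only [dom, compTape, interleave_kPlace]
      split_ifs with h
      · rw [h]; exact z.domLeft_subset
      · exact fun y hy => hy.1
    | transition θ =>
      simp only [dom, compTape, interleave_kPlace]
      exact subset_rfl
  · cases r with
    | basic θ => simp only [dom, interleave_pPlace]; exact Set.empty_subset _
    | adding θ l z =>
      simp only [dom, compTape, interleave_pPlace]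
      split_ifs with h
      · rw [h]; exact z.domRight_subset
      · exact Set.empty_subset _
    | transition θ => simp only [dom, interleave_pPlace]; exact Set.empty_subset _

variable (S)

theorem finite_compState : Finite (CompState S) := by
  have := S.finite_Q
  have := S.finite_R
  let f : S.Q ⊕ Fin n ⊕ (Fin n × S.Rule × Phase) → CompState S := fun x => match x with
    | .inl q => .k q
    | .inr (.inl i) => .p i
    | .inr (.inr (i, θ, x)) => .pz i θ x
  refine Finite.of_surjective f ?_
  rintro (q | i | ⟨i, θ, x⟩)
  · exact ⟨.inl q, rfl⟩
  · exact ⟨.inr (.inl i), rfl⟩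
  · exact ⟨.inr (.inr (i, θ, x)), rfl⟩

theorem finite_compRule : Finite (CompRule S) := by
  have := S.finite_A
  have := S.finite_R
  have : ∀ i : Fin n, Finite (ZRule (S.tape i.castSucc)) := fun i => ZRule.finite
  let f : S.R ⊕ (S.Rule × (i : Fin n) × ZRule (S.tape i.castSucc)) ⊕ S.Rule → CompRule S :=
    fun x => match x with
    | .inl θ => .basic θ
    | .inr (.inl (θ, ⟨i, z⟩)) => .adding θ i z
    | .inr (.inr θ) => .transition θ
  refine Finite.of_surjective f ?_
  rintro (θ | ⟨θ, i, z⟩ | θ)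
  · exact ⟨.inl θ, rfl⟩
  · exact ⟨.inr (.inl (θ, ⟨i, z⟩)), rfl⟩
  · exact ⟨.inr (.inr θ), rfl⟩

/-- The composition of the `S`-machine `S` with the adding machine. -/
def compZ : SMachine (2 * n) where
  Q := CompState S
  A := S.A × Fin 2
  R := CompRule S
  finite_Q := finite_compState S
  finite_A := by have := S.finite_A; infer_instance
  finite_R := finite_compRule S
  part := CompState.place
  part_surjective := by
    intro j
    rcases place_cases j with ⟨i, rfl⟩ | ⟨i, rfl⟩
    · obtain ⟨q, hq⟩ := S.part_surjective i
      exact ⟨.k q, congrArg kPlace hq⟩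
    · exact ⟨.p i, rfl⟩
  tape := S.compTape
  tape_last := by
    have h : Fin.last (2 * n) = kPlace (Fin.last n) := rfl
    rw [h, compTape, interleave_kPlace, S.tape_last]
    rfl
  src := CompRule.src
  tgt := CompRule.tgt
  dom := CompRule.dom
  src_fits := CompRule.src_fits
  tgt_fits := CompRule.tgt_fits
  dom_subset := CompRule.dom_subset

end SMachine

/-- The occurrence of letters number `i, …, j` (counted from `0`) of the word `w` is contained in an
occurrence of a subword that belongs to `B`. -/
def CoveredAt {α : Type} (B : Set (List α)) (w : List α) (i j : ℕ) : Prop :=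
  ∃ s d e : List α, w = s ++ d ++ e ∧ d ∈ B ∧ s.length ≤ i ∧ j < s.length + d.length

/-- A word is `B`-covered if every letter of it belongs to a subword from `B`, and it has the form
`x v x` for some letter `x`. -/
def IsCovered {α : Type} (B : Set (List α)) (w : List α) : Prop :=
  (∀ i, i < w.length → CoveredAt B w i i) ∧ ∃ x v, w = x :: (v ++ [x])

/-- A word is `B`-narrow if it has no `B`-covered subwords. -/
def IsNarrow {α : Type} (B : Set (List α)) (w : List α) : Prop :=
  ∀ c, c <:+: w → ¬ IsCovered B c

/-! Take for `B` all base words of length at most `K₀` for which the width bound holds with some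
constant (`Good`). This set is finite, so one constant serves all of it, and a word of `B` covers
its own letters. It remains to find in each long base word a good subword x v x of bounded length.

The width is estimated gap by gap (`good_of_ends`). Between two K-letters of the same sign the tape
is empty. Between K⁻¹ and K the word never changes. Between K and K⁻¹ it is conjugated by the rules
of S, in general without control. A pair x⁻¹ x elsewhere in the base tames this, because its gap
must be nontrivial. If x is a K-letter, no basic rule is applicable. If x is a P-letter, its adding
machine can never pass between the phases one and three, so a rule of S can only be undone. Among
three occurrences of a letter at suitable positions, either a segment between consecutive ones
contains no K K⁻¹, or a pair x⁻¹ x stands between two such turns (`exists_good_segment`).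

There remains a P-letter with its two gaps (`exists_tripleComp_len_le`). The left tape of an adding
machine is a vertex x of the Cayley tree of a free group, and the right tape is (flat x)⁻¹ c, where
c is preserved. A reduced computation becomes a path without backtracking in a graph over this tree.
Its closed paths are those of a binary counter (`IsPath.loopSpec`): they exist at o only if the
right tape is a positive word L, they take about 2 ^ |L| steps, and they stay within distance |L| of
o. Hence a run stays near the geodesic between its ends, in comparison with the right tape on that
geodesic (`IsPath.near_geodesic`). Coarse convexity of length functions then bounds a run by its
ends. If the left neighbour is P⁻¹, only a conjugate x⁻¹ w x is controlled; but then x is near a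
power of w, and powers stay almost geodesic under `flat` (`CoarseConvex.map_between`).

Finally the runs are glued. If the right neighbour is P⁻¹, the right tape is never trivial; apart
from counting only phase switches are possible, and two of them cannot enclose a run of counting. If
it is a K-letter, the content, corrected by the rule of S in force (`Conf.origin`), can change only
at phase switches. There the content is short because of an end of the computation, or it has been
carried completely across the P-letter. The latter takes exponential time and produces the logarithm
(`TripleComp.len_content_le_of_exit`). -/

namespace FreeGroup

/-! ### Lengths, distances and tree geometry in free groups. -/

/-- The length of the reduced word representing an element of a free group. -/
noncomputable def len {α : Type} (x : FreeGroup α) : ℕ :=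
  @FreeGroup.norm _ (Classical.decEq _) x

/-- The distance of two vertices of the Cayley tree. -/
noncomputable def dst {α : Type} (x y : FreeGroup α) : ℕ := len (x⁻¹ * y)

section Length

variable {α : Type}

@[simp] theorem len_one : len (1 : FreeGroup α) = 0 := by classical exact norm_one

@[simp] theorem len_inv (x : FreeGroup α) : len x⁻¹ = len x := by classical exact norm_inv_eq

theorem len_eq_zero {x : FreeGroup α} : len x = 0 ↔ x = 1 := by classical exact norm_eq_zero

theorem len_mul_le (x y : FreeGroup α) : len (x * y) ≤ len x + len y := by
  classical exact norm_mul_le x y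

theorem len_mk_le (L : List (α × Bool)) : len (mk L) ≤ L.length := by
  classical exact norm_mk_le

theorem len_mk {L : List (α × Bool)} (h : IsReduced L) : len (mk L) = L.length := by
  classical
  have : len (mk L) = (reduce L).length := by
    rw [← toWord_mk]; unfold len norm; congr 2
  rw [this, h.reduce_eq]

theorem exists_reduced (x : FreeGroup α) : ∃ L, IsReduced L ∧ x = mk L := by
  classical exact ⟨x.toWord, isReduced_toWord, mk_toWord.symm⟩

/-- Two reduced words decompose with a common prefix such that the remainders do not cancel. -/
theorem exists_common_prefix : ∀ (L M : List (α × Bool)), IsReduced L → IsReduced M →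
    ∃ P L' M', L = P ++ L' ∧ M = P ++ M' ∧ (L'.head? = none ∨ L'.head? ≠ M'.head?) := by
  intro L
  induction L with
  | nil => intro M _ _; exact ⟨[], [], M, rfl, rfl, Or.inl rfl⟩
  | cons x L ih =>
    intro M hL hM
    by_cases h : M.head? = some x
    · obtain ⟨M, rfl⟩ : ∃ M', M = x :: M' := by
        cases M with
        | nil => simp at h
        | cons y M => simp at h; exact ⟨M, by rw [h]⟩
      obtain ⟨P, L', M', h1, h2, h3⟩ := ih M (hL.infix ⟨[x], [], by simp⟩)
        (hM.infix ⟨[x], [], by simp⟩)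
      exact ⟨x :: P, L', M', by simp [h1], by simp [h2], h3⟩
    · exact ⟨[], x :: L, M, rfl, rfl, Or.inr (by simpa using fun h' => h h'.symm)⟩

theorem IsReduced.invRev {L : List (α × Bool)} (h : IsReduced L) : IsReduced (invRev L) := by
  classical
  rw [isReduced_iff_reduce_eq, reduce_invRev, h.reduce_eq]

theorem isReduced_invRev_append {L M : List (α × Bool)} (hL : IsReduced L) (hM : IsReduced M)
    (h : L.head? = none ∨ L.head? ≠ M.head?) : IsReduced (FreeGroup.invRev L ++ M) := by
  refine List.IsChain.append hL.invRev hM ?_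
  intro x hx y hy hxy
  rcases L with _ | ⟨l, L⟩
  · simp [FreeGroup.invRev] at hx
  · rcases M with _ | ⟨m, M⟩
    · simp at hy
    · simp [FreeGroup.invRev] at hx hy h
      subst hx hy
      by_contra hne
      apply h
      ext
      · exact hxy
      · cases h1 : l.2 <;> cases h2 : m.2 <;> simp_all

/-- The length of the longest common prefix of two lists. -/
def _root_.List.lcp {β : Type} [DecidableEq β] : List β → List β → ℕ
  | x :: l, y :: m => if x = y then List.lcp l m + 1 else 0
  | _, _ => 0

/-- Common prefixes are ultrametric. For reduced words the length of the common prefix is the Gromov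
product based at 1 (`dst_mk`), so this is the combinatorial form of the tree property. -/
theorem _root_.List.lcp_min {β : Type} [DecidableEq β] (l m n : List β) :
    min (l.lcp m) (m.lcp n) ≤ l.lcp n := by
  induction l generalizing m n with
  | nil => cases m <;> simp [List.lcp]
  | cons x l ih =>
    cases m with
    | nil => simp [List.lcp]
    | cons y m =>
      cases n with
      | nil => simp [List.lcp]
      | cons z n =>
        have := ih m n
        simp only [List.lcp]
        split_ifs <;> simp_all

theorem _root_.List.lcp_append {β : Type} [DecidableEq β] (p l m : List β)
    (h : l.head? = none ∨ l.head? ≠ m.head?) : (p ++ l).lcp (p ++ m) = p.length := by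
  induction p with
  | nil => cases l <;> cases m <;> simp_all [List.lcp]
  | cons x p ih => simp [List.lcp, ih]

theorem dst_mk [DecidableEq α] {L M : List (α × Bool)} (hL : IsReduced L) (hM : IsReduced M) :
    dst (mk L) (mk M) + 2 * L.lcp M = L.length + M.length := by
  obtain ⟨P, L', M', rfl, rfl, h⟩ := exists_common_prefix L M hL hM
  have h1 : (mk (P ++ L'))⁻¹ * mk (P ++ M') = mk (FreeGroup.invRev L' ++ M') := by
    rw [← mul_mk, ← mul_mk, ← mul_mk, ← inv_mk]; group
  rw [List.lcp_append _ _ _ h, dst, h1, len_mk (isReduced_invRev_append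
    (hL.infix ⟨P, [], by simp⟩) (hM.infix ⟨P, [], by simp⟩) h)]
  simp [FreeGroup.invRev]
  omega

theorem dst_comm (x y : FreeGroup α) : dst x y = dst y x := by
  rw [dst, dst, ← len_inv]; congr 1; group

@[simp] theorem dst_self (x : FreeGroup α) : dst x x = 0 := by simp [dst]

theorem dst_eq_zero {x y : FreeGroup α} : dst x y = 0 ↔ x = y := by
  rw [dst, len_eq_zero, inv_mul_eq_one]

theorem dst_triangle (x y z : FreeGroup α) : dst x z ≤ dst x y + dst y z := by
  have := len_mul_le (x⁻¹ * y) (y⁻¹ * z)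
  rwa [show x⁻¹ * y * (y⁻¹ * z) = x⁻¹ * z by group] at this

@[simp] theorem dst_mul_left (g x y : FreeGroup α) : dst (g * x) (g * y) = dst x y := by
  unfold dst; congr 1; group

@[simp] theorem dst_one_left (x : FreeGroup α) : dst 1 x = len x := by simp [dst]

/-- The four point inequality: the Cayley graph of a free group is a tree. -/
theorem dst_four_point (x y z w : FreeGroup α) :
    dst x y + dst z w ≤ max (dst x z + dst y w) (dst x w + dst y z) := by
  classical
  have key : ∀ y z w : FreeGroup α,
      dst 1 y + dst z w ≤ max (dst 1 z + dst y w) (dst 1 w + dst y z) := by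
    intro y z w
    obtain ⟨Y, hY, rfl⟩ := exists_reduced y
    obtain ⟨Z, hZ, rfl⟩ := exists_reduced z
    obtain ⟨W, hW, rfl⟩ := exists_reduced w
    have h1 := dst_mk hZ hW
    have h2 := dst_mk hY hW
    have h3 := dst_mk hY hZ
    have h4 := dst_mk hZ hY
    rw [dst_comm] at h4
    -- In terms of Gromov products at 1 the four point inequality is exactly this one; the general
    -- base point follows by translation.
    have h5 := List.lcp_min Z Y W
    rw [dst_one_left, dst_one_left, dst_one_left, len_mk hY, len_mk hZ, len_mk hW]
    omega
  have := key (x⁻¹ * y) (x⁻¹ * z) (x⁻¹ * w)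
  rw [← inv_mul_cancel x] at this
  simpa only [dst_mul_left] using this

/-- `o` lies on the geodesic from `x` to `y`. -/
def Between (x o y : FreeGroup α) : Prop := dst x o + dst o y = dst x y

/-- The median of three vertices. -/
theorem exists_median (x y z : FreeGroup α) :
    ∃ o, Between x o y ∧ Between x o z ∧ Between y o z := by
  classical
  obtain ⟨Y, hY, hY'⟩ := exists_reduced (x⁻¹ * y)
  obtain ⟨Z, hZ, hZ'⟩ := exists_reduced (x⁻¹ * z)
  have hy : y = x * mk Y := by rw [← hY']; group
  have hz : z = x * mk Z := by rw [← hZ']; group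
  have hd := dst_mk hY hZ
  obtain ⟨P, L', M', rfl, rfl, h⟩ := exists_common_prefix Y Z hY hZ
  rw [List.lcp_append _ _ _ h] at hd
  have h1 : dst x (x * mk P) = P.length := by
    rw [dst, inv_mul_cancel_left, len_mk (hY.infix ⟨[], L', by simp⟩)]
  have h2 : dst (x * mk P) y = L'.length := by
    rw [hy, dst_mul_left, dst, ← mul_mk, inv_mul_cancel_left,
      len_mk (hY.infix ⟨P, [], by simp⟩)]
  have h3 : dst (x * mk P) z = M'.length := by
    rw [hz, dst_mul_left, dst, ← mul_mk, inv_mul_cancel_left,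
      len_mk (hZ.infix ⟨P, [], by simp⟩)]
  have h4 : dst x y = P.length + L'.length := by rw [dst, hY', len_mk hY]; simp
  have h5 : dst x z = P.length + M'.length := by rw [dst, hZ', len_mk hZ]; simp
  have h6 : dst y z + 2 * P.length = P.length + L'.length + (P.length + M'.length) := by
    rw [hy, hz, dst_mul_left]; simpa using hd
  refine ⟨x * mk P, ?_, ?_, ?_⟩
  · unfold Between; omega
  · unfold Between; omega
  · unfold Between; rw [dst_comm y]; omega

/-- The length of the powers of an element grows linearly. -/
theorem exists_len_pow (g : FreeGroup α) : ∃ a b : ℕ, (g ≠ 1 → 1 ≤ a) ∧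
    ∀ n : ℕ, 1 ≤ n → len (g ^ n) = n * a + b := by
  classical
  -- The element is a conjugate of a cyclically reduced word; `a` is the length of that word and `b`
  -- twice the length of the conjugator.
  refine ⟨(reduceCyclically g.toWord).length, 2 * (reduceCyclically.conjugator g.toWord).length,
    ?_, ?_⟩
  · intro hg
    by_contra h
    have h0 : reduceCyclically g.toWord = [] := by
      rw [← List.length_eq_zero_iff]; omega
    have h1 := reduceCyclically.conj_conjugator_reduceCyclically g.toWord
    rw [h0] at h1
    apply hg
    rw [← mk_toWord (x := g), ← h1, List.append_nil, ← mul_mk, ← inv_mk]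
    group
  · intro n hn
    have h : len (g ^ n) = (g ^ n).toWord.length := by
      unfold len norm; congr 2
    rw [h, toWord_pow, reduceCyclically.reduce_flatten_replicate isReduced_toWord,
      if_neg (by omega)]
    simp [FreeGroup.invRev]
    ring

theorem len_pow_mono (g : FreeGroup α) {m n : ℕ} (h : m ≤ n) : len (g ^ m) ≤ len (g ^ n) := by
  obtain ⟨a, b, -, hab⟩ := exists_len_pow g
  rcases Nat.eq_zero_or_pos m with rfl | hm
  · simp
  · rw [hab m hm, hab n (by omega)]
    gcongr

/-- The defect is the `b` of `exists_len_pow`. It says that the powers of any element, in particular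
of an image under a homomorphism, lie on a geodesic up to a bounded error. -/
theorem len_pow_add_len_pow (g : FreeGroup α) (m n : ℕ) :
    len (g ^ m) + len (g ^ n) ≤ len (g ^ (m + n)) + len g := by
  obtain ⟨a, b, -, hab⟩ := exists_len_pow g
  rcases Nat.eq_zero_or_pos m with rfl | hm
  · simp
  rcases Nat.eq_zero_or_pos n with rfl | hn
  · simp
  have h1 := hab 1 le_rfl
  rw [pow_one] at h1
  rw [hab m hm, hab n hn, hab (m + n) (by omega), h1]
  nlinarith

theorem len_lt_len_sq {g : FreeGroup α} (hg : g ≠ 1) : len g < len (g ^ 2) := by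
  obtain ⟨a, b, ha, hab⟩ := exists_len_pow g
  have h1 := hab 1 le_rfl
  rw [pow_one] at h1
  rw [h1, hab 2 (by omega)]
  have := ha hg
  omega

/-! ### Coarsely convex functions on the tree. -/

/-- A function on the vertices of the Cayley tree that is coarsely convex. -/
structure CoarseConvex (F : FreeGroup α → ℕ) : Prop where
  lipschitz : ∀ x y, F x ≤ F y + 2 * dst x y
  convex : ∀ x o y, F o + dst x y ≤ max (F x) (F y) + (dst x o + dst o y)

theorem CoarseConvex.between {F : FreeGroup α → ℕ} (hF : CoarseConvex F) {x o y : FreeGroup α}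
    (h : Between x o y) : F o ≤ max (F x) (F y) := by
  have := hF.convex x o y
  rw [h] at this
  omega

theorem coarseConvex_dst (c : FreeGroup α) : CoarseConvex fun x => dst x c where
  lipschitz x y := by
    have := dst_triangle x y c
    omega
  convex x o y := by
    have := dst_four_point o c x y
    rw [dst_comm c y, dst_comm c x, dst_comm o x] at this
    omega

/-- The conjugate measures how far `w` moves x. Convexity is the four point inequality for o, w o,
x, y, followed by triangle inequalities through w x and w y. -/
theorem coarseConvex_displacement (w : FreeGroup α) :
    CoarseConvex fun x => len (x⁻¹ * w * x) := by
  have h0 : ∀ x : FreeGroup α, len (x⁻¹ * w * x) = dst x (w * x) := fun x => by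
    rw [dst, mul_assoc]
  simp only [h0]
  constructor
  · intro x y
    have h1 := dst_triangle x y (w * x)
    have h2 := dst_triangle y (w * y) (w * x)
    rw [dst_mul_left, dst_comm y x] at h2
    omega
  · intro x o y
    have h1 := dst_four_point o (w * o) x y
    have h2 := dst_triangle (w * o) (w * y) y
    have h3 := dst_triangle (w * o) (w * x) x
    rw [dst_mul_left] at h2 h3
    have h4 := dst_comm (w * y) y
    have h5 := dst_comm (w * x) x
    have h6 := dst_comm o x
    omega

/-- An element that is not shortened by the multiplication by `w⁻¹` or `w` on the left is short in
comparison with `w` and its conjugate. -/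
theorem two_mul_len_le {w e : FreeGroup α} (hw : w ≠ 1) (h1 : len e ≤ len (w * e))
    (h2 : len e ≤ len (w⁻¹ * e)) : 2 * len e ≤ len w + len (e⁻¹ * w * e) := by
  by_contra hlt
  -- If the claim fails, `k1` forces w e and w⁻¹ e to have exactly the length of e. Then `k2` makes
  -- the square of the conjugate no longer than the conjugate, against `len_lt_len_sq`.
  have k1 := dst_four_point 1 (w * e) e w
  have k2 := dst_four_point 1 e (w⁻¹ * e) (w * e)
  have e1 : dst w (w * e) = len e := by
    have := dst_mul_left w 1 e
    rwa [mul_one, dst_one_left] at this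
  have e2 : dst e (w * e) = len (e⁻¹ * w * e) := by rw [dst, mul_assoc]
  have e3 : dst e w = len (w⁻¹ * e) := by rw [dst_comm, dst]
  have e4 : dst e (w⁻¹ * e) = len (e⁻¹ * w * e) := by
    have := dst_mul_left w e (w⁻¹ * e)
    rw [mul_inv_cancel_left] at this
    rw [← this, dst_comm, e2]
  have e5 : dst (w⁻¹ * e) (w * e) = len ((e⁻¹ * w * e) ^ 2) := by
    rw [dst, pow_two]; congr 1; group
  have hne : e⁻¹ * w * e ≠ 1 := by
    intro h
    apply hw
    have : w = e * (e⁻¹ * w * e) * e⁻¹ := by group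
    rw [this, h]; group
  have k3 := len_lt_len_sq hne
  rw [dst_comm (w * e) w, dst_comm (w * e) e] at k1
  simp only [dst_one_left] at k1 k2
  omega

/-- A vertex that is moved by `w` not far is close to a power of `w`. -/
theorem exists_near_zpow {w : FreeGroup α} (hw : w ≠ 1) (x : FreeGroup α) {b : ℕ}
    (h1 : len w ≤ b) (h2 : len (x⁻¹ * w * x) ≤ b) : ∃ (i : ℤ) (e : FreeGroup α),
      x = w ^ i * e ∧ len e ≤ b := by
  let f : ℤ → ℕ := fun i => len (w ^ (-i) * x)
  -- Choose the power of `w` nearest to x; then w^(-i) x is shortened neither by `w` nor by its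
  -- inverse.
  obtain ⟨i, hi⟩ : ∃ i, ∀ j, f i ≤ f j :=
    ⟨Function.argmin f, fun j => Function.argmin_le f j⟩
  refine ⟨i, w ^ (-i) * x, by group, ?_⟩
  have h3 := two_mul_len_le (e := w ^ (-i) * x) hw
    (by have := hi (i - 1); simp only [f] at this; convert this using 2; group)
    (by have := hi (i + 1); simp only [f] at this; convert this using 2; group)
  have h4 : (w ^ (-i) * x)⁻¹ * w * (w ^ (-i) * x) = x⁻¹ * w * x := by group
  rw [h4] at h3
  omega

/-- The map φ need not send geodesics to anything near a geodesic, but powers of one element go to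
powers of one element, and these are almost geodesic. The constant is 8 b for the comparison at the
powers themselves and 2 b for each of the passages to e and f. -/
theorem CoarseConvex.map_near_pow {β : Type} {φ : FreeGroup α →* FreeGroup β}
    (hφ : ∀ x, len (φ x) ≤ len x) {F : FreeGroup β → ℕ} (hF : CoarseConvex F) {w : FreeGroup α}
    {b : ℕ} (hb : len w ≤ b) {i : ℤ} {j : ℕ} {e f : FreeGroup α} (he : len e ≤ b)
    (hf : len f ≤ b) (h : Between 1 (w ^ i * e) (w ^ j * f)) :
    F (φ (w ^ i * e)) ≤ max (F 1) (F (φ (w ^ j * f))) + 12 * b := by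
  have hd : ∀ x y : FreeGroup α, dst (φ x) (φ y) ≤ dst x y := fun x y => by
    unfold dst; rw [← _root_.map_inv, ← _root_.map_mul]; exact hφ _
  have e1 : dst (w ^ i) (w ^ i * e) = len e := by rw [dst, inv_mul_cancel_left]
  have e2 : dst (w ^ j) (w ^ j * f) = len f := by rw [dst, inv_mul_cancel_left]
  have t1 := dst_triangle 1 (w ^ i * e) (w ^ i)
  have t2 := dst_triangle (w ^ i) (w ^ i * e) (w ^ j)
  have t3 := dst_triangle (w ^ i * e) (w ^ j * f) (w ^ j)
  have t4 := dst_triangle 1 (w ^ j) (w ^ j * f)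
  rw [dst_comm (w ^ i * e) (w ^ i), e1] at t1
  rw [e1] at t2
  rw [dst_comm (w ^ j * f) (w ^ j), e2] at t3
  rw [e2] at t4
  unfold Between at h
  have hF1 := hF.lipschitz (φ (w ^ i * e)) (φ (w ^ i))
  have hF2 := hF.lipschitz (φ (w ^ j)) (φ (w ^ j * f))
  have d1 := hd (w ^ i * e) (w ^ i)
  rw [dst_comm (w ^ i * e) (w ^ i), e1] at d1
  have d2 := hd (w ^ j) (w ^ j * f)
  rw [e2] at d2
  simp only [dst_one_left] at *
  -- Up to 4 b the power w^i lies on the geodesic from 1 to w^j. If i is outside the interval from 0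
  -- to j, then w^i is within 4 b of 1 or of w^j and the Lipschitz condition suffices; convexity is
  -- needed only inside.
  have hij : len (w ^ i) + dst (w ^ i) (w ^ j) ≤ len (w ^ j) + 4 * b := by omega
  have hmain : F (φ (w ^ i)) ≤ max (F 1) (F (φ (w ^ j))) + 8 * b := by
    rcases lt_trichotomy i 0 with hi | rfl | hi
    · obtain ⟨k, rfl⟩ : ∃ k : ℕ, i = -k := ⟨i.natAbs, by omega⟩
      have h1 : dst (w ^ (-k : ℤ)) (w ^ j) = len (w ^ (k + j)) := by
        rw [dst, pow_add]; congr 1; rw [zpow_neg, inv_inv, zpow_natCast]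
      have h2 := len_pow_mono w (show j ≤ k + j by omega)
      have h3 := hF.lipschitz (φ (w ^ (-k : ℤ))) 1
      have h4 := hd (w ^ (-k : ℤ)) 1
      rw [_root_.map_one] at h4
      rw [dst_comm _ 1, dst_one_left] at h3 h4
      rw [dst_comm _ 1, dst_one_left] at h4
      omega
    · simp
      omega
    · lift i to ℕ using hi.le
      simp only [zpow_natCast] at *
      rcases le_total i j with hle | hle
      · obtain ⟨k, rfl⟩ := Nat.exists_eq_add_of_le hle
        have h1 : ∀ g : FreeGroup β, dst (g ^ i) (g ^ (i + k)) = len (g ^ k) := fun g => by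
          rw [dst, pow_add, inv_mul_cancel_left]
        have h2 := hF.convex 1 (φ w ^ i) (φ w ^ (i + k))
        have h3 := len_pow_add_len_pow (φ w) i k
        have h4 := hφ w
        rw [h1] at h2
        simp only [dst_one_left, _root_.map_pow] at *
        omega
      · obtain ⟨k, rfl⟩ := Nat.exists_eq_add_of_le hle
        have h1 : dst (w ^ (j + k)) (w ^ j) = len (w ^ k) := by
          rw [dst_comm, dst, pow_add, inv_mul_cancel_left]
        have h2 := len_pow_mono w (show j ≤ j + k by omega)
        have h3 := hF.lipschitz (φ (w ^ (j + k))) (φ (w ^ j))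
        have h4 := hd (w ^ (j + k)) (w ^ j)
        omega
  omega

/-- A coarsely convex function is controlled along a geodesic whose ends are moved by `w ≠ 1` not
far. -/
theorem CoarseConvex.map_between {β : Type} {φ : FreeGroup α →* FreeGroup β}
    (hφ : ∀ x, len (φ x) ≤ len x) {F : FreeGroup β → ℕ} (hF : CoarseConvex F) {w : FreeGroup α}
    (hw : w ≠ 1) {b : ℕ} {o x : FreeGroup α} (hb : len w ≤ b) (hx : len (x⁻¹ * w * x) ≤ b)
    (h : Between 1 o x) : F (φ o) ≤ max (F 1) (F (φ x)) + 12 * b := by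
  have ho := (coarseConvex_displacement w).between h
  obtain ⟨i, e, rfl, he⟩ := exists_near_zpow hw o hb
    (ho.trans (by simpa using ⟨hb, hx⟩))
  obtain ⟨j, f, rfl, hf⟩ := exists_near_zpow hw x hb hx
  -- For negative j the roles of w and w⁻¹ are exchanged.
  rcases le_total 0 j with hj | hj
  · lift j to ℕ using hj
    rw [zpow_natCast] at *
    exact hF.map_near_pow hφ hb he hf h
  · obtain ⟨k, rfl⟩ : ∃ k : ℕ, j = -k := ⟨j.natAbs, by omega⟩
    have e1 : ∀ i : ℤ, w ^ i = w⁻¹ ^ (-i) := fun i => by simp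
    rw [e1 i, e1 (-k), neg_neg, zpow_natCast] at *
    exact hF.map_near_pow hφ (by rwa [len_inv]) he hf h

end Length

end FreeGroup

/-! ### Walks in the tree. -/

open FreeGroup in
/-- A walk in the Cayley tree that starts and ends on different sides of `o` visits `o`. -/
theorem FreeGroup.product_pos_step {α : Type} {o x z z' : FreeGroup α} (h : dst z z' ≤ 1)
    (hz : z ≠ o) (hz' : z' ≠ o) (hx : dst x z < dst o x + dst o z) :
    dst x z' < dst o x + dst o z' := by
  have h1 : dst o z ≠ 0 := fun h0 => hz (dst_eq_zero.1 h0).symm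
  have h2 : dst o z' ≠ 0 := fun h0 => hz' (dst_eq_zero.1 h0).symm
  have h3 := dst_four_point x z' o z
  rw [dst_comm z' z, dst_comm z' o, dst_comm x o] at h3
  omega

-- The strict inequality means that the Gromov product at o is positive: both points lie in the same
-- component of the tree without o. A walk that avoids o cannot leave its component.
open FreeGroup in
theorem FreeGroup.product_pos_walk {α : Type} {o : FreeGroup α} {f : ℕ → FreeGroup α} {m n : ℕ}
    (hmn : m ≤ n) (h : ∀ j, m ≤ j → j < n → dst (f j) (f (j + 1)) ≤ 1)
    (hne : ∀ j, m ≤ j → j ≤ n → f j ≠ o) :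
    dst (f m) (f n) < dst o (f m) + dst o (f n) := by
  induction n, hmn using Nat.le_induction with
  | base =>
    have : dst o (f m) ≠ 0 := fun h0 => hne m le_rfl le_rfl (dst_eq_zero.1 h0).symm
    simp only [dst_self]
    omega
  | succ n hmn ih =>
    exact product_pos_step (h n hmn (by omega)) (hne n hmn (by omega)) (hne (n + 1) (by omega) le_rfl)
      (ih (fun j h1 h2 => h j h1 (by omega)) fun j h1 h2 => hne j h1 (by omega))

open FreeGroup in
theorem FreeGroup.exists_visit {α : Type} {o : FreeGroup α} {f : ℕ → FreeGroup α} {m n : ℕ}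
    (hmn : m ≤ n) (h : ∀ j, m ≤ j → j < n → dst (f j) (f (j + 1)) ≤ 1)
    (ho : Between (f m) o (f n)) : ∃ j, m ≤ j ∧ j ≤ n ∧ f j = o := by
  by_contra hne
  push Not at hne
  have := product_pos_walk hmn h hne
  unfold Between at ho
  rw [dst_comm (f m) o] at ho
  omega

/-! ### The counter graph over the tree. -/

namespace Counter

open FreeGroup

/-- The states of the adding machine while it is counting; `mid a` is an auxiliary state in the
middle of the application of the rule `r12 a`. -/
inductive Stage (A : Type) : Type
  | one
  | two
  | mid (a : A)

/-- Tape letters of the left tape with exponents. -/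
abbrev TLetter (A : Type) : Type := (A × Fin 2) × Bool

variable {A : Type}

/-- A tape letter as an element of the free group. -/
def TLetter.val (l : TLetter A) : FreeGroup (A × Fin 2) := mk [l]

/-- The inverse letter. -/
def TLetter.inv (l : TLetter A) : TLetter A := (l.1, !l.2)

theorem TLetter.val_inv (l : TLetter A) : l.inv.val = l.val⁻¹ := by
  simp [TLetter.val, TLetter.inv, inv_mk, invRev]

theorem TLetter.len_val (l : TLetter A) : len l.val = 1 := by
  rw [TLetter.val, len_mk IsReduced.singleton]; rfl

theorem TLetter.eq_of_len_lt {l m : TLetter A} (h : len (l.val⁻¹ * m.val) < 2) : l = m := by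
  by_contra hne
  have h1 : l.val⁻¹ * m.val = mk [l.inv, m] := by
    rw [← TLetter.val_inv, TLetter.val, TLetter.val, mul_mk]; rfl
  have h2 : IsReduced [l.inv, m] := by
    rw [isReduced_cons_cons]
    refine ⟨fun h3 => ?_, IsReduced.singleton⟩
    obtain ⟨l1, l2⟩ := l
    obtain ⟨m1, m2⟩ := m
    simp only [TLetter.inv] at h3 ⊢
    subst h3
    cases l2 <;> cases m2 <;> simp_all
  rw [h1, len_mk h2] at h
  simp at h

theorem TLetter.val_injective : Function.Injective (TLetter.val (A := A)) := fun l m h =>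
  TLetter.eq_of_len_lt (by rw [h]; simp)

/-- The letter `a_i` with exponent `1`. -/
abbrev pos (a : A) (i : Fin 2) : TLetter A := ((a, i), true)

/-- The letter `a_i` with exponent `-1`. -/
abbrev neg (a : A) (i : Fin 2) : TLetter A := ((a, i), false)

/-- How the state changes when the position in the Cayley tree moves along a letter. -/
inductive Move : TLetter A → Stage A → Stage A → Prop
  | one_pos (a : A) : Move (pos a 1) .one .one
  | one_neg (a : A) : Move (neg a 1) .one .one
  | two_pos (a : A) : Move (pos a 0) .two .two
  | two_neg (a : A) : Move (neg a 0) .two .two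
  | mid_one (a : A) : Move (pos a 0) (.mid a) .one
  | one_mid (a : A) : Move (neg a 0) .one (.mid a)
  | mid_two (a : A) : Move (pos a 1) (.mid a) .two
  | two_mid (a : A) : Move (neg a 1) .two (.mid a)

theorem Move.symm {l : TLetter A} {φ ψ : Stage A} (h : Move l φ ψ) : Move l.inv ψ φ := by
  cases h <;> constructor

/-- Consequently a path that returns at once along the edge just used also restores the state, which
is backtracking. -/
theorem Move.unique {l : TLetter A} {φ φ' ψ : Stage A} (h : Move l φ ψ) (h' : Move l φ' ψ) :
    φ = φ' := by
  cases h <;> cases h' <;> rfl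

/-- The endomorphism that replaces the letters `a_1` by `a_0`. -/
def flat : FreeGroup (A × Fin 2) →* FreeGroup (A × Fin 2) := FreeGroup.map fun p => (p.1, 0)

theorem len_flat_le (x : FreeGroup (A × Fin 2)) : len (flat x) ≤ len x := by
  obtain ⟨L, hL, rfl⟩ := exists_reduced x
  rw [flat, map.mk, len_mk hL]
  exact (len_mk_le _).trans (by simp)

/-- The content of the right tape when the left tape is `x`. -/
def rest (c x : FreeGroup (A × Fin 2)) : FreeGroup (A × Fin 2) := (flat x)⁻¹ * c

theorem dst_flat_le (x y : FreeGroup (A × Fin 2)) : dst (flat x) (flat y) ≤ dst x y := by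
  unfold dst
  rw [← _root_.map_inv, ← _root_.map_mul]
  exact len_flat_le _

theorem len_rest_le (c x y : FreeGroup (A × Fin 2)) :
    len (rest c x) ≤ len (rest c y) + dst x y := by
  have h1 := dst_triangle (flat x) (flat y) c
  have h2 := dst_flat_le x y
  unfold dst at *
  unfold rest
  omega

/-- The positive word in the letters `a_0`. -/
def posWord (L : List A) : FreeGroup (A × Fin 2) := mk (L.map fun a => pos a 0)

theorem isReduced_posWord (L : List A) : IsReduced (L.map fun a => pos a 0) := by
  induction L with
  | nil => exact IsReduced.nil
  | cons a L ih =>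
    cases L with
    | nil => exact IsReduced.singleton
    | cons b L =>
      simp only [List.map_cons] at ih ⊢
      rw [isReduced_cons_cons]
      exact ⟨fun _ => rfl, ih⟩

theorem len_posWord (L : List A) : len (posWord L) = L.length := by
  rw [posWord, len_mk (isReduced_posWord L), List.length_map]

theorem posWord_cons (a : A) (L : List A) : posWord (a :: L) = (pos a 0).val * posWord L := by
  rw [posWord, posWord, TLetter.val, mul_mk]; rfl

theorem posWord_injective : Function.Injective (posWord (A := A)) := by
  classical
  intro L M h
  have := congrArg toWord h
  rw [posWord, posWord, toWord_mk, toWord_mk, (isReduced_posWord L).reduce_eq,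
    (isReduced_posWord M).reduce_eq] at this
  exact List.map_injective_iff.2 (fun a b hab => by simpa using hab) this

/-- The vertices of the counter graph: the left tape (a vertex of the Cayley tree) and the state. -/
abbrev Vertex (A : Type) : Type := FreeGroup (A × Fin 2) × Stage A

/-- The edges of the counter graph: the state moves along an edge of the Cayley tree, or the states
`one` and `two` are interchanged while the right tape is empty. -/
inductive Adj (c : FreeGroup (A × Fin 2)) : Vertex A → Vertex A → Prop
  | move (x : FreeGroup (A × Fin 2)) (l : TLetter A) (φ ψ : Stage A) (h : Move l φ ψ) :
      Adj c (x, φ) (x * l.val, ψ)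
  | up (x : FreeGroup (A × Fin 2)) (h : rest c x = 1) : Adj c (x, .one) (x, .two)
  | down (x : FreeGroup (A × Fin 2)) (h : rest c x = 1) : Adj c (x, .two) (x, .one)

theorem Adj.dst_le {c : FreeGroup (A × Fin 2)} {u v : Vertex A} (h : Adj c u v) :
    dst u.1 v.1 ≤ 1 := by
  cases h with
  | move x l φ ψ h => rw [dst, inv_mul_cancel_left, TLetter.len_val]
  | up x h => simp
  | down x h => simp

/-- Walks without backtracking in the counter graph. -/
structure IsPath (c : FreeGroup (A × Fin 2)) (k : ℕ) (f : ℕ → Vertex A) : Prop where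
  adj : ∀ i, i < k → Adj c (f i) (f (i + 1))
  reduced : ∀ i, i + 2 ≤ k → f i ≠ f (i + 2)

theorem IsPath.shift {c : FreeGroup (A × Fin 2)} {k : ℕ} {f : ℕ → Vertex A} (h : IsPath c k f)
    {m n : ℕ} (hmn : m + n ≤ k) : IsPath c n fun i => f (m + i) where
  adj i hi := h.adj (m + i) (by omega)
  reduced i hi := h.reduced (m + i) (by omega)

/-- `LoopData L o φ ψ v k`: a closed path of length `k` at `o`, where the right tape is the positive
word `L`, may lead from the state `φ` to the state `ψ` such that its second vertex is `v`. -/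
inductive LoopData : List A → FreeGroup (A × Fin 2) → Stage A → Stage A → Vertex A → ℕ → Prop
  | up (o) : LoopData [] o .one .two (o, .two) 1
  | down (o) : LoopData [] o .two .one (o, .one) 1
  | one_two (a L o k) (h : 2 ^ (a :: L).length ≤ k) :
      LoopData (a :: L) o .one .two (o * (pos a 1).val, .one) k
  | two_one (a L o k) (h : 2 ^ (a :: L).length ≤ k) :
      LoopData (a :: L) o .two .one (o * (pos a 0).val, .two) k
  | one_mid (a L o k) (h : 2 ^ (a :: L).length ≤ 2 * k) :
      LoopData (a :: L) o .one (.mid a) (o * (pos a 1).val, .one) k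
  | mid_one (a L o k) (h : 2 ^ (a :: L).length ≤ 2 * k) :
      LoopData (a :: L) o (.mid a) .one (o * (pos a 1).val, .two) k
  | two_mid (a L o k) (h : 2 ^ (a :: L).length ≤ 2 * k) :
      LoopData (a :: L) o .two (.mid a) (o * (pos a 0).val, .two) k
  | mid_two (a L o k) (h : 2 ^ (a :: L).length ≤ 2 * k) :
      LoopData (a :: L) o (.mid a) .two (o * (pos a 0).val, .one) k

/-- A closed path always changes the state. This is what makes a run trivial if its left tape and
phase are the same at both ends. -/
theorem LoopData.ne {L : List A} {o : FreeGroup (A × Fin 2)} {φ ψ : Stage A} {v : Vertex A} {k : ℕ}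
    (h : LoopData L o φ ψ v k) : φ ≠ ψ := by
  cases h <;> simp

theorem LoopData.pow_le {L : List A} {o : FreeGroup (A × Fin 2)} {φ ψ : Stage A} {v : Vertex A}
    {k : ℕ} (h : LoopData L o φ ψ v k) : 2 ^ L.length ≤ 2 * k := by
  cases h <;> first | omega | simp

/-- `PieceData L o φ ψ v v' k`: a closed path at `o` that does not visit `o` in between leads from
`φ` to `ψ`, its second vertex is `v` and its last but one vertex is `v'`. -/
inductive PieceData : List A → FreeGroup (A × Fin 2) → Stage A → Stage A → Vertex A → Vertex A →
    Prop
  | one_mid (a L o) : PieceData (a :: L) o .one (.mid a) (o * (pos a 1).val, .one)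
      (o * (pos a 1).val, .two)
  | mid_one (a L o) : PieceData (a :: L) o (.mid a) .one (o * (pos a 1).val, .two)
      (o * (pos a 1).val, .one)
  | two_mid (a L o) : PieceData (a :: L) o .two (.mid a) (o * (pos a 0).val, .two)
      (o * (pos a 0).val, .one)
  | mid_two (a L o) : PieceData (a :: L) o (.mid a) .two (o * (pos a 0).val, .one)
      (o * (pos a 0).val, .two)

theorem rest_mul (c x y : FreeGroup (A × Fin 2)) : rest c x = flat y * rest c (x * y) := by
  unfold rest; rw [_root_.map_mul]; group

theorem flat_pos (a : A) (i : Fin 2) : flat (pos a i).val = (pos a 0).val := by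
  simp [flat, TLetter.val]

/-- The inner closed path at o l is completed by the edge l and its return. For a negative l the
data of the inner path force its first step to lead back to (o, φ), which `hv` excludes. So l is
positive, the right tape at o is one letter longer than at o l, and the possibilities left are the
half-turns of the counter that begin or end in `mid a`. -/
theorem pieceData_of_inner {c o : FreeGroup (A × Fin 2)} {l : TLetter A} {φ φ' ψ ψ' : Stage A}
    {L : List A} {v : Vertex A} {k : ℕ} (h1 : Move l φ φ') (h2 : Move l ψ ψ')
    (h : LoopData L (o * l.val) φ' ψ' v k) (hL : rest c (o * l.val) = posWord L)
    (hv : v ≠ (o, φ)) : ∃ a, rest c o = posWord (a :: L) ∧ 2 ^ L.length ≤ k ∧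
      PieceData (a :: L) o φ ψ (o * l.val, φ') (o * l.val, ψ') := by
  have hback : ∀ (a : A) (i : Fin 2), o * (neg a i).val * (pos a i).val = o := fun a i => by
    rw [show neg a i = (pos a i).inv from rfl, TLetter.val_inv]; group
  cases h1 with
  | one_pos a =>
    refine ⟨a, by rw [rest_mul _ _ (pos a 1).val, hL, flat_pos, posWord_cons], ?_⟩
    cases h <;> cases h2 <;> exact ⟨by first | assumption | simp, by constructor⟩
  | mid_two a =>
    refine ⟨a, by rw [rest_mul _ _ (pos a 1).val, hL, flat_pos, posWord_cons], ?_⟩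
    cases h <;> cases h2 <;> exact ⟨by first | assumption | simp, by constructor⟩
  | two_pos a =>
    refine ⟨a, by rw [rest_mul _ _ (pos a 0).val, hL, flat_pos, posWord_cons], ?_⟩
    cases h <;> cases h2 <;> exact ⟨by first | assumption | simp, by constructor⟩
  | mid_one a =>
    refine ⟨a, by rw [rest_mul _ _ (pos a 0).val, hL, flat_pos, posWord_cons], ?_⟩
    cases h <;> cases h2 <;> exact ⟨by first | assumption | simp, by constructor⟩
  | one_neg a => cases h <;> cases h2 <;> exact absurd (by rw [hback]) hv
  | two_mid a => cases h <;> cases h2 <;> exact absurd (by rw [hback]) hv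
  | two_neg a => cases h <;> cases h2 <;> exact absurd (by rw [hback]) hv
  | one_mid a => cases h <;> cases h2 <;> exact absurd (by rw [hback]) hv

end Counter

/-! ### Closed paths of the counter graph. -/

namespace Counter

open FreeGroup

variable {A : Type}

/-- What is known about a closed path of length `k ≥ 1` at `o`. -/
structure LoopSpec (c o : FreeGroup (A × Fin 2)) (φ ψ : Stage A) (k : ℕ) (f : ℕ → Vertex A)
    (L : List A) : Prop where
  rest_eq : rest c o = posWord L
  data : LoopData L o φ ψ (f 1) k
  dst_le : ∀ i ≤ k, dst o (f i).1 ≤ L.length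
  len_le : ∀ i ≤ k, len (rest c (f i).1) ≤ L.length
  stay : ∃ i < k, (f i).1 = (f (i + 1)).1

theorem Adj.exists_move {c : FreeGroup (A × Fin 2)} {u v : Vertex A} (h : Adj c u v)
    (hne : u.1 ≠ v.1) : ∃ l, v.1 = u.1 * TLetter.val l ∧ Move l u.2 v.2 := by
  cases h with
  | move x l φ ψ h => exact ⟨l, rfl, h⟩
  | up x h => exact absurd rfl hne
  | down x h => exact absurd rfl hne

theorem Adj.eq_of_fst_eq {c : FreeGroup (A × Fin 2)} {u v : Vertex A} (h : Adj c u v)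
    (he : u.1 = v.1) : rest c u.1 = 1 ∧
      ((u.2 = .one ∧ v.2 = .two) ∨ (u.2 = .two ∧ v.2 = .one)) := by
  cases h with
  | move x l φ ψ h =>
    have h1 := TLetter.len_val l
    have h2 : x * l.val = x := he.symm
    rw [mul_eq_left] at h2
    rw [h2, len_one] at h1
    omega
  | up x h => exact ⟨h, Or.inl ⟨rfl, rfl⟩⟩
  | down x h => exact ⟨h, Or.inr ⟨rfl, rfl⟩⟩

/-- A continuation that begins with the edge by which the piece arrived is excluded by `hne`. What
remains is a passage between `one` and `two` through `mid a`; each half takes at least half of 2 ^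
|L| steps, so the whole takes at least 2 ^ |L|. -/
theorem LoopSpec.combine {c o : FreeGroup (A × Fin 2)} {φ χ ψ : Stage A} {k m : ℕ}
    {f : ℕ → Vertex A} {L M : List A} {v v' : Vertex A} (hm : m ≤ k)
    (hp : PieceData L o φ χ v v') (hv : f 1 = v) (hpow : 2 ^ L.length ≤ 2 * m)
    (hrest : rest c o = posWord L) (h1 : ∀ i ≤ m, dst o (f i).1 ≤ L.length)
    (h2 : ∀ i ≤ m, len (rest c (f i).1) ≤ L.length)
    (hstay : ∃ i < m, (f i).1 = (f (i + 1)).1)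
    (h : LoopSpec c o χ ψ (k - m) (fun i => f (m + i)) M) (hne : v' ≠ f (m + 1)) :
    LoopSpec c o φ ψ k f L := by
  obtain ⟨h3, h4, h5, h6, h7⟩ := h
  obtain rfl : L = M := posWord_injective (hrest.symm.trans h3)
  refine ⟨hrest, ?_, ?_, ?_, ?_⟩
  · generalize hk : k - m = j at h4
    generalize f (m + 1) = w at h4 hne
    rw [hv]
    cases hp <;> cases h4 <;> first
      | exact absurd rfl hne
      | (constructor; omega)
  · intro i hi
    rcases le_total i m with h | h
    · exact h1 i h
    · have := h5 (i - m) (by omega)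
      rwa [Nat.add_sub_cancel' h] at this
  · intro i hi
    rcases le_total i m with h | h
    · exact h2 i h
    · have := h6 (i - m) (by omega)
      rwa [Nat.add_sub_cancel' h] at this
  · obtain ⟨i, hi, h8⟩ := hstay
    exact ⟨i, by omega, h8⟩

/-- The structure of closed paths in the counter graph. -/
theorem IsPath.loopSpec {c : FreeGroup (A × Fin 2)} : ∀ {k : ℕ} {f : ℕ → Vertex A},
    IsPath c k f → 1 ≤ k → (f 0).1 = (f k).1 →
    ∃ L, LoopSpec c (f 0).1 (f 0).2 (f k).2 k f L := by
  intro k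
  induction k using Nat.strong_induction_on with
  | _ k ih =>
  intro f hf hk hclosed
  classical
  have hex : ∃ m, 1 ≤ m ∧ (f m).1 = (f 0).1 := ⟨k, hk, hclosed.symm⟩
  -- The path is cut at its first return `m`; the part after it is again closed and falls under the
  -- induction hypothesis.
  obtain ⟨m, ⟨hm1, hm⟩, hmin⟩ : ∃ m, (1 ≤ m ∧ (f m).1 = (f 0).1) ∧
      ∀ j, 1 ≤ j → j < m → (f j).1 ≠ (f 0).1 :=
    ⟨Nat.find hex, Nat.find_spec hex, fun j h1 h2 h3 => Nat.find_min hex h2 ⟨h1, h3⟩⟩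
  have hmk : m ≤ k := by
    by_contra h
    exact hmin k hk (by omega) hclosed.symm
  have hshift : ∀ n, m + n ≤ k → IsPath c n fun i => f (m + i) := fun n hn => hf.shift hn
  have htail : m < k → ∃ M, LoopSpec c (f 0).1 (f m).2 (f k).2 (k - m) (fun i => f (m + i)) M := by
    intro h
    have := ih (k - m) (by omega) (hshift (k - m) (by omega)) (by omega)
      (by rw [Nat.add_sub_cancel' hmk, add_zero, hm, hclosed])
    rw [add_zero, Nat.add_sub_cancel' hmk, hm] at this
    exact this
  -- If the position does not move at the first step, the right tape is empty, and any continuation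
  -- would start with the opposite interchange of states, that is, by backtracking.
  by_cases hstep : (f 0).1 = (f 1).1
  · obtain ⟨hr, hφ⟩ := (hf.adj 0 (by omega)).eq_of_fst_eq hstep
    rw [zero_add] at hφ
    obtain rfl : m = 1 := by
      by_contra h
      exact hmin 1 le_rfl (by omega) hstep.symm
    rcases Nat.eq_or_lt_of_le hk with rfl | hk
    · refine ⟨[], by rw [hr]; rfl, ?_, ?_, ?_, 0, by omega, hstep⟩
      · have h1 : f 1 = ((f 0).1, (f 1).2) := Prod.ext hstep.symm rfl
        rcases hφ with ⟨h2, h3⟩ | ⟨h2, h3⟩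
        · rw [h1, h2, h3]; exact .up _
        · rw [h1, h2, h3]; exact .down _
      · intro i hi
        interval_cases i
        · simp
        · rw [← hstep]; simp
      · intro i hi
        interval_cases i
        · rw [hr]; simp
        · rw [← hstep, hr]; simp
    · obtain ⟨M, h1, h2, -⟩ := htail hk
      obtain rfl : M = [] := posWord_injective (by rw [← h1, hr]; rfl)
      exfalso
      have h3 := hf.reduced 0 (by omega)
      generalize hj : k - 1 = j at h2
      rcases hφ with ⟨h4, h5⟩ | ⟨h4, h5⟩
      · rw [h5] at h2
        generalize h7 : (f k).2 = χ at h2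
        generalize h6 : f (1 + 1) = w at h2
        cases h2
        exact h3 (by rw [show 0 + 2 = 1 + 1 from rfl, h6, ← h4])
      · rw [h5] at h2
        generalize h7 : (f k).2 = χ at h2
        generalize h6 : f (1 + 1) = w at h2
        cases h2
        exact h3 (by rw [show 0 + 2 = 1 + 1 from rfl, h6, ← h4])
  · obtain ⟨l, hl, hmove⟩ := (hf.adj 0 (by omega)).exists_move hstep
    rw [zero_add] at hl hmove
    have hm2 : 2 ≤ m := by
      by_contra h
      obtain rfl : m = 1 := by omega
      exact hstep hm.symm
    have hlast : (f (m - 1)).1 ≠ (f m).1 := by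
      rw [hm]; exact hmin (m - 1) (by omega) (by omega)
    have hadj := hf.adj (m - 1) (by omega)
    rw [Nat.sub_add_cancel hm1] at hadj
    obtain ⟨l', hl', hmove'⟩ := hadj.exists_move hlast
    have hm' : (f (m - 1)).1 = (f 0).1 * l'.inv.val := by
      rw [← hm, hl', TLetter.val_inv]; group
    -- Strictly between 0 and `m` the path avoids its starting vertex of the tree, so it stays in
    -- one component and returns by the edge by which it left.
    have hsame : l = l'.inv := by
      apply TLetter.eq_of_len_lt
      have := product_pos_walk (o := (f 0).1) (f := fun i => (f i).1) (m := 1) (n := m - 1)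
        (by omega) (fun j h1 h2 => (hf.adj j (by omega)).dst_le)
        (fun j h1 h2 => hmin j h1 (by omega))
      simp only [hl, hm', dst_mul_left] at this
      have e1 : ∀ x y : FreeGroup (A × Fin 2), dst x (x * y) = len y := fun x y => by
        rw [dst, inv_mul_cancel_left]
      rw [e1, e1, TLetter.len_val, TLetter.len_val] at this
      exact this
    have hmove'' : Move l (f m).2 (f (m - 1)).2 := hsame ▸ hmove'.symm
    rw [← hsame] at hm'
    have hm3 : 3 ≤ m := by
      by_contra h
      obtain rfl : m = 2 := by omega
      exact hf.reduced 0 (by omega) (Prod.ext hm.symm (hmove.unique hmove''))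
    -- Without its first and last edge the first loop is a closed path at the neighbour, where the
    -- right tape is shorter by one letter.
    have hin := ih (m - 2) (by omega) (hf.shift (m := 1) (n := m - 2) (by omega)) (by omega)
      (by rw [show 1 + (m - 2) = m - 1 by omega, hm', ← hl])
    obtain ⟨L, h1, h2, h3, h4, h5⟩ := hin
    rw [show 1 + (m - 2) = m - 1 by omega] at h2
    simp only [add_zero] at h1 h2 h3
    rw [hl] at h1 h2 h3
    obtain ⟨a, h6, h7, h8⟩ := pieceData_of_inner hmove hmove'' h2 h1
      (fun h => hf.reduced 0 (by omega) (by rw [show 0 + 2 = 1 + 1 from rfl, h]))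
    have hf1 : f 1 = ((f 0).1 * l.val, (f 1).2) := Prod.ext hl rfl
    have hfm : f (m - 1) = ((f 0).1 * l.val, (f (m - 1)).2) := Prod.ext hm' rfl
    have hpow : 2 ^ (a :: L).length ≤ 2 * m := by
      rw [List.length_cons, pow_succ]; omega
    have hinner : ∀ i, 1 ≤ i → i ≤ m - 1 → dst (f 0).1 (f i).1 ≤ (a :: L).length ∧
        len (rest c (f i).1) ≤ (a :: L).length := by
      intro i hi1 hi2
      have e1 := h3 (i - 1) (by omega)
      have e2 := h4 (i - 1) (by omega)
      rw [Nat.add_sub_cancel' hi1] at e1 e2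
      have e3 := dst_triangle (f 0).1 ((f 0).1 * l.val) (f i).1
      have e4 : dst (f 0).1 ((f 0).1 * l.val) = 1 := by
        rw [dst, inv_mul_cancel_left, TLetter.len_val]
      rw [List.length_cons]
      omega
    have hd : ∀ i ≤ m, dst (f 0).1 (f i).1 ≤ (a :: L).length ∧
        len (rest c (f i).1) ≤ (a :: L).length := by
      intro i hi
      rcases Nat.eq_zero_or_pos i with rfl | h0
      · rw [dst_self, h6, len_posWord]; simp
      rcases Nat.eq_or_lt_of_le hi with rfl | hlt
      · rw [hm, dst_self, h6, len_posWord]; simp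
      · exact hinner i h0 (by omega)
    have hstay : ∃ i < m, (f i).1 = (f (i + 1)).1 := by
      obtain ⟨i, hi, h⟩ := h5
      exact ⟨1 + i, by omega, h⟩
    rw [← hf1, ← hfm] at h8
    rcases Nat.eq_or_lt_of_le hmk with rfl | hlt
    · refine ⟨a :: L, h6, ?_, fun i hi => (hd i hi).1, fun i hi => (hd i hi).2, hstay⟩
      generalize f (m - 1) = v' at h8
      generalize f 1 = v at h8 ⊢
      generalize (f 0).2 = φ at h8 ⊢
      generalize (f m).2 = ψ at h8 ⊢
      cases h8 <;> constructor <;> exact hpow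
    · obtain ⟨M, hM⟩ := htail hlt
      refine ⟨a :: L, LoopSpec.combine hmk h8 rfl hpow h6 (fun i hi => (hd i hi).1)
        (fun i hi => (hd i hi).2) hstay hM ?_⟩
      have := hf.reduced (m - 1) (by omega)
      rwa [show m - 1 + 2 = m + 1 by omega] at this

/-- Each vertex of a path is close to the geodesic between the ends, in comparison with the length
of the right tape. -/
theorem IsPath.near_geodesic {c : FreeGroup (A × Fin 2)} {k : ℕ} {f : ℕ → Vertex A}
    (hf : IsPath c k f) {i : ℕ} (hi : i ≤ k) : ∃ o, Between (f 0).1 o (f k).1 ∧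
      dst o (f i).1 ≤ len (rest c o) ∧ len (rest c (f i).1) ≤ len (rest c o) ∧
      ((f i).1 = o ∨ ∃ j < k, (f j).1 = (f (j + 1)).1) := by
  -- The median is visited both before and after time `i`; the part of the path between these visits
  -- is closed, and `loopSpec` applies to it.
  obtain ⟨o, h1, h2, h3⟩ := exists_median (f 0).1 (f i).1 (f k).1
  obtain ⟨m, -, hm, hmo⟩ := exists_visit (f := fun j => (f j).1) (Nat.zero_le i)
    (fun j _ hj => (hf.adj j (by omega)).dst_le) h1
  obtain ⟨n, hn, hnk, hno⟩ := exists_visit (f := fun j => (f j).1) hi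
    (fun j _ hj => (hf.adj j (by omega)).dst_le) h3
  refine ⟨o, h2, ?_⟩
  rcases Nat.eq_or_lt_of_le (hm.trans hn) with h | h
  · obtain rfl : m = i := by omega
    rw [hmo]; simp
  · obtain ⟨L, h4, -, h5, h6, j, hj, h7⟩ := (hf.shift (m := m) (n := n - m) (by omega)).loopSpec
      (by omega) (by rw [Nat.add_sub_cancel' h.le, add_zero, hmo, hno])
    have h8 := h5 (i - m) (by omega)
    have h9 := h6 (i - m) (by omega)
    rw [Nat.add_sub_cancel' hm] at h8 h9
    simp only [add_zero, hmo] at h4 h8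
    rw [h4, len_posWord]
    exact ⟨h8, h9, Or.inr ⟨m + j, by omega, h7⟩⟩

/-- A path without steps at which the position in the tree does not change visits only the
vertices of the geodesic between its ends. -/
theorem IsPath.between {c : FreeGroup (A × Fin 2)} {k : ℕ} {f : ℕ → Vertex A}
    (hf : IsPath c k f) (hmove : ∀ j < k, (f j).1 ≠ (f (j + 1)).1) {i : ℕ} (hi : i ≤ k) :
    Between (f 0).1 (f i).1 (f k).1 := by
  obtain ⟨o, h1, -, -, h | ⟨j, hj, h⟩⟩ := hf.near_geodesic hi
  · rwa [h]
  · exact absurd h (hmove j hj)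

end Counter

/-! ### Carrying a word across takes exponential time. -/

namespace Counter

open FreeGroup

variable {A : Type}

theorem Adj.symm {c : FreeGroup (A × Fin 2)} {u v : Vertex A} (h : Adj c u v) : Adj c v u := by
  cases h with
  | move x l φ ψ h =>
    have := Adj.move (c := c) (x * l.val) l.inv ψ φ h.symm
    rwa [TLetter.val_inv, mul_inv_cancel_right] at this
  | up x h => exact .down x h
  | down x h => exact .up x h

theorem IsPath.reverse {c : FreeGroup (A × Fin 2)} {k : ℕ} {f : ℕ → Vertex A}
    (hf : IsPath c k f) : IsPath c k fun i => f (k - i) where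
  adj i hi := by
    have := (hf.adj (k - (i + 1)) (by omega)).symm
    rwa [show k - (i + 1) + 1 = k - i by omega] at this
  reduced i hi := by
    have := hf.reduced (k - (i + 2)) (by omega)
    rw [show k - (i + 2) + 2 = k - i by omega] at this
    exact this.symm

theorem IsPath.extend {c : FreeGroup (A × Fin 2)} {k : ℕ} {f : ℕ → Vertex A}
    (hf : IsPath c k f) {v : Vertex A} (hv : Adj c (f k) v) (hne : 1 ≤ k → f (k - 1) ≠ v) :
    IsPath c (k + 1) fun i => if i ≤ k then f i else v where
  adj i hi := by
    rcases Nat.lt_or_ge i k with h | h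
    · simpa [h.le, Nat.succ_le_of_lt h] using hf.adj i h
    · obtain rfl : i = k := by omega
      simpa using hv
  reduced i hi := by
    rcases Nat.lt_or_ge (i + 1) k with h | h
    · simpa [show i ≤ k by omega, show i + 2 ≤ k by omega] using hf.reduced i h
    · obtain rfl : k = i + 1 := by omega
      simpa using hne (by omega)

/-- The first visit of a path to a vertex `o` comes from the direction of the starting point. -/
theorem IsPath.exists_arrival {c o : FreeGroup (A × Fin 2)} {k : ℕ} {f : ℕ → Vertex A}
    (hf : IsPath c k f) {n : ℕ} (hn : n ≤ k) (ho : (f n).1 = o) {l : TLetter A}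
    {w : List (TLetter A)} (hw : IsReduced (l :: w)) (h0 : (f 0).1 = o * FreeGroup.mk (l :: w)) :
    ∃ m, m ≤ n ∧ (f m).1 = o ∧ ∃ χ, Move l.inv χ (f m).2 ∧ 1 ≤ m ∧ f (m - 1) = (o * l.val, χ) := by
  classical
  have hex : ∃ m, (f m).1 = o := ⟨n, ho⟩
  obtain ⟨m, hm, hmin⟩ : ∃ m, (f m).1 = o ∧ ∀ j, j < m → (f j).1 ≠ o :=
    ⟨Nat.find hex, Nat.find_spec hex, fun j h => Nat.find_min hex h⟩
  have hmn : m ≤ n := by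
    by_contra h
    exact hmin n (by omega) ho
  have hm1 : 1 ≤ m := by
    by_contra h
    obtain rfl : m = 0 := by omega
    rw [hm, eq_comm, mul_eq_left] at h0
    have h1 := len_mk hw
    rw [h0] at h1
    simp at h1
  have hadj := hf.adj (m - 1) (by omega)
  rw [Nat.sub_add_cancel hm1] at hadj
  obtain ⟨l', hl', hmove⟩ := hadj.exists_move (by rw [hm]; exact hmin (m - 1) (by omega))
  have hm' : (f (m - 1)).1 = o * l'.inv.val := by rw [← hm, hl', TLetter.val_inv]; group
  -- Otherwise o would separate the starting point from the vertex before the first visit, although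
  -- the path has avoided o so far.
  have hsame : l' = l.inv := by
    by_contra hne
    have h1 := product_pos_walk (o := o) (f := fun i => (f i).1) (m := 0) (n := m - 1)
      (by omega) (fun j h1 h2 => (hf.adj j (by omega)).dst_le)
      (fun j h1 h2 => hmin j (by omega))
    simp only [h0, hm', dst_mul_left] at h1
    have e1 : ∀ y : FreeGroup (A × Fin 2), dst o (o * y) = len y := fun y => by
      rw [dst, inv_mul_cancel_left]
    have h2 : IsReduced (l' :: l :: w) := by
      rw [isReduced_cons_cons]
      refine ⟨fun h3 => ?_, hw⟩
      obtain ⟨l1, l2⟩ := l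
      obtain ⟨m1, m2⟩ := l'
      simp only [TLetter.inv] at h3 hne ⊢
      subst h3
      cases l2 <;> cases m2 <;> simp_all
    rw [e1, e1, dst_comm, dst, TLetter.val_inv, inv_inv, TLetter.val, mul_mk, len_mk hw, len_inv,
      len_mk IsReduced.singleton, List.singleton_append, len_mk h2] at h1
    simp at h1
  refine ⟨m, hmn, hm, (f (m - 1)).2, hsame ▸ hmove, hm1, Prod.ext ?_ rfl⟩
  rw [hm', hsame]
  simp [TLetter.inv]

/-- Lengths agree, so the letterwise image of the reduced word is itself reduced; two reduced words
for the same element coincide letter by letter. -/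
theorem flat_eq_self_iff {L : List (TLetter A)} (hL : IsReduced L) (h : flat (mk L) = mk L) :
    ∀ l ∈ L, l.1.2 = 0 := by
  classical
  have h1 := len_mk hL
  rw [← h, flat, map.mk] at h1
  have h2 : IsReduced (L.map fun p => (((p.1.1, 0) : A × Fin 2), p.2)) := by
    rw [isReduced_iff_reduce_eq]
    refine (List.Sublist.eq_of_length ?_ ?_)
    · exact reduce.red.sublist
    · rw [← toWord_mk]
      rw [List.length_map, ← h1]
      unfold len FreeGroup.norm
      congr 2
      exact Subsingleton.elim _ _
  have h3 : (flat (mk L)).toWord = (mk L).toWord := by rw [h]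
  rw [flat, map.mk, toWord_mk, toWord_mk, h2.reduce_eq, hL.reduce_eq] at h3
  intro l hl
  rw [← h3] at hl
  obtain ⟨p, -, rfl⟩ := List.mem_map.1 hl
  rfl

/-- To count from the word `κ` on the left tape to `κ` on the right tape takes exponential time. -/
theorem IsPath.pow_le_of_crossing {κ : FreeGroup (A × Fin 2)} {k : ℕ} {f : ℕ → Vertex A}
    (hf : IsPath κ k f) (hκ : flat κ = κ) (h0 : f 0 = (κ, .one)) (hk : f k = (1, .one)) :
    2 ^ len κ ≤ 2 * k + 1 := by
  -- If the vertex 1 is visited before the end, the remainder is a closed path there with right tape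
  -- κ, and it is long.
  have hloop : ∀ m ≤ k, (f m).1 = 1 → m ≠ k → 2 ^ len κ ≤ 2 * k + 1 := by
    intro m hm h1 h2
    obtain ⟨L, h3, h4, -⟩ := (hf.shift (m := m) (n := k - m) (by omega)).loopSpec (by omega)
      (by rw [Nat.add_sub_cancel' hm, add_zero, hk, h1])
    have h5 := h4.pow_le
    rw [add_zero, h1] at h3
    rw [show κ = rest κ 1 by simp [rest], h3, len_posWord]
    omega
  obtain ⟨W, hW, hκW⟩ := exists_reduced κ
  have hflat := flat_eq_self_iff hW (hκW ▸ hκ)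
  rcases W with _ | ⟨l, W⟩
  · rw [hκW, len_mk hW]; simp
  obtain ⟨m, hmk, hm, χ, hmove, hm1, hm'⟩ := hf.exists_arrival le_rfl (by rw [hk]) hW
    (by rw [h0, one_mul, hκW])
  rcases Nat.eq_or_lt_of_le hmk with rfl | hlt
  swap
  · exact hloop m hmk hm hlt.ne
  rw [hk] at hmove
  rw [one_mul] at hm'
  obtain ⟨⟨a, i⟩, ε⟩ := l
  obtain rfl : i = 0 := hflat _ (List.mem_cons_self)
  -- The last edge is the inverse of the first letter of κ and leads to the state `one`. No move
  -- does this along a_0⁻¹, so κ would begin with a_0⁻¹, and the last but one state would be `mid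
  -- a`.
  cases ε with
  | true => cases hmove
  | false =>
    cases hmove
    exfalso
    have hrest : rest κ (neg a 0).val = FreeGroup.mk W := by
      have e1 : κ = (neg a 0).val * FreeGroup.mk W := by rw [TLetter.val, mul_mk, hκW]; rfl
      have e2 : flat (neg a 0).val = (neg a 0).val := by simp [flat, TLetter.val]
      rw [rest, e2, e1]; group
    have hhead : ∀ w ∈ W.head?, w ≠ pos a 0 := by
      intro w hw h
      obtain ⟨W', rfl⟩ : ∃ W', W = w :: W' := by
        cases W with
        | nil => simp at hw
        | cons x W => simp at hw; exact ⟨W, by rw [hw]⟩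
      rw [isReduced_cons_cons, h] at hW
      exact absurd (hW.1 rfl) (by simp)
    have hred : IsReduced W := hW.infix ⟨[((a, 0), false)], [], by simp⟩
    -- A closed path there that ends in `mid a` needs a right tape beginning with a_0, but the right
    -- tape is what follows a_0⁻¹ in the reduced word κ. So already the first visit is in `mid a`, a
    -- state that cannot be entered from the direction of the start, nor be the starting state.
    have hmid : ∀ j ≤ m - 1, (f j).1 = (neg a 0).val → (f j).2 = .mid a := by
      intro j hj h1
      by_contra h2
      have h3 : j ≠ m - 1 := by
        rintro rfl
        rw [hm'] at h2
        exact h2 rfl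
      obtain ⟨L, h4, h5, -⟩ := (hf.shift (m := j) (n := m - 1 - j) (by omega)).loopSpec (by omega)
        (by rw [Nat.add_sub_cancel' hj, add_zero, h1, hm'])
      rw [Nat.add_sub_cancel' hj, add_zero] at h5
      rw [add_zero, h1, hrest] at h4
      have h6 : ∃ M, L = a :: M := by
        generalize (f j).2 = φ at h5
        generalize hv : (f (m - 1)).2 = ψ at h5
        generalize f (j + 1) = v at h5
        rw [hm'] at hv
        subst hv
        cases h5 <;> exact ⟨_, rfl⟩
      obtain ⟨M, rfl⟩ := h6
      classical
      have h7 := congrArg toWord h4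
      rw [posWord, toWord_mk, toWord_mk, hred.reduce_eq, (isReduced_posWord _).reduce_eq] at h7
      exact hhead (pos a 0) (by rw [h7]; rfl) rfl
    rcases W with _ | ⟨l, W⟩
    · have := hmid 0 (by omega) (by rw [h0, hκW]; rfl)
      rw [h0] at this
      cases this
    · obtain ⟨n, hn, h1, χ, h2, h3, -⟩ := hf.exists_arrival (n := m - 1) (by omega) (by rw [hm'])
        hred (by rw [h0, hκW, TLetter.val, mul_mk]; rfl)
      rw [hmid n hn h1] at h2
      have h4 := hflat l (by simp)
      obtain ⟨⟨b, i⟩, ε⟩ := l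
      obtain rfl : i = 0 := h4
      cases ε with
      | true =>
        have h5 : b = a := by
          generalize hφ : Stage.mid a = φ at h2
          cases h2 <;> cases hφ; rfl
        exact hhead (pos b 0) rfl (by rw [h5])
      | false =>
        cases h2

end Counter

/-! ### Runs of the adding machine as paths of the counter graph. -/

namespace Counter

open FreeGroup

variable {A : Type} {s : Set A}

/-- The rules of the adding machine and their inverses. -/
abbrev ZStep (s : Set A) : Type := ZRule s × Bool

namespace ZStep

/-- The word by which the left tape is multiplied. -/
def left (ρ : ZStep s) : FreeGroup (A × Fin 2) := if ρ.2 then ρ.1.left else ρ.1.left⁻¹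

/-- The word by which the right tape is multiplied. -/
def right (ρ : ZStep s) : FreeGroup (A × Fin 2) := if ρ.2 then ρ.1.right else ρ.1.right⁻¹

/-- The phase before the step. -/
def source (ρ : ZStep s) : Phase := if ρ.2 then ρ.1.source else ρ.1.target

/-- The phase after the step. -/
def target (ρ : ZStep s) : Phase := if ρ.2 then ρ.1.target else ρ.1.source

/-- The inverse step. -/
def inv (ρ : ZStep s) : ZStep s := (ρ.1, !ρ.2)

/-- The step belongs to the transition between the phases `one` and `three`. -/
def IsExit (ρ : ZStep s) : Prop := ρ.1 = .r13

/-- The step belongs to the transition from `two` to `one` that tests whether the right tape is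
empty. -/
def IsTest (ρ : ZStep s) : Prop := ρ.1 = .r21

theorem right_eq (ρ : ZStep s) : ρ.right = (flat ρ.left)⁻¹ := by
  obtain ⟨z, ε⟩ := ρ
  cases z <;> cases ε <;> simp [right, left, ZRule.left, ZRule.right, ZRule.a0, ZRule.a1, flat]

theorem source_inv (ρ : ZStep s) : ρ.inv.source = ρ.target := by
  obtain ⟨z, ε⟩ := ρ
  cases ε <;> rfl

end ZStep

/-- The state of the counter that corresponds to a phase of the adding machine. -/
def stage : Phase → Stage A
  | .one => .one
  | _ => .two

/-- The vertex of the counter graph next to the vertex with left tape `x` on the way that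
corresponds to a step of the adding machine. -/
def nextVertex (x : FreeGroup (A × Fin 2)) : ZStep s → Vertex A
  | (.r1 a, true) => (x * (neg a.1 1).val, .one)
  | (.r1 a, false) => (x * (pos a.1 1).val, .one)
  | (.r12 a, true) => (x * (neg a.1 0).val, .mid a)
  | (.r12 a, false) => (x * (neg a.1 1).val, .mid a)
  | (.r2 a, true) => (x * (pos a.1 0).val, .two)
  | (.r2 a, false) => (x * (neg a.1 0).val, .two)
  | (.r3 a, true) => (x * (pos a.1 0).val, .two)
  | (.r3 a, false) => (x * (neg a.1 0).val, .two)
  | (.r21, true) => (x, .one)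
  | (.r21, false) => (x, .two)
  | (.r13, _) => (x, .two)

/-- Phase and first vertex determine the step. This turns reduced histories into paths without
backtracking, although the phases two and three share one state of the counter. -/
theorem nextVertex_injective (x : FreeGroup (A × Fin 2)) {ρ ρ' : ZStep s}
    (h1 : ρ.source = ρ'.source) (h2 : ¬ρ.IsExit) (h3 : ¬ρ'.IsExit)
    (h : nextVertex x ρ = nextVertex x ρ') : ρ = ρ' := by
  have hone : ∀ l : TLetter A, x * l.val ≠ x := fun l hl => by
    rw [mul_eq_left] at hl
    have := TLetter.len_val l
    rw [hl, len_one] at this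
    omega
  obtain ⟨z, ε⟩ := ρ
  obtain ⟨z', ε'⟩ := ρ'
  cases z <;> cases ε <;> cases z' <;> cases ε' <;>
    simp_all [nextVertex, ZStep.source, ZRule.source, ZRule.target, ZStep.IsExit,
      TLetter.val_injective.eq_iff, Subtype.ext_iff, eq_comm]

/-- A computation of the adding machine in which the phase `three` is not entered or left: `ρ` is
its history, `x` is the left tape and `φ` is the phase; `c` is the content of both tapes. -/
structure IsRun (c : FreeGroup (A × Fin 2)) (n : ℕ) (ρ : ℕ → ZStep s)
    (x : ℕ → FreeGroup (A × Fin 2)) (φ : ℕ → Phase) : Prop where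
  source : ∀ j < n, (ρ j).source = φ j
  target : ∀ j < n, (ρ j).target = φ (j + 1)
  left : ∀ j < n, x (j + 1) = x j * (ρ j).left
  not_exit : ∀ j < n, ¬(ρ j).IsExit
  test : ∀ j < n, (ρ j).IsTest → rest c (x j) = 1
  reduced : ∀ j, j + 1 < n → ρ (j + 1) ≠ (ρ j).inv

/-- A step of the adding machine is a path of length one or two in the counter graph. -/
theorem exists_path_of_step {c x : FreeGroup (A × Fin 2)} {ρ : ZStep s} (h : ¬ρ.IsExit)
    (ht : ρ.IsTest → rest c x = 1) {k : ℕ} {f : ℕ → Vertex A} (hf : IsPath c k f)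
    (hk : f k = (x, stage ρ.source)) (hne : 1 ≤ k → f (k - 1) ≠ nextVertex x ρ) :
    ∃ (m : ℕ) (g : ℕ → Vertex A), k + 1 ≤ m ∧ m ≤ k + 2 ∧ IsPath c m g ∧ (∀ i ≤ k, g i = f i) ∧
      g m = (x * ρ.left, stage ρ.target) ∧ g (m - 1) = nextVertex (x * ρ.left) ρ.inv ∧
      (¬ρ.IsTest → ∀ i, k ≤ i → i < m → (g i).1 ≠ (g (i + 1)).1) := by
  have hone : ∀ (y : FreeGroup (A × Fin 2)) (l : TLetter A), y ≠ y * l.val := fun y l hl => by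
    rw [eq_comm, mul_eq_left] at hl
    have := TLetter.len_val l
    rw [hl, len_one] at this
    omega
  have single : ∀ v : Vertex A, Adj c (x, stage ρ.source) v → nextVertex x ρ = v →
      v = (x * ρ.left, stage ρ.target) → (x, stage ρ.source) = nextVertex (x * ρ.left) ρ.inv →
      (¬ρ.IsTest → v.1 ≠ x) →
      ∃ (m : ℕ) (g : ℕ → Vertex A), k + 1 ≤ m ∧ m ≤ k + 2 ∧ IsPath c m g ∧ (∀ i ≤ k, g i = f i) ∧
        g m = (x * ρ.left, stage ρ.target) ∧ g (m - 1) = nextVertex (x * ρ.left) ρ.inv ∧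
        (¬ρ.IsTest → ∀ i, k ≤ i → i < m → (g i).1 ≠ (g (i + 1)).1) := by
    intro v h1 h2 h3 h4 h5
    refine ⟨k + 1, _, le_rfl, by omega, hf.extend (hk ▸ h1) (h2 ▸ hne), ?_, ?_, ?_, ?_⟩
    · intro i hi; simp [hi]
    · simpa using h3
    · simpa [hk] using h4
    · intro h6 i hi1 hi2
      obtain rfl : i = k := by omega
      simpa [hk] using (h5 h6).symm
  -- Only `r12` and its inverse need two edges, with the state `mid a` in between; this is the
  -- source of the factor 2 between the lengths of runs and of paths.
  have double : ∀ v w : Vertex A, Adj c (x, stage ρ.source) v → Adj c v w → nextVertex x ρ = v →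
      w = (x * ρ.left, stage ρ.target) → v = nextVertex (x * ρ.left) ρ.inv →
      (x, stage ρ.source) ≠ w → v.1 ≠ x → v.1 ≠ w.1 →
      ∃ (m : ℕ) (g : ℕ → Vertex A), k + 1 ≤ m ∧ m ≤ k + 2 ∧ IsPath c m g ∧ (∀ i ≤ k, g i = f i) ∧
        g m = (x * ρ.left, stage ρ.target) ∧ g (m - 1) = nextVertex (x * ρ.left) ρ.inv ∧
        (¬ρ.IsTest → ∀ i, k ≤ i → i < m → (g i).1 ≠ (g (i + 1)).1) := by
    intro v w h1 h2 h3 h4 h5 h6 h7 h8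
    refine ⟨k + 2, _, by omega, le_rfl,
      (hf.extend (hk ▸ h1) (h3 ▸ hne)).extend (v := w) (by simpa using h2)
        (fun _ => by simpa [hk] using h6), ?_, ?_, ?_, ?_⟩
    · intro i hi; simp [hi, show i ≤ k + 1 by omega]
    · simpa using h4
    · simpa using h5
    · intro _ i hi1 hi2
      rcases (by omega : i = k ∨ i = k + 1) with rfl | rfl
      · simpa [hk] using h7.symm
      · simpa using h8
  have hv : ∀ (a : A) (i : Fin 2), (pos a i).val = of (a, i) := fun a i => rfl
  have hv' : ∀ (a : A) (i : Fin 2), (neg a i).val = (of (a, i))⁻¹ := fun a i => by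
    rw [← hv, ← TLetter.val_inv]; rfl
  obtain ⟨z, ε⟩ := ρ
  cases z with
  | r13 => exact absurd rfl h
  | r21 =>
    have hr := ht rfl
    cases ε
    · refine single (x, .two) (.up x hr) rfl ?_ ?_ (fun h => absurd rfl h) <;>
        simp [ZStep.left, ZRule.left, ZStep.target, ZRule.source, ZStep.source, ZRule.target, stage,
          ZStep.inv, nextVertex]
    · refine single (x, .one) (.down x hr) rfl ?_ ?_ (fun h => absurd rfl h) <;>
        simp [ZStep.left, ZRule.left, ZStep.target, ZRule.source, ZStep.source, ZRule.target, stage,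
          ZStep.inv, nextVertex]
  | r1 a =>
    cases ε
    · refine single _ (.move x (pos a.1 1) _ _ (.one_pos _)) rfl ?_ ?_ (fun _ => (hone _ _).symm) <;>
        simp [ZStep.left, ZRule.left, ZStep.target, ZRule.source, ZStep.source, ZRule.target, stage,
          ZStep.inv, nextVertex, ZRule.a1, hv, hv']
    · refine single _ (.move x (neg a.1 1) _ _ (.one_neg _)) rfl ?_ ?_ (fun _ => (hone _ _).symm) <;>
        simp [ZStep.left, ZRule.left, ZStep.target, ZRule.source, ZStep.source, ZRule.target, stage,
          ZStep.inv, nextVertex, ZRule.a1, hv, hv']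
  | r2 a =>
    cases ε
    · refine single _ (.move x (neg a.1 0) _ _ (.two_neg _)) rfl ?_ ?_ (fun _ => (hone _ _).symm) <;>
        simp [ZStep.left, ZRule.left, ZStep.target, ZRule.source, ZStep.source, ZRule.target, stage,
          ZStep.inv, nextVertex, ZRule.a0, hv, hv']
    · refine single _ (.move x (pos a.1 0) _ _ (.two_pos _)) rfl ?_ ?_ (fun _ => (hone _ _).symm) <;>
        simp [ZStep.left, ZRule.left, ZStep.target, ZRule.source, ZStep.source, ZRule.target, stage,
          ZStep.inv, nextVertex, ZRule.a0, hv, hv']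
  | r3 a =>
    cases ε
    · refine single _ (.move x (neg a.1 0) _ _ (.two_neg _)) rfl ?_ ?_ (fun _ => (hone _ _).symm) <;>
        simp [ZStep.left, ZRule.left, ZStep.target, ZRule.source, ZStep.source, ZRule.target, stage,
          ZStep.inv, nextVertex, ZRule.a0, hv, hv']
    · refine single _ (.move x (pos a.1 0) _ _ (.two_pos _)) rfl ?_ ?_ (fun _ => (hone _ _).symm) <;>
        simp [ZStep.left, ZRule.left, ZStep.target, ZRule.source, ZStep.source, ZRule.target, stage,
          ZStep.inv, nextVertex, ZRule.a0, hv, hv']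
  | r12 a =>
    cases ε
    · refine double _ _ (.move x (neg a.1 1) _ _ (.two_mid _))
        (.move _ (pos a.1 0) _ _ (.mid_one _)) rfl ?_ ?_ ?_ (hone _ _).symm (hone _ _) <;>
        simp [ZStep.left, ZRule.left, ZStep.target, ZRule.source, ZStep.source, ZRule.target, stage,
          ZStep.inv, nextVertex, ZRule.a0, ZRule.a1, hv, hv', mul_assoc]
    · refine double _ _ (.move x (neg a.1 0) _ _ (.one_mid _))
        (.move _ (pos a.1 1) _ _ (.mid_two _)) rfl ?_ ?_ ?_ (hone _ _).symm (hone _ _) <;>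
        simp [ZStep.left, ZRule.left, ZStep.target, ZRule.source, ZStep.source, ZRule.target, stage,
          ZStep.inv, nextVertex, ZRule.a0, ZRule.a1, hv, hv', mul_assoc]

/-- A computation of the adding machine as a path in the counter graph. -/
theorem IsRun.exists_path {c : FreeGroup (A × Fin 2)} {n : ℕ} {ρ : ℕ → ZStep s}
    {x : ℕ → FreeGroup (A × Fin 2)} {φ : ℕ → Phase} (h : IsRun c n ρ x φ) :
    ∃ (k : ℕ) (f : ℕ → Vertex A), n ≤ k ∧ k ≤ 2 * n ∧ IsPath c k f ∧
      (∀ j ≤ n, ∃ i ≤ k, f i = (x j, stage (φ j))) ∧ f 0 = (x 0, stage (φ 0)) ∧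
      f k = (x n, stage (φ n)) ∧ (1 ≤ n → f (k - 1) = nextVertex (x n) (ρ (n - 1)).inv) ∧
      ((∀ j < n, ¬(ρ j).IsTest) → ∀ i < k, (f i).1 ≠ (f (i + 1)).1) := by
  induction n with
  | zero =>
    refine ⟨0, fun _ => (x 0, stage (φ 0)), le_rfl, le_rfl, ⟨by simp, by simp⟩, ?_, rfl, rfl, by simp,
      by simp⟩
    intro j hj
    obtain rfl : j = 0 := by omega
    exact ⟨0, le_rfl, rfl⟩
  | succ n ih =>
    obtain ⟨k, f, h1, h2, h3, h4, h5, h6, h7, h8⟩ := ih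
      ⟨fun j hj => h.source j (by omega), fun j hj => h.target j (by omega),
        fun j hj => h.left j (by omega), fun j hj => h.not_exit j (by omega),
        fun j hj => h.test j (by omega), fun j hj => h.reduced j (by omega)⟩
    -- The previous vertex is the first vertex of the inverse of the previous step, so equality
    -- would make two consecutive steps inverse to each other.
    have hne : 1 ≤ k → f (k - 1) ≠ nextVertex (x n) (ρ n) := by
      intro hk heq
      have hn : 1 ≤ n := by omega
      rw [h7 hn] at heq
      have hred := h.reduced (n - 1) (by omega)
      rw [Nat.sub_add_cancel hn] at hred
      have htgt := h.target (n - 1) (by omega)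
      rw [Nat.sub_add_cancel hn] at htgt
      refine hred (nextVertex_injective (x n) ?_ ?_ (h.not_exit n (by omega)) heq).symm
      · rw [h.source n (by omega), ← htgt]
        exact ZStep.source_inv _
      · exact h.not_exit (n - 1) (by omega)
    obtain ⟨m, g, g1, g2, g3, g4, g5, g6, g7⟩ := exists_path_of_step (h.not_exit n (by omega))
      (h.test n (by omega)) h3 (by rw [h6, h.source n (by omega)]) hne
    rw [← h.left n (by omega), h.target n (by omega)] at g5
    rw [← h.left n (by omega)] at g6
    refine ⟨m, g, by omega, by omega, g3, ?_, by rw [g4 0 (by omega), h5], g5, fun _ => g6, ?_⟩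
    · intro j hj
      rcases Nat.eq_or_lt_of_le hj with rfl | hlt
      · exact ⟨m, le_rfl, g5⟩
      · obtain ⟨i, hi, h9⟩ := h4 j (by omega)
        exact ⟨i, by omega, by rw [g4 i hi, h9]⟩
    · intro hj i hi
      rcases Nat.lt_or_ge i k with hlt | hge
      · rw [g4 i (by omega), g4 (i + 1) (by omega)]
        exact h8 (fun j h => hj j (by omega)) i hlt
      · exact g7 (hj n (by omega)) i hge hi

end Counter

/-! ### Length bounds for runs. -/

namespace Counter

open FreeGroup

variable {A : Type} {s : Set A}

theorem IsRun.near_geodesic {c : FreeGroup (A × Fin 2)} {n : ℕ} {ρ : ℕ → ZStep s}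
    {x : ℕ → FreeGroup (A × Fin 2)} {φ : ℕ → Phase} (h : IsRun c n ρ x φ) {j : ℕ} (hj : j ≤ n) :
    ∃ o, Between (x 0) o (x n) ∧ dst o (x j) ≤ len (rest c o) ∧
      len (rest c (x j)) ≤ len (rest c o) := by
  obtain ⟨k, f, -, -, hf, hv, h0, hk, -⟩ := h.exists_path
  obtain ⟨i, hi, hij⟩ := hv j hj
  obtain ⟨o, h1, h2, h3, -⟩ := hf.near_geodesic hi
  rw [hij] at h2 h3
  rw [h0, hk] at h1
  exact ⟨o, h1, h2, h3⟩

theorem IsRun.between {c : FreeGroup (A × Fin 2)} {n : ℕ} {ρ : ℕ → ZStep s}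
    {x : ℕ → FreeGroup (A × Fin 2)} {φ : ℕ → Phase} (h : IsRun c n ρ x φ)
    (ht : ∀ j < n, ¬(ρ j).IsTest) {j : ℕ} (hj : j ≤ n) : Between (x 0) (x j) (x n) := by
  obtain ⟨k, f, -, -, hf, hv, h0, hk, -, hmove⟩ := h.exists_path
  obtain ⟨i, hi, hij⟩ := hv j hj
  have h1 := hf.between (hmove ht) hi
  rwa [hij, h0, hk] at h1

/-- A closed computation that returns to the same phase is trivial. -/
theorem IsRun.eq_zero_of_closed_of_phase {c : FreeGroup (A × Fin 2)} {n : ℕ} {ρ : ℕ → ZStep s}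
    {x : ℕ → FreeGroup (A × Fin 2)} {φ : ℕ → Phase} (h : IsRun c n ρ x φ)
    (hφ : φ 0 = φ n) (hx : x 0 = x n) : n = 0 := by
  obtain ⟨k, f, h1, -, hf, hv, h0, hk, -⟩ := h.exists_path
  by_contra hn
  obtain ⟨L, -, h2, -⟩ := hf.loopSpec (by omega) (by rw [h0, hk, hx])
  exact h2.ne (by rw [h0, hk, hφ])

theorem IsRun.pow_le_of_crossing {κ : FreeGroup (A × Fin 2)} {n : ℕ} {ρ : ℕ → ZStep s}
    {x : ℕ → FreeGroup (A × Fin 2)} {φ : ℕ → Phase} (h : IsRun κ n ρ x φ) (hκ : flat κ = κ)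
    (h1 : φ 0 = .one) (h2 : φ n = .one)
    (hx : (x 0 = κ ∧ x n = 1) ∨ (x 0 = 1 ∧ x n = κ)) : 2 ^ len κ ≤ 4 * n + 1 := by
  obtain ⟨k, f, -, hk2, hf, hv, h0, hk, -⟩ := h.exists_path
  rw [h1] at h0
  rw [h2] at hk
  rcases hx with ⟨h3, h4⟩ | ⟨h3, h4⟩
  · have := hf.pow_le_of_crossing hκ (by rw [h0, h3]; rfl) (by rw [hk, h4]; rfl)
    omega
  · have := hf.reverse.pow_le_of_crossing hκ (by simp only [Nat.sub_zero]; rw [hk, h4]; rfl)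
      (by simp only [Nat.sub_self]; rw [h0, h3]; rfl)
    omega

/-- The length bound for computations with base `L p R`. -/
theorem IsRun.len_add_len_le {c : FreeGroup (A × Fin 2)} {n : ℕ} {ρ : ℕ → ZStep s}
    {x : ℕ → FreeGroup (A × Fin 2)} {φ : ℕ → Phase} (h : IsRun c n ρ x φ) {j : ℕ} (hj : j ≤ n) :
    len (x j) + len (rest c (x j)) ≤
      4 * (len (x 0) + len (rest c (x 0)) + (len (x n) + len (rest c (x n)))) := by
  obtain ⟨o, h1, h2, h3⟩ := h.near_geodesic hj
  have h4 := (coarseConvex_dst (1 : FreeGroup (A × Fin 2))).between h1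
  simp only [dst_comm _ 1, dst_one_left] at h4
  have h5 := len_rest_le c o (x 0)
  have h6 := dst_triangle 1 o (x j)
  have h7 := dst_triangle (x 0) 1 (x n)
  rw [dst_comm o (x 0)] at h5
  unfold Between at h1
  rw [dst_comm (x 0) 1] at h7
  simp only [dst_one_left] at h6 h7
  omega

/-- The length bound for computations with base `p⁻¹ p R`. -/
theorem IsRun.len_conj_add_len_le {c : FreeGroup (A × Fin 2)} {n : ℕ} {ρ : ℕ → ZStep s}
    {x : ℕ → FreeGroup (A × Fin 2)} {φ : ℕ → Phase} (h : IsRun c n ρ x φ) (h0 : x 0 = 1)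
    {w : FreeGroup (A × Fin 2)} (hw : w ≠ 1) {j : ℕ} (hj : j ≤ n) :
    len ((x j)⁻¹ * w * x j) + len (rest c (x j)) ≤
      40 * (len w + len c + (len ((x n)⁻¹ * w * x n) + len (rest c (x n)))) := by
  obtain ⟨o, h1, h2, h3⟩ := h.near_geodesic hj
  rw [h0] at h1
  -- The end x n may be long although its conjugate is short, so the right tape at o is compared
  -- along powers of w. With b the maximum in this line, the sum is at most b + 3 len (rest c o),
  -- and len (rest c o) exceeds its end values by at most 12 b; this fits into the factor 40.
  have h4 := (coarseConvex_dst c).map_between (φ := flat) len_flat_le hw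
    (b := max (len w) (len ((x n)⁻¹ * w * x n))) (le_max_left _ _) (le_max_right _ _) h1
  have h5 := (coarseConvex_displacement w).between h1
  have h6 := (coarseConvex_displacement w).lipschitz (x j) o
  rw [dst_comm] at h6
  simp only [inv_one, one_mul, mul_one] at h5
  have h7 : ∀ y, dst (flat y) c = len (rest c y) := fun y => rfl
  rw [h7, h7, dst_one_left] at h4
  omega

/-- The length bound for computations with base `L p p⁻¹`. -/
theorem IsRun.len_add_len_conj_le {c : FreeGroup (A × Fin 2)} {n : ℕ} {ρ : ℕ → ZStep s}
    {x : ℕ → FreeGroup (A × Fin 2)} {φ : ℕ → Phase} (h : IsRun c n ρ x φ)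
    (ht : ∀ j < n, ¬(ρ j).IsTest) (r : FreeGroup (A × Fin 2)) {j : ℕ} (hj : j ≤ n) :
    len (x j) ≤ max (len (x 0)) (len (x n)) ∧
      len ((flat ((x 0)⁻¹ * x j))⁻¹ * r * flat ((x 0)⁻¹ * x j)) ≤
        len r + 2 * (len (x 0) + len (x n)) := by
  -- Without tests there are no closed paths, and the run does not leave the geodesic.
  have h1 := h.between ht hj
  have h4 := (coarseConvex_dst (1 : FreeGroup (A × Fin 2))).between h1
  simp only [dst_comm _ 1, dst_one_left] at h4
  have h2 := (coarseConvex_displacement r).lipschitz (flat ((x 0)⁻¹ * x j)) 1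
  have h3 := len_flat_le ((x 0)⁻¹ * x j)
  have h7 := dst_triangle (x 0) 1 (x n)
  rw [← dst] at h3
  unfold Between at h1
  rw [dst_comm (x 0) 1] at h7
  rw [dst_comm, dst_one_left] at h2
  simp only [inv_one, one_mul, mul_one, dst_one_left] at h2 h7
  exact ⟨h4, by omega⟩

/-- The length bound for computations with base `p⁻¹ p p⁻¹`. -/
theorem IsRun.len_conj_add_len_conj_le {c : FreeGroup (A × Fin 2)} {n : ℕ} {ρ : ℕ → ZStep s}
    {x : ℕ → FreeGroup (A × Fin 2)} {φ : ℕ → Phase} (h : IsRun c n ρ x φ) (h0 : x 0 = 1)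
    (ht : ∀ j < n, ¬(ρ j).IsTest) {w : FreeGroup (A × Fin 2)} (hw : w ≠ 1)
    (r : FreeGroup (A × Fin 2)) {j : ℕ} (hj : j ≤ n) :
    len ((x j)⁻¹ * w * x j) + len ((flat (x j))⁻¹ * r * flat (x j)) ≤
      13 * (len w + len r + (len ((x n)⁻¹ * w * x n) + len ((flat (x n))⁻¹ * r * flat (x n)))) := by
  have h1 := h.between ht hj
  rw [h0] at h1
  have h4 := (coarseConvex_displacement r).map_between (φ := flat) len_flat_le hw
    (b := max (len w) (len ((x n)⁻¹ * w * x n))) (le_max_left _ _) (le_max_right _ _) h1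
  have h5 := (coarseConvex_displacement w).between h1
  simp only [inv_one, one_mul, mul_one] at h4 h5
  omega

end Counter

/-! ### The action of rules on single letters and gaps of a word. -/

namespace SMachine

open FreeGroup

section General

variable {n : ℕ} {M : SMachine n}

/-- State letter number `k` of a word that starts with the letter `a`, followed by `l`. -/
def letterAt (a : M.Letter) : List (FreeGroup M.A × M.Letter) → ℕ → M.Letter
  | _, 0 => a
  | [], _ + 1 => a
  | x :: l, k + 1 => letterAt x.2 l k

/-- The tape word after the state letter number `k`. -/
def gapAt : List (FreeGroup M.A × M.Letter) → ℕ → FreeGroup M.A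
  | [], _ => 1
  | x :: _, 0 => x.1
  | _ :: l, k + 1 => gapAt l k

/-- The inverse of a state letter. -/
def Letter.inv (a : M.Letter) : M.Letter := (a.1, !a.2)

/-- The effect of a rule on a part `a w b` of a word. -/
structure GapStep (ρ : M.Rule) (a : M.Letter) (w : FreeGroup M.A) (b : M.Letter)
    (w' : FreeGroup M.A) : Prop where
  adjacent : a.base.gapAfter = b.base.gapBefore
  reduced : ¬(w = 1 ∧ b = a.inv)
  left : a.1 = (ρ.lhs (M.part a.1)).state
  right : b.1 = (ρ.lhs (M.part b.1)).state
  exists_word : ∃ y ∈ wordsOver (M.dom ρ.1 a.base.gapAfter),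
    w = (ρ.lhs (M.part a.1)).after a.2 * y * (ρ.lhs (M.part b.1)).before b.2 ∧
    w' = (ρ.rhs (M.part a.1)).after a.2 * y * (ρ.rhs (M.part b.1)).before b.2

theorem Letter.inv_inv (a : M.Letter) : a.inv.inv = a := by simp [Letter.inv]

theorem Letter.base_inv_gapAfter (a : M.Letter) : a.inv.base.gapAfter = a.base.gapBefore := by
  obtain ⟨q, ε⟩ := a
  cases ε <;> rfl

theorem Letter.base_inv_gapBefore (a : M.Letter) : a.inv.base.gapBefore = a.base.gapAfter := by
  obtain ⟨q, ε⟩ := a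
  cases ε <;> rfl

/-- The effect of a rule on the inverse of a part of a word. -/
theorem GapStep.inv {ρ : M.Rule} {a b : M.Letter} {w w' : FreeGroup M.A}
    (h : GapStep ρ a w b w') : GapStep ρ b.inv w⁻¹ a.inv w'⁻¹ := by
  obtain ⟨h1, h2, h3, h4, y, hy, h5, h6⟩ := h
  have e1 : ∀ (P : SPart M.Q M.A) (ε : Bool), (P.after (!ε)) = (P.before ε)⁻¹ := fun P ε => by
    cases ε <;> simp [SPart.after, SPart.before]
  have e2 : ∀ (P : SPart M.Q M.A) (ε : Bool), (P.before (!ε)) = (P.after ε)⁻¹ := fun P ε => by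
    cases ε <;> simp [SPart.after, SPart.before]
  refine ⟨?_, ?_, h4, h3, y⁻¹, ?_, ?_, ?_⟩
  · rw [Letter.base_inv_gapAfter, Letter.base_inv_gapBefore, h1]
  · rintro ⟨h7, h8⟩
    refine h2 ⟨by rwa [inv_eq_one] at h7, ?_⟩
    rw [Letter.inv_inv] at h8
    exact h8.symm
  · rw [Letter.base_inv_gapAfter, ← h1]; exact inv_mem hy
  · simp only [Letter.inv, e1, e2]
    rw [h5]; group
  · simp only [Letter.inv, e1, e2]
    rw [h6]; group

theorem LetterStep.part_eq {ρ : M.Rule} {a b : M.Letter} (h : LetterStep ρ a b) :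
    M.part b.1 = M.part a.1 := by
  rw [h.2]; exact Rule.part_rhs ρ _

theorem LetterStep.base_eq {ρ : M.Rule} {a b : M.Letter} (h : LetterStep ρ a b) :
    b.base = a.base := by
  refine Prod.ext h.part_eq ?_
  rw [h.2]
  rfl

theorem TailStep.letterStep {ρ : M.Rule} {a a' : M.Letter}
    {l l' : List (FreeGroup M.A × M.Letter)} (h : TailStep ρ a l l') (ha : LetterStep ρ a a')
    {k : ℕ} (hk : k ≤ l.length) : LetterStep ρ (letterAt a l k) (letterAt a' l' k) := by
  induction h generalizing k a' with
  | nil a =>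
    obtain rfl : k = 0 := by simpa using hk
    exact ha
  | cons a b b' y w w' l l' _ _ _ _ hb _ _ ih =>
    cases k with
    | zero => exact ha
    | succ k => exact ih hb (by simpa using hk)

theorem TailStep.gapStep {ρ : M.Rule} {a a' : M.Letter}
    {l l' : List (FreeGroup M.A × M.Letter)} (h : TailStep ρ a l l') (ha : LetterStep ρ a a')
    {k : ℕ} (hk : k < l.length) :
    GapStep ρ (letterAt a l k) (gapAt l k) (letterAt a l (k + 1)) (gapAt l' k) := by
  induction h generalizing k a' with
  | nil a => simp at hk
  | cons a b b' y w w' l l' h1 h2 h3 h4 hb h6 h7 ih =>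
    cases k with
    | zero =>
      have h8 : letterAt a ((w, b) :: l) (0 + 1) = b := by cases l <;> rfl
      rw [h8]
      exact ⟨h1, h2, ha.1, hb.1, y, h3, h4, h6⟩
    | succ k => exact ih hb (by simpa using hk)

/-- State letter number `k` of a word. -/
def Word.letter (W : M.Word) (k : ℕ) : M.Letter := letterAt W.head W.tail k

/-- The tape word after the state letter number `k`. -/
def Word.gap (W : M.Word) (k : ℕ) : FreeGroup M.A := gapAt W.tail k

theorem letterAt_base (a : M.Letter) (l : List (FreeGroup M.A × M.Letter)) (k : ℕ) :
    (a.base :: l.map fun x => x.2.base)[k]? =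
      if k ≤ l.length then some (letterAt a l k).base else none := by
  induction l generalizing a k with
  | nil => cases k <;> simp [letterAt]
  | cons x l ih =>
    cases k with
    | zero => simp [letterAt]
    | succ k =>
      rw [List.map_cons, List.getElem?_cons_succ, ih]
      simp [letterAt]

theorem Word.base_getElem? (W : M.Word) {k : ℕ} (hk : k ≤ W.tail.length) :
    W.base[k]? = some (W.letter k).base := by
  rw [Word.base, letterAt_base, if_pos hk]; rfl

theorem Word.length_base (W : M.Word) : W.base.length = W.tail.length + 1 := by
  simp [Word.base]

theorem Word.length_eq (W : M.Word) :
    W.length = 1 + ∑ k ∈ Finset.range W.tail.length, (len (W.gap k) + 1) := by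
  have : ∀ l : List (FreeGroup M.A × M.Letter),
      (l.map fun x => @FreeGroup.norm _ (Classical.decEq _) x.1 + 1).sum =
        ∑ k ∈ Finset.range l.length, (len (gapAt l k) + 1) := by
    intro l
    induction l with
    | nil => rfl
    | cons x l ih =>
      rw [List.map_cons, List.sum_cons, ih, List.length_cons, Finset.sum_range_succ']
      simp [gapAt, len]
      ring
  rw [Word.length, this]; rfl

theorem Word.len_gap_lt (W : M.Word) {k : ℕ} (hk : k < W.tail.length) :
    len (W.gap k) < W.length := by
  rw [Word.length_eq]
  have := Finset.single_le_sum (f := fun k => len (W.gap k) + 1) (fun _ _ => Nat.zero_le _)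
    (Finset.mem_range.2 hk)
  omega

theorem Step.letterStep {ρ : M.Rule} {W W' : M.Word} (h : Step ρ W W') {k : ℕ}
    (hk : k ≤ W.tail.length) : LetterStep ρ (W.letter k) (W'.letter k) := h.2.letterStep h.1 hk

theorem Step.gapStep {ρ : M.Rule} {W W' : M.Word} (h : Step ρ W W') {k : ℕ}
    (hk : k < W.tail.length) :
    GapStep ρ (W.letter k) (W.gap k) (W.letter (k + 1)) (W'.gap k) := h.2.gapStep h.1 hk

end General

theorem _root_.wordsOver_empty {A : Type} {y : FreeGroup A} (h : y ∈ wordsOver (∅ : Set A)) :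
    y = 1 := by
  simpa [wordsOver] using h

theorem _root_.flat_eq_of_mem {A : Type} {s : Set (A × Fin 2)} (hs : ∀ p ∈ s, p.2 = 0)
    {y : FreeGroup (A × Fin 2)} (h : y ∈ wordsOver s) : Counter.flat y = y := by
  have : wordsOver s ≤ (Counter.flat).eqLocus (MonoidHom.id _) := by
    refine (Subgroup.closure_le _).2 ?_
    rintro _ ⟨⟨a, i⟩, ha, rfl⟩
    obtain rfl : i = 0 := hs _ ha
    simp [Counter.flat, MonoidHom.eqLocus]
  exact this h

theorem _root_.flat_lift0 {A : Type} (u : FreeGroup A) : Counter.flat (lift0 u) = lift0 u := by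
  have : (Counter.flat).comp lift0 = (lift0 : FreeGroup A →* FreeGroup (A × Fin 2)) := by
    ext a
    simp [Counter.flat, lift0]
  exact DFunLike.congr_fun this u

end SMachine

/-! ### The neighbourhood of one P-letter. -/

namespace SMachine

open FreeGroup Counter

variable {n : ℕ} {S : SMachine n}

/-- A `P`-letter together with the tape words on its left and on its right. -/
@[ext]
structure Conf (S : SMachine n) where
  state : CompState S
  L : FreeGroup (S.A × Fin 2)
  R : FreeGroup (S.A × Fin 2)

/-- Multiplication of the word on the left of a `P`-letter: the left end of the word is a `K`-letter
if `lk` holds and the inverse of the `P`-letter otherwise. -/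
def actL {A : Type} (lk : Bool) (x L : FreeGroup (A × Fin 2)) : FreeGroup (A × Fin 2) :=
  if lk then L * x else x⁻¹ * L * x

/-- Multiplication of the word on the right of a `P`-letter: the right end of the word is a
`K`-letter if `rk` holds and the inverse of the `P`-letter otherwise. -/
def actR {A : Type} (rk : Bool) (x R : FreeGroup (A × Fin 2)) : FreeGroup (A × Fin 2) :=
  if rk then (flat x)⁻¹ * R else (flat x)⁻¹ * R * flat x

theorem actL_mul {A : Type} (lk : Bool) (x y L : FreeGroup (A × Fin 2)) :
    actL lk y (actL lk x L) = actL lk (x * y) L := by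
  cases lk <;> simp [actL, mul_assoc]

theorem actR_mul {A : Type} (rk : Bool) (x y R : FreeGroup (A × Fin 2)) :
    actR rk y (actR rk x R) = actR rk (x * y) R := by
  cases rk <;> simp [actR, mul_assoc]

theorem actL_one {A : Type} (lk : Bool) (L : FreeGroup (A × Fin 2)) : actL lk 1 L = L := by
  cases lk <;> simp [actL]

theorem actR_one {A : Type} (rk : Bool) (R : FreeGroup (A × Fin 2)) : actR rk 1 R = R := by
  cases rk <;> simp [actR]

/-- The word on the left of a `P`-letter which is given by one side `f` of a rule of `S`. -/
def basicWord (lk : Bool) (f : Fin (n + 1) → SPart S.Q S.A) (i : Fin n)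
    (y : FreeGroup (S.A × Fin 2)) : FreeGroup (S.A × Fin 2) :=
  (if lk then lift0 (f i.castSucc).right else (lift0 (f i.succ).left)⁻¹) * y *
    lift0 (f i.succ).left

/-- The effect of positive rules of the composition on a `P`-letter and its neighbourhood, for the
rules that do not multiply tape words by the adding machine. -/
inductive Special (i : Fin n) (lk : Bool) : CompRule S → Conf S → Conf S → Prop
  | exit (θ : S.Rule) (R : FreeGroup (S.A × Fin 2)) :
      Special i lk (.adding θ i .r13) ⟨.pz i θ .one, 1, R⟩ ⟨.pz i θ .three, 1, R⟩
  | basic (θ : S.R) (y : FreeGroup (S.A × Fin 2)) (hy : flat y = y) :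
      Special i lk (.basic θ) ⟨.p i, basicWord lk (S.src θ) i y, 1⟩
        ⟨.pz i (θ, true) .one, basicWord lk (S.tgt θ) i y, 1⟩
  | idle (θ : S.Rule) (j : Fin n) (z : ZRule (S.tape j.castSucc)) (hj : j ≠ i) (x : Phase)
      (hx : x ≠ .two) (L : FreeGroup (S.A × Fin 2)) (hL : flat L = L) :
      Special i lk (.adding θ j z) ⟨.pz i θ x, L, 1⟩ ⟨.pz i θ x, L, 1⟩
  | transition (θ : S.Rule) (L : FreeGroup (S.A × Fin 2)) :
      Special i lk (.transition θ) ⟨.pz i θ .three, L, 1⟩ ⟨.p i, L, 1⟩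

/-- The effect of the rules of the composition on a `P`-letter and its neighbourhood. -/
inductive TripleStep (i : Fin n) (lk rk : Bool) : S.compZ.Rule → Conf S → Conf S → Prop
  | counter (θ : S.Rule) (ρ : ZStep (S.tape i.castSucc)) (L R : FreeGroup (S.A × Fin 2))
      (hne : ¬ρ.IsExit) (test : ρ.IsTest → R = 1) (three : ρ.source = .three → flat L = L) :
      TripleStep i lk rk (.adding θ i ρ.1, ρ.2) ⟨.pz i θ ρ.source, L, R⟩
        ⟨.pz i θ ρ.target, actL lk ρ.left L, actR rk ρ.left R⟩
  | pos (r : CompRule S) (c c' : Conf S) (h : Special i lk r c c') :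
      TripleStep i lk rk (r, true) c c'
  | neg (r : CompRule S) (c c' : Conf S) (h : Special i lk r c' c) :
      TripleStep i lk rk (r, false) c c'

theorem sub_one_eq_pPlace (i : Fin n) : kPlace i.succ - 1 = pPlace i := by
  rw [sub_eq_iff_eq_add]
  apply Fin.ext
  have hi := i.isLt
  have h1 : 1 % (2 * n + 1) = 1 := Nat.mod_eq_of_lt (by omega)
  simp only [kPlace, pPlace, Fin.val_succ, Fin.val_add, Fin.val_one', h1]
  rw [Nat.mod_eq_of_lt (by omega)]
  ring

theorem GapStep.exists_word_of_base {n : ℕ} {M : SMachine n} {ρ : M.Rule} {a b : M.Letter}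
    {w w' : FreeGroup M.A} (h : GapStep ρ a w b w') {x z : BaseLetter n} (ha : a.base = x)
    (hb : b.base = z) :
    ∃ y ∈ wordsOver (M.dom ρ.1 x.gapAfter),
      w = (ρ.lhs x.1).after x.2 * y * (ρ.lhs z.1).before z.2 ∧
      w' = (ρ.rhs x.1).after x.2 * y * (ρ.rhs z.1).before z.2 := by
  subst ha hb
  exact h.exists_word

/-- The left hand sides (`ε = true`) or the right hand sides (`ε = false`) of a rule. -/
def CompRule.side (r : CompRule S) (ε : Bool) :
    Fin (2 * n + 1) → SPart (CompState S) (S.A × Fin 2) :=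
  if ε then r.src else r.tgt

/-- Here `ε` selects a side of the positive rule, and comparison with the sign of the rule decides
whether this side is the old or the new word. In this form a rule and its inverse are treated
together. -/
theorem exists_left_word {ρ : S.compZ.Rule} {a p : S.compZ.Letter} {L L' : FreeGroup (S.A × Fin 2)}
    {i : Fin n} {lk : Bool} (h : GapStep (M := S.compZ) ρ a L p L')
    (ha : a.base = if lk then (kPlace i.castSucc, true) else (pPlace i, false))
    (hp : p.base = (pPlace i, true)) :
    ∃ y ∈ wordsOver (CompRule.dom ρ.1 (kPlace i.castSucc)), ∀ ε : Bool,
      (if ε = ρ.2 then L else L') =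
        (if lk then (CompRule.side ρ.1 ε (kPlace i.castSucc)).right
          else (CompRule.side ρ.1 ε (pPlace i)).left⁻¹) * y *
        (CompRule.side ρ.1 ε (pPlace i)).left := by
  obtain ⟨y, hy, h1, h2⟩ := h.exists_word_of_base ha hp
  obtain ⟨r, δ⟩ := ρ
  refine ⟨y, ?_, ?_⟩
  · cases lk
    · change y ∈ wordsOver (CompRule.dom r (pPlace i - 1)) at hy
      rwa [pPlace_sub_one] at hy
    · exact hy
  · intro ε
    cases lk <;> cases δ <;> cases ε
    exacts [h1, h2, h2, h1, h1, h2, h2, h1]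

theorem exists_right_word {ρ : S.compZ.Rule} {p b : S.compZ.Letter}
    {R R' : FreeGroup (S.A × Fin 2)} {i : Fin n} {rk : Bool}
    (h : GapStep (M := S.compZ) ρ p R b R') (hp : p.base = (pPlace i, true))
    (hb : b.base = if rk then (kPlace i.succ, true) else (pPlace i, false)) :
    ∃ y ∈ wordsOver (CompRule.dom ρ.1 (pPlace i)), ∀ ε : Bool,
      (if ε = ρ.2 then R else R') =
        (CompRule.side ρ.1 ε (pPlace i)).right * y *
        (if rk then (CompRule.side ρ.1 ε (kPlace i.succ)).left
          else (CompRule.side ρ.1 ε (pPlace i)).right⁻¹) := by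
  obtain ⟨y, hy, h1, h2⟩ := h.exists_word_of_base hp hb
  obtain ⟨r, δ⟩ := ρ
  refine ⟨y, hy, ?_⟩
  intro ε
  cases rk <;> cases δ <;> cases ε
  exacts [h1, h2, h2, h1, h1, h2, h2, h1]

theorem mem_domLeft_three {A : Type} {s : Set A} {z : ZRule s} (hz : z.source = .three)
    {y : FreeGroup (A × Fin 2)} (hy : y ∈ wordsOver z.domLeft) : flat y = y := by
  refine flat_eq_of_mem ?_ hy
  cases z <;> simp_all [ZRule.source, ZRule.domLeft]

theorem ZRule.flat_left_three {A : Type} {s : Set A} {z : ZRule s} (hz : z.source = .three) :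
    flat z.left = z.left := by
  cases z <;> simp_all [ZRule.source, ZRule.left, ZRule.a0, flat]

theorem ZRule.target_three {A : Type} {s : Set A} {z : ZRule s} (hz : z ≠ .r13)
    (h : z.target = .three) : z.source = .three := by
  cases z <;> simp_all [ZRule.source, ZRule.target]

theorem CompState.working_of_ne {θ : S.Rule} {i j : Fin n} (x y : Phase) (h : j ≠ i) :
    CompState.working θ j x i = CompState.working θ j y i := by
  simp [CompState.working, h.symm]

theorem exists_working {θ : S.Rule} {i j : Fin n} (x : Phase) (h : j ≠ i) :
    ∃ y, y ≠ .two ∧ CompState.working θ j x i = .pz i θ y := by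
  rcases lt_or_gt_of_ne h with h1 | h1
  · exact ⟨.one, by simp, by simp [CompState.working, h.symm, h1.not_gt]⟩
  · exact ⟨.three, by simp, by simp [CompState.working, h1]⟩

theorem TripleStep.of_special {i : Fin n} {lk rk : Bool} {r : CompRule S} {ε : Bool}
    {c c' a b : Conf S} (h : Special i lk r a b) (ha : (if true = ε then c else c') = a)
    (hb : (if false = ε then c else c') = b) : TripleStep i lk rk (r, ε) c c' := by
  subst ha hb
  cases ε
  · exact .neg _ _ _ h
  · exact .pos _ _ _ h

/-- Only the rules of the i-th adding machine move letters across P_i. All other rules lock the gap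
on its right, so that `R` is trivial, and the phase switch `r13` locks the gap on its left, so that
`L` is trivial. -/
theorem tripleStep_of_gapStep {ρ : S.compZ.Rule} {a p p' b : S.compZ.Letter}
    {L L' R R' : FreeGroup (S.A × Fin 2)} {i : Fin n} {lk rk : Bool}
    (h1 : GapStep (M := S.compZ) ρ a L p L') (h2 : GapStep (M := S.compZ) ρ p R b R')
    (hp' : LetterStep ρ p p')
    (ha : a.base = if lk then (kPlace i.castSucc, true) else (pPlace i, false))
    (hp : p.base = (pPlace i, true))
    (hb : b.base = if rk then (kPlace i.succ, true) else (pPlace i, false)) :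
    TripleStep i lk rk ρ ⟨p.1, L, R⟩ ⟨p'.1, L', R'⟩ := by
  obtain ⟨y, hy, e1⟩ := exists_left_word h1 ha hp
  obtain ⟨x, hx, e2⟩ := exists_right_word h2 hp hb
  have hq : ∀ ε : Bool, (if ε = ρ.2 then p.1 else p'.1) =
      (CompRule.side ρ.1 ε (pPlace i)).state := by
    have h3 := hp'.1
    have h4 := congrArg Prod.fst hp'.2
    rw [show S.compZ.part p.1 = pPlace i from congrArg Prod.fst hp] at h3 h4
    obtain ⟨r, δ⟩ := ρ
    intro ε
    cases δ <;> cases ε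
    exacts [h3, h4, h4, h3]
  have key : ∀ ε : Bool, (if ε = ρ.2 then (⟨p.1, L, R⟩ : Conf S) else ⟨p'.1, L', R'⟩) =
      ⟨(CompRule.side ρ.1 ε (pPlace i)).state,
        (if lk then (CompRule.side ρ.1 ε (kPlace i.castSucc)).right
          else (CompRule.side ρ.1 ε (pPlace i)).left⁻¹) * y *
        (CompRule.side ρ.1 ε (pPlace i)).left,
        (CompRule.side ρ.1 ε (pPlace i)).right * x *
        (if rk then (CompRule.side ρ.1 ε (kPlace i.succ)).left
          else (CompRule.side ρ.1 ε (pPlace i)).right⁻¹)⟩ := by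
    intro ε
    rw [← hq, ← e1, ← e2]
    split_ifs <;> rfl
  generalize (⟨p.1, L, R⟩ : Conf S) = c at key ⊢
  generalize (⟨p'.1, L', R'⟩ : Conf S) = c' at key ⊢
  clear h1 h2 hp' ha hp hb e1 e2 hq
  obtain ⟨r, ε⟩ := ρ
  have hs := key true
  have ht := key false
  clear key
  simp only [CompRule.side, if_true, Bool.false_eq_true, if_false] at hs ht hx hy
  cases r with
  | basic θ =>
    rw [CompRule.dom, interleave_pPlace] at hx
    obtain rfl := wordsOver_empty hx
    rw [CompRule.dom, interleave_kPlace] at hy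
    have hf : flat y = y := flat_eq_of_mem (fun p hp => hp.2) hy
    refine .of_special (Special.basic (lk := lk) (i := i) θ y hf) (hs.trans ?_) (ht.trans ?_) <;>
    cases lk <;> cases rk <;>
      simp [CompRule.src, CompRule.tgt, interleave_kPlace, interleave_pPlace, basicWord]
  | transition θ =>
    rw [CompRule.dom, interleave_pPlace] at hx
    obtain rfl := wordsOver_empty hx
    refine .of_special (Special.transition (lk := lk) (i := i) θ y) (hs.trans ?_)
      (ht.trans ?_) <;>
    cases lk <;> cases rk <;>
      simp [CompRule.src, CompRule.tgt, interleave_kPlace, interleave_pPlace, bare]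
  | adding θ j z =>
    rw [CompRule.dom, interleave_pPlace] at hx
    rw [CompRule.dom, interleave_kPlace] at hy
    by_cases hij : j = i
    · subst hij
      rw [if_pos rfl] at hx hy
      by_cases hz : z = .r13
      · subst hz
        obtain rfl := wordsOver_empty hy
        refine .of_special (Special.exit (lk := lk) (i := j) θ x) (hs.trans ?_) (ht.trans ?_) <;>
        cases lk <;> cases rk <;>
          simp [CompRule.src, CompRule.tgt, interleave_kPlace, interleave_pPlace, bare,
            CompState.working, ZRule.left, ZRule.right, ZRule.source, ZRule.target]
      · have hr := ZStep.right_eq (z, true)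
        simp only [ZStep.right, ZStep.left, if_true] at hr
        have htest : z = .r21 → x = 1 := by
          rintro rfl
          exact wordsOver_empty hx
        have hs' : (if true = ε then c else c') = ⟨.pz j θ z.source, y, x⟩ := by
          rw [hs]
          cases lk <;> cases rk <;>
            simp [CompRule.src, interleave_kPlace, interleave_pPlace, bare, CompState.working]
        have ht' : (if false = ε then c else c') =
            ⟨.pz j θ z.target, actL lk z.left y, actR rk z.left x⟩ := by
          rw [ht]
          cases lk <;> cases rk <;>
            simp [CompRule.tgt, interleave_kPlace, interleave_pPlace, bare, CompState.working,
              actL, actR, hr]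
        cases ε
        -- For an inverse rule the conditions concern the words after the positive rule. They carry
        -- over: `r21` inserts nothing, and apart from `r13` only `r3` ends in phase three.
        · simp only [Bool.true_eq_false, if_false, if_true] at hs' ht'
          rw [hs', ht']
          have h := TripleStep.counter (lk := lk) (rk := rk) (i := j) θ (z, false)
            (actL lk z.left y) (actR rk z.left x) hz (fun ht => ?_) (fun ht => ?_)
          · simpa [actL_mul, actR_mul, ZStep.left, ZStep.source, ZStep.target, actL_one,
              actR_one] using h
          · rw [htest ht]
            have ht' : z = .r21 := ht
            subst ht'
            cases rk <;> simp [actR, ZRule.left]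
          · have h3 := ZRule.target_three hz ht
            have h4 := mem_domLeft_three h3 hy
            have h5 := ZRule.flat_left_three h3
            cases lk <;> simp [actL, h4, h5]
        · simp only [Bool.false_eq_true, if_false, if_true] at hs' ht'
          rw [hs', ht']
          exact TripleStep.counter (lk := lk) (rk := rk) (i := j) θ (z, true)
            y x hz htest (fun ht => mem_domLeft_three ht hy)
    · rw [if_neg (Ne.symm hij)] at hx
      rw [if_neg (fun h => hij (Fin.castSucc_injective n h).symm)] at hy
      obtain rfl := wordsOver_empty hx
      have hf : flat y = y := flat_eq_of_mem (fun p hp => hp.2) hy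
      obtain ⟨ph, hph, e⟩ := exists_working (θ := θ) z.source hij
      have e' : CompState.working θ j z.target i = .pz i θ ph := by
        rw [← e]; exact CompState.working_of_ne _ _ hij
      refine .of_special (Special.idle (lk := lk) (i := i) θ j z hij ph hph y hf) (hs.trans ?_)
        (ht.trans ?_) <;>
      cases lk <;> cases rk <;>
        simp [CompRule.src, CompRule.tgt, interleave_kPlace, interleave_pPlace, bare,
          Ne.symm hij, e, e']

end SMachine

/-! ### Segments of pure counting. -/

namespace SMachine

open FreeGroup Counter

variable {n : ℕ} {S : SMachine n}

/-- The effect of a computation on a `P`-letter and its neighbourhood. -/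
structure TripleComp (i : Fin n) (lk rk : Bool) (t : ℕ) (h : ℕ → S.compZ.Rule) (c : ℕ → Conf S) :
    Prop where
  step : ∀ j < t, TripleStep i lk rk (h j) (c j) (c (j + 1))
  left_ne : lk = false → ∀ j < t, (c j).L ≠ 1
  right_ne : rk = false → ∀ j < t, (c j).R ≠ 1
  reduced : ∀ j, j + 1 < t → h (j + 1) ≠ (h j).inv

/-- The rule multiplies the tape words around the `i`-th `P`-letter by the adding machine. -/
def IsCounter (i : Fin n) (ρ : S.compZ.Rule) : Prop :=
  ∃ (θ : S.Rule) (σ : ZStep (S.tape i.castSucc)), ¬σ.IsExit ∧ ρ = (.adding θ i σ.1, σ.2)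

/-- The rule switches the `i`-th adding machine between the phases `one` and `three`. -/
def IsExitRule (i : Fin n) (ρ : S.compZ.Rule) : Prop :=
  ∃ θ : S.Rule, ρ.1 = .adding θ i .r13

theorem TripleStep.of_isCounter {i : Fin n} {lk rk : Bool} {ρ : S.compZ.Rule} {c c' : Conf S}
    (h : TripleStep i lk rk ρ c c') (hρ : IsCounter i ρ) :
    ∃ (θ : S.Rule) (σ : ZStep (S.tape i.castSucc)), ¬σ.IsExit ∧ ρ = (.adding θ i σ.1, σ.2) ∧
      c.state = .pz i θ σ.source ∧ c'.state = .pz i θ σ.target ∧ c'.L = actL lk σ.left c.L ∧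
      c'.R = actR rk σ.left c.R ∧ (σ.IsTest → c.R = 1) := by
  cases h with
  | counter θ σ L R hne test three => exact ⟨θ, σ, hne, rfl, rfl, rfl, rfl, rfl, test⟩
  | pos r c c' h =>
    obtain ⟨θ, σ, h1, h2⟩ := hρ
    have h3 : r = .adding θ i σ.1 := congrArg Prod.fst h2
    cases h with
    | exit θ R =>
      simp only [CompRule.adding.injEq, heq_eq_eq, true_and] at h3
      exact absurd h3.2.symm h1
    | basic θ y hy => cases h3
    | idle θ j z hj x hx L hL => exact absurd (CompRule.adding.inj h3).2.1 hj
    | transition θ L => cases h3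
  | neg r c c' h =>
    obtain ⟨θ, σ, h1, h2⟩ := hρ
    have h3 : r = .adding θ i σ.1 := congrArg Prod.fst h2
    cases h with
    | exit θ R =>
      simp only [CompRule.adding.injEq, heq_eq_eq, true_and] at h3
      exact absurd h3.2.symm h1
    | basic θ y hy => cases h3
    | idle θ j z hj x hx L hL => exact absurd (CompRule.adding.inj h3).2.1 hj
    | transition θ L => cases h3

theorem TripleStep.isCounter_or {i : Fin n} {lk rk : Bool} {ρ : S.compZ.Rule} {c c' : Conf S}
    (h : TripleStep i lk rk ρ c c') :
    IsCounter i ρ ∨ Special i lk ρ.1 c c' ∧ ρ.2 = true ∨ Special i lk ρ.1 c' c ∧ ρ.2 = false := by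
  cases h with
  | counter θ σ L R hne test three => exact .inl ⟨θ, σ, hne, rfl⟩
  | pos r c c' h => exact .inr (.inl ⟨h, rfl⟩)
  | neg r c c' h => exact .inr (.inr ⟨h, rfl⟩)

theorem TripleComp.sub {i : Fin n} {lk rk : Bool} {t : ℕ} {h : ℕ → S.compZ.Rule} {c : ℕ → Conf S}
    (H : TripleComp i lk rk t h c) {a b : ℕ} (hab : a ≤ b) (hb : b ≤ t) :
    TripleComp i lk rk (b - a) (fun k => h (a + k)) (fun k => c (a + k)) where
  step j hj := H.step (a + j) (by omega)
  left_ne hl j hj := H.left_ne hl (a + j) (by omega)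
  right_ne hr j hj := H.right_ne hr (a + j) (by omega)
  reduced j hj := H.reduced (a + j) (by omega)

/-- The element `g` is a free starting point in the tree. With a K-letter on the left it is chosen
as the left word, so that x is the left tape; with P⁻¹ on the left only the accumulated multiplier
matters and `g = 1` serves. Tests need an empty right tape and do not occur next to P⁻¹. -/
theorem TripleComp.exists_isRun {i : Fin n} {lk rk : Bool} {t : ℕ} {h : ℕ → S.compZ.Rule}
    {c : ℕ → Conf S} (H : TripleComp i lk rk t h c) (hc : ∀ j < t, IsCounter i (h j)) (ht : 0 < t)
    (g : FreeGroup (S.A × Fin 2)) :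
    ∃ (θ : S.Rule) (σ : ℕ → ZStep (S.tape i.castSucc)) (x : ℕ → FreeGroup (S.A × Fin 2))
      (φ : ℕ → Phase), IsRun (flat g * (c 0).R) t σ x φ ∧ x 0 = g ∧
      (rk = false → ∀ j < t, ¬(σ j).IsTest) ∧
      ∀ j ≤ t, c j = ⟨.pz i θ (φ j), actL lk (g⁻¹ * x j) (c 0).L, actR rk (g⁻¹ * x j) (c 0).R⟩ := by
  have key : ∀ j, ∃ (θ : S.Rule) (σ : ZStep (S.tape i.castSucc)), j < t → ¬σ.IsExit ∧
      h j = (.adding θ i σ.1, σ.2) ∧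
      (c j).state = .pz i θ σ.source ∧ (c (j + 1)).state = .pz i θ σ.target ∧
      (c (j + 1)).L = actL lk σ.left (c j).L ∧
      (c (j + 1)).R = actR rk σ.left (c j).R ∧ (σ.IsTest → (c j).R = 1) := by
    intro j
    by_cases hj : j < t
    · obtain ⟨θ, σ, h1⟩ := (H.step j hj).of_isCounter (hc j hj)
      exact ⟨θ, σ, fun _ => h1⟩
    · obtain ⟨θ, σ, h1⟩ := (H.step 0 ht).of_isCounter (hc 0 ht)
      exact ⟨θ, σ, fun h => absurd h hj⟩
  choose θ σ hσ using key
  have hlink : ∀ j, j + 1 < t → θ (j + 1) = θ j ∧ (σ (j + 1)).source = (σ j).target := by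
    intro j hj
    have h1 := (hσ j (by omega)).2.2.2.1
    have h2 := (hσ (j + 1) hj).2.2.1
    rw [h1] at h2
    simp only [CompState.pz.injEq, true_and] at h2
    exact ⟨h2.1.symm, h2.2.symm⟩
  have hθ : ∀ j < t, θ j = θ 0 := by
    intro j
    induction j with
    | zero => exact fun _ => rfl
    | succ j ih => exact fun hj => (hlink j hj).1.trans (ih (by omega))
  let x : ℕ → FreeGroup (S.A × Fin 2) := fun j => Nat.rec g (fun k y => y * (σ k).left) j
  let φ : ℕ → Phase := fun j => if j < t then (σ j).source else (σ (t - 1)).target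
  have hφ : ∀ j < t, (σ j).target = φ (j + 1) := by
    intro j hj
    by_cases h1 : j + 1 < t
    · simp only [φ, if_pos h1]
      exact (hlink j h1).2.symm
    · simp only [φ, if_neg h1]
      rw [show t - 1 = j by omega]
  have hconf : ∀ j ≤ t, c j = ⟨.pz i (θ 0) (φ j), actL lk (g⁻¹ * x j) (c 0).L,
      actR rk (g⁻¹ * x j) (c 0).R⟩ := by
    intro j
    induction j with
    | zero =>
      intro _
      refine Conf.ext ?_ ?_ ?_
      · simp only [φ, if_pos ht]
        exact (hσ 0 ht).2.2.1
      · simp [x, actL_one]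
      · simp [x, actR_one]
    | succ j ih =>
      intro hj
      have h1 := hσ j (by omega)
      have h2 := ih (by omega)
      refine Conf.ext ?_ ?_ ?_
      · rw [h1.2.2.2.1, hθ j (by omega), hφ j (by omega)]
      · rw [h1.2.2.2.2.1, h2, actL_mul, mul_assoc]
      · rw [h1.2.2.2.2.2.1, h2, actR_mul, mul_assoc]
  have htest : rk = false → ∀ j < t, ¬(σ j).IsTest := fun hr j hj h1 =>
    H.right_ne hr j hj ((hσ j hj).2.2.2.2.2.2 h1)
  refine ⟨θ 0, σ, x, φ, ⟨?_, hφ, fun _ _ => rfl, fun j hj => (hσ j hj).1, ?_, ?_⟩, rfl, htest,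
    hconf⟩
  · intro j hj
    simp only [φ, if_pos hj]
  · intro j hj h1
    cases rk
    · exact absurd h1 (htest rfl j hj)
    · have h2 := (hσ j hj).2.2.2.2.2.2 h1
      rw [hconf j hj.le] at h2
      simpa [actR, rest, mul_assoc] using h2
  · intro j hj h1
    refine H.reduced j hj ?_
    rw [(hσ (j + 1) hj).2.1, (hσ j (by omega)).2.1, h1, (hlink j hj).1]
    rfl

/-- The total length of the tape words next to a `P`-letter. -/
noncomputable def Conf.len (c : Conf S) : ℕ := FreeGroup.len c.L + FreeGroup.len c.R

/-- The width of a computation of the adding machine. -/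
theorem TripleComp.len_le_of_isCounter {i : Fin n} {lk rk : Bool} {t : ℕ}
    {h : ℕ → S.compZ.Rule} {c : ℕ → Conf S} (H : TripleComp i lk rk t h c)
    (hc : ∀ j < t, IsCounter i (h j)) {j : ℕ} (hj : j ≤ t) :
    (c j).len ≤ 40 * ((c 0).len + (c t).len) := by
  rcases Nat.eq_zero_or_pos t with rfl | ht
  · obtain rfl : j = 0 := by omega
    omega
  cases lk
  · obtain ⟨θ, σ, x, φ, hr, hx, htest, hconf⟩ := H.exists_isRun hc ht 1
    rw [hconf j hj, hconf t le_rfl]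
    have hw := H.left_ne rfl 0 ht
    simp only [_root_.map_one, one_mul] at hr
    cases rk
    · have := hr.len_conj_add_len_conj_le hx (htest rfl) hw (c 0).R hj
      simp only [Conf.len, actL, actR, Bool.false_eq_true, if_false, inv_one, one_mul]
      omega
    · have := hr.len_conj_add_len_le hx hw hj
      simp only [rest] at this
      simp only [Conf.len, actL, actR, Bool.false_eq_true, if_false, inv_one, one_mul, if_true]
      omega
  · obtain ⟨θ, σ, x, φ, hr, hx, htest, hconf⟩ := H.exists_isRun hc ht (c 0).L
    have e : ∀ j ≤ t, (c j).L = x j := fun j hj => by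
      rw [hconf j hj]; simp [actL]
    have e0 := e 0 (by omega)
    cases rk
    · have h1 := hr.len_add_len_conj_le (htest rfl) (c 0).R hj
      have e2 : (c j).R = (flat ((x 0)⁻¹ * x j))⁻¹ * (c 0).R * flat ((x 0)⁻¹ * x j) := by
        rw [hconf j hj, hx]; rfl
      simp only [Conf.len]
      rw [e j hj, e t le_rfl, e2, e0]
      omega
    · have h1 := hr.len_add_len_le hj
      have e2 : ∀ j ≤ t, (c j).R = rest (flat (c 0).L * (c 0).R) (x j) := by
        intro j hj
        rw [hconf j hj]
        simp [actR, rest, mul_assoc]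
      rw [← e2 j hj, ← e2 t le_rfl, ← e2 0 (by omega), ← e j hj, ← e t le_rfl, ← e0] at h1
      simp only [Conf.len]
      omega

/-- A maximal interval around `j` in which a property holds. -/
theorem exists_maximal_interval (P : ℕ → Prop) {j t : ℕ} (hj : j ≤ t) :
    ∃ a b, a ≤ j ∧ j ≤ b ∧ b ≤ t ∧ (∀ k, a ≤ k → k < b → P k) ∧ (0 < a → ¬P (a - 1)) ∧
      (b < t → ¬P b) := by
  classical
  have ha : ∃ a, a ≤ j ∧ ∀ k, a ≤ k → k < j → P k := ⟨j, le_rfl, fun k h1 h2 => by omega⟩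
  have hb : ∃ m, j + m ≤ t ∧ ∀ k, j ≤ k → k < j + m → P k :=
    ⟨0, by omega, fun k h1 h2 => by omega⟩
  have hfind := Nat.find_spec ha
  have hmin := @Nat.find_min _ _ ha
  set a := Nat.find ha
  let Q : ℕ → Prop := fun m => j + m ≤ t ∧ ∀ k, j ≤ k → k < j + m → P k
  have hQ0 : Q 0 := ⟨by omega, fun k h1 h2 => by omega⟩
  have hg : Q (Nat.findGreatest Q t) := Nat.findGreatest_spec (P := Q) (Nat.zero_le t) hQ0
  have hmax := fun m => @Nat.findGreatest_is_greatest m Q _ t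
  set m := Nat.findGreatest Q t
  refine ⟨a, j + m, hfind.1, by omega, hg.1, ?_, ?_, ?_⟩
  · intro k h1 h2
    rcases lt_or_ge k j with h3 | h3
    · exact hfind.2 k h1 h3
    · exact hg.2 k h3 h2
  · intro h1 h2
    refine hmin (m := a - 1) (by omega) ⟨by omega, fun k h3 h4 => ?_⟩
    rcases eq_or_lt_of_le h3 with h5 | h5
    · rwa [← h5]
    · exact hfind.2 k (by omega) h4
  · intro h1 h2
    refine hmax (m + 1) (by omega) (by omega) ⟨by omega, fun k h3 h4 => ?_⟩
    rcases eq_or_lt_of_le (show k ≤ j + m by omega) with h5 | h5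
    · rwa [h5]
    · exact hg.2 k h3 h5

end SMachine

/-! ### Phase switches, and the case of the right neighbour P⁻¹. -/

namespace SMachine

open FreeGroup Counter

variable {n : ℕ} {S : SMachine n}

/-- The rule `θ` if the state letter is `p_i(θ, 1)` or `p_i(θ, 2)`. -/
def CompState.activeRule : CompState S → Option S.Rule
  | .pz _ θ .one => some θ
  | .pz _ θ .two => some θ
  | _ => none

/-- Without `r13` the phases one and two are not connected with phase three. So during counting
`activeRule` is constant and records on which side of the switch the run takes place. -/
theorem activeRule_source {i : Fin n} {θ : S.Rule} {s : Set S.A} {σ : ZStep s} (h : ¬σ.IsExit) :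
    (CompState.pz i θ σ.source).activeRule = (CompState.pz i θ σ.target).activeRule := by
  obtain ⟨z, ε⟩ := σ
  cases z <;> cases ε <;> first | rfl | exact absurd rfl h

theorem TripleStep.of_isExitRule {i : Fin n} {lk rk : Bool} {ρ : S.compZ.Rule} {c c' : Conf S}
    (h : TripleStep i lk rk ρ c c') (hρ : IsExitRule i ρ) :
    ∃ (θ : S.Rule) (R : FreeGroup (S.A × Fin 2)),
      (ρ = (.adding θ i .r13, true) ∧ c = ⟨.pz i θ .one, 1, R⟩ ∧ c' = ⟨.pz i θ .three, 1, R⟩) ∨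
      (ρ = (.adding θ i .r13, false) ∧ c = ⟨.pz i θ .three, 1, R⟩ ∧
        c' = ⟨.pz i θ .one, 1, R⟩) := by
  obtain ⟨θ, hθ⟩ := hρ
  cases h with
  | counter θ σ L R hne test three =>
    exact absurd (eq_of_heq (CompRule.adding.inj hθ).2.2) hne
  | pos r c c' h =>
    cases h with
    | exit θ R => exact ⟨θ, R, .inl ⟨rfl, rfl, rfl⟩⟩
    | basic θ y hy => cases hθ
    | idle θ j z hj x hx L hL => exact absurd (CompRule.adding.inj hθ).2.1 hj
    | transition θ L => cases hθ
  | neg r c c' h =>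
    cases h with
    | exit θ R => exact ⟨θ, R, .inr ⟨rfl, rfl, rfl⟩⟩
    | basic θ y hy => cases hθ
    | idle θ j z hj x hx L hL => exact absurd (CompRule.adding.inj hθ).2.1 hj
    | transition θ L => cases hθ

/-- If the right word does not vanish, then all steps belong to the adding machine. -/
theorem TripleStep.isExitRule_of_right_ne {i : Fin n} {lk rk : Bool} {ρ : S.compZ.Rule}
    {c c' : Conf S} (h : TripleStep i lk rk ρ c c') (hρ : ¬IsCounter i ρ) (hR : c.R ≠ 1) :
    IsExitRule i ρ := by
  rcases h.isCounter_or with h | ⟨h, -⟩ | ⟨h, -⟩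
  · exact absurd h hρ
  · obtain ⟨r, ε⟩ := ρ
    cases h with
    | exit θ R => exact ⟨θ, rfl⟩
    | basic θ y hy => exact absurd rfl hR
    | idle θ j z hj x hx L hL => exact absurd rfl hR
    | transition θ L => exact absurd rfl hR
  · obtain ⟨r, ε⟩ := ρ
    cases h with
    | exit θ R => exact ⟨θ, rfl⟩
    | basic θ y hy => exact absurd rfl hR
    | idle θ j z hj x hx L hL => exact absurd rfl hR
    | transition θ L => exact absurd rfl hR

/-- The configuration after a switch determines the only switch that may follow, and this is the
inverse one. -/
theorem TripleComp.not_exit_exit {i : Fin n} {lk rk : Bool} {t : ℕ} {h : ℕ → S.compZ.Rule}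
    {c : ℕ → Conf S} (H : TripleComp i lk rk t h c) {k : ℕ} (hk : k + 1 < t)
    (h1 : IsExitRule i (h k)) (h2 : IsExitRule i (h (k + 1))) : False := by
  obtain ⟨θ, R, h3⟩ := (H.step k (by omega)).of_isExitRule h1
  obtain ⟨θ', R', h4⟩ := (H.step (k + 1) hk).of_isExitRule h2
  have h5 := H.reduced k hk
  rcases h3 with ⟨e1, -, e2⟩ | ⟨e1, -, e2⟩ <;> rcases h4 with ⟨e3, e4, -⟩ | ⟨e3, e4, -⟩ <;>
    rw [e2] at e4 <;> simp only [Conf.mk.injEq, CompState.pz.injEq, reduceCtorEq, and_false,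
      false_and, true_and, and_true] at e4
  · obtain ⟨rfl, -⟩ := e4
    exact h5 (by rw [e1, e3]; rfl)
  · obtain ⟨rfl, -⟩ := e4
    exact h5 (by rw [e1, e3]; rfl)

theorem TripleComp.activeRule_eq {i : Fin n} {lk rk : Bool} {t : ℕ} {h : ℕ → S.compZ.Rule}
    {c : ℕ → Conf S} (H : TripleComp i lk rk t h c) (hc : ∀ j < t, IsCounter i (h j)) :
    (c 0).state.activeRule = (c t).state.activeRule := by
  suffices ∀ j ≤ t, (c 0).state.activeRule = (c j).state.activeRule from this t le_rfl
  intro j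
  induction j with
  | zero => exact fun _ => rfl
  | succ j ih =>
    intro hj
    obtain ⟨θ, σ, h1, -, h2, h3, -⟩ := (H.step j (by omega)).of_isCounter (hc j (by omega))
    rw [ih (by omega), h2, h3, activeRule_source h1]

theorem TripleComp.eq_zero_of_closed {i : Fin n} {rk : Bool} {t : ℕ} {h : ℕ → S.compZ.Rule}
    {c : ℕ → Conf S} (H : TripleComp i true rk t h c) (hc : ∀ j < t, IsCounter i (h j))
    {θ θ' : S.Rule} {ph : Phase} (h0 : (c 0).state = .pz i θ ph) (ht : (c t).state = .pz i θ' ph)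
    (hL : (c 0).L = (c t).L) : t = 0 := by
  by_contra hne
  obtain ⟨θ, σ, x, φ, hr, hx, -, hconf⟩ := H.exists_isRun hc (by omega) (c 0).L
  refine hne (hr.eq_zero_of_closed_of_phase ?_ ?_)
  · have h1 := congrArg Conf.state (hconf 0 (by omega))
    have h2 := congrArg Conf.state (hconf t le_rfl)
    rw [h0] at h1
    rw [ht] at h2
    simp only [CompState.pz.injEq, true_and] at h1 h2
    rw [← h1.2, ← h2.2]
  · have h2 := congrArg Conf.L (hconf t le_rfl)
    simp only [actL, if_true, mul_inv_cancel_left] at h2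
    rw [hx, hL, h2]

/-- Between two transitions of the adding machine between the phases `one` and `three`, the
computation has to leave the adding machine. -/
theorem TripleComp.not_isolated {i : Fin n} {rk : Bool} {t : ℕ} {h : ℕ → S.compZ.Rule}
    {c : ℕ → Conf S} (H : TripleComp i true rk t h c) {a b : ℕ} (hab : a + 1 ≤ b) (hb : b < t)
    (hc : ∀ k, a + 1 ≤ k → k < b → IsCounter i (h k)) (h1 : IsExitRule i (h a))
    (h2 : IsExitRule i (h b)) : False := by
  have H' := H.sub hab hb.le
  have hc' : ∀ j < b - (a + 1), IsCounter i (h (a + 1 + j)) := fun j hj =>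
    hc _ (by omega) (by omega)
  have h3 := H'.activeRule_eq hc'
  have e1 : a + 1 + (b - (a + 1)) = b := by omega
  simp only [add_zero, e1] at h3
  obtain ⟨θ, R, h4⟩ := (H.step a (by omega)).of_isExitRule h1
  obtain ⟨θ', R', h5⟩ := (H.step b hb).of_isExitRule h2
  -- Both ends of the run have `L = 1`, and by `activeRule` they are in the same phase; a closed run
  -- of this kind is empty.
  have h6 : b - (a + 1) = 0 := by
    rcases h4 with ⟨-, -, h4⟩ | ⟨-, -, h4⟩ <;> rcases h5 with ⟨-, h5, -⟩ | ⟨-, h5, -⟩ <;>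
      rw [h4, h5] at h3 <;> simp only [CompState.activeRule, reduceCtorEq] at h3 <;>
      exact H'.eq_zero_of_closed hc' (congrArg Conf.state h4)
        (by simp only [e1]; exact congrArg Conf.state h5) (by simp only [e1, add_zero, h4, h5])
  obtain rfl : b = a + 1 := by omega
  exact H.not_exit_exit hb h1 h2

theorem len_conj_le {A : Type} (g x : FreeGroup A) : len (g⁻¹ * x * g) ≤ len x + 2 * len g := by
  have h1 := len_mul_le (g⁻¹ * x) g
  have h2 := len_mul_le g⁻¹ x
  rw [len_inv] at h2
  omega

/-- The bound for the right end `p⁻¹`. -/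
theorem TripleComp.len_le_of_right_false {i : Fin n} {lk : Bool} {t : ℕ} {h : ℕ → S.compZ.Rule}
    {c : ℕ → Conf S} (H : TripleComp i lk false t h c) {j : ℕ} (hj : j ≤ t) :
    (c j).len ≤ 160 * ((c 0).len + (c t).len) := by
  obtain ⟨a, b, haj, hjb, hbt, hP, ha, hb⟩ :=
    exists_maximal_interval (fun k => IsCounter i (h k)) hj
  -- The right word is never trivial here, so every step that does not count is a switch. A switch
  -- needs `L = 1`, which is impossible next to P⁻¹ on the left.
  have hexit : ∀ k < t, ¬IsCounter i (h k) →
      lk = true ∧ IsExitRule i (h k) ∧ (c k).L = 1 ∧ (c (k + 1)).L = 1 := by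
    intro k hk h1
    have h2 := (H.step k hk).isExitRule_of_right_ne h1 (H.right_ne rfl k hk)
    obtain ⟨θ, R, h3⟩ := (H.step k hk).of_isExitRule h2
    have h4 : (c k).L = 1 ∧ (c (k + 1)).L = 1 := by
      rcases h3 with ⟨-, h4, h5⟩ | ⟨-, h4, h5⟩ <;> rw [h4, h5] <;> exact ⟨rfl, rfl⟩
    refine ⟨?_, h2, h4⟩
    by_contra h5
    exact H.left_ne (by simpa using h5) k hk h4.1
  have H' := H.sub (haj.trans hjb) hbt
  have hc' : ∀ k < b - a, IsCounter i (h (a + k)) := fun k hk => hP _ (by omega) (by omega)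
  have hrun := H'.len_le_of_isCounter hc' (j := j - a) (by omega)
  simp only [add_zero] at hrun
  rw [show a + (j - a) = j by omega, show a + (b - a) = b by omega] at hrun
  -- Counting conjugates `R` by the flattened change of `L`; hence at an end with `L = 1` the total
  -- length is controlled by the other end.
  have hconj : lk = true → len (c a).R ≤ len (c b).R + 2 * (len (c a).L + len (c b).L) ∧
      len (c b).R ≤ len (c a).R + 2 * (len (c a).L + len (c b).L) := by
    rintro rfl
    rcases Nat.eq_zero_or_pos (b - a) with h0 | h0
    · obtain rfl : b = a := by omega
      omega
    obtain ⟨θ, σ, x, φ, -, -, -, hconf⟩ := H'.exists_isRun hc' h0 (c a).L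
    have h1 := hconf (b - a) le_rfl
    rw [show a + (b - a) = b by omega] at h1
    simp only [add_zero, actL, actR, if_true, Bool.false_eq_true, if_false] at h1
    have h2 : (c b).L = x (b - a) := by rw [h1]; simp
    have h3 : (c b).R = (flat ((c a).L⁻¹ * (c b).L))⁻¹ * (c a).R * flat ((c a).L⁻¹ * (c b).L) := by
      rw [h2, h1]
    have h4 : len (flat ((c a).L⁻¹ * (c b).L)) ≤ len (c a).L + len (c b).L := by
      refine (len_flat_le _).trans ((len_mul_le _ _).trans ?_)
      rw [len_inv]
    have h5 := len_conj_le (flat ((c a).L⁻¹ * (c b).L)) (c a).R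
    have h6 := len_conj_le (flat ((c a).L⁻¹ * (c b).L))⁻¹ (c b).R
    rw [← h3] at h5
    rw [len_inv, h3, show ∀ g y : FreeGroup (S.A × Fin 2), g⁻¹⁻¹ * (g⁻¹ * y * g) * g⁻¹ = y by
      intro g y; group, ← h3] at h6
    omega
  have hL : len (1 : FreeGroup (S.A × Fin 2)) = 0 := len_one
  have h0 : 0 < a → lk = true ∧ IsExitRule i (h (a - 1)) ∧ (c a).L = 1 := by
    intro h0
    obtain ⟨h1, h2, -, h3⟩ := hexit (a - 1) (by omega) (ha h0)
    rw [Nat.sub_add_cancel h0] at h3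
    exact ⟨h1, h2, h3⟩
  unfold Conf.len at hrun ⊢
  -- By `not_isolated` at most one end of the counting interval is a switch; the other one is an end
  -- of the computation.
  rcases Nat.eq_zero_or_pos a with rfl | ha0
  · rcases eq_or_lt_of_le hbt with rfl | hb0
    · omega
    · obtain ⟨h1, -, h2, -⟩ := hexit b hb0 (hb hb0)
      have := hconj h1
      rw [h2] at this hrun
      omega
  · obtain ⟨h1, h2, h3⟩ := h0 ha0
    rcases eq_or_lt_of_le hbt with rfl | hb0
    · have := hconj h1
      rw [h3] at this hrun
      omega
    · obtain ⟨-, h4, -⟩ := hexit b hb0 (hb hb0)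
      subst h1
      refine (H.not_isolated (a := a - 1) (by omega) hb0 (fun k h5 h6 => hP k (by omega) h6)
        h2 h4).elim

end SMachine

/-! ### The case of the right neighbour K. -/

namespace SMachine

open FreeGroup Counter

variable {n : ℕ} {S : SMachine n}

/-- The word that is preserved by the adding machine. -/
def Conf.content (lk : Bool) (c : Conf S) : FreeGroup (S.A × Fin 2) :=
  if lk then flat c.L * c.R else c.R⁻¹ * flat c.L * c.R

theorem flat_flat {A : Type} (x : FreeGroup (A × Fin 2)) : flat (flat x) = flat x := by
  have : (flat (A := A)).comp flat = flat := by
    ext ⟨a, i⟩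
    simp [flat]
  exact DFunLike.congr_fun this x

theorem content_act (lk : Bool) (q q' : CompState S) (g L R : FreeGroup (S.A × Fin 2)) :
    Conf.content lk ⟨q, actL lk g L, actR true g R⟩ = Conf.content lk ⟨q', L, R⟩ := by
  cases lk <;> simp [Conf.content, actL, actR, mul_assoc]

theorem Conf.len_content_le (lk : Bool) (c : Conf S) : FreeGroup.len (c.content lk) ≤ 3 * c.len := by
  have h1 := len_conj_le c.R (flat c.L)
  have h2 := len_flat_le c.L
  have h3 := len_mul_le (flat c.L) c.R
  unfold content Conf.len
  split_ifs <;> omega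

/-- The left tape word is not in the canonical form that is required for all rules but the
transition rules. -/
def Conf.Thick (i : Fin n) (c : Conf S) : Prop :=
  (c.state = .p i ∨ ∃ θ, c.state = .pz i θ .three) ∧ c.R = 1 ∧ flat c.L ≠ c.L

theorem ZStep.flat_left_three {A : Type} {s : Set A} {σ : ZStep s} (hσ : ¬σ.IsExit)
    (h : σ.target = .three) : σ.source = .three ∧ flat σ.left = σ.left := by
  obtain ⟨z, ε⟩ := σ
  cases z <;> cases ε <;>
    simp_all [ZStep.target, ZStep.source, ZStep.left, ZRule.target, ZRule.source, ZRule.left,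
      ZRule.a0, flat, ZStep.IsExit]

theorem flat_basicWord (lk : Bool) (f : Fin (n + 1) → SPart S.Q S.A) (i : Fin n)
    {y : FreeGroup (S.A × Fin 2)} (hy : flat y = y) :
    flat (basicWord lk f i y) = basicWord lk f i y := by
  cases lk <;> simp [basicWord, hy, flat_lift0]

theorem Special.thick_iff {i : Fin n} {lk : Bool} {r : CompRule S} {c c' : Conf S}
    (h : Special i lk r c c') :
    (c.Thick i ↔ c'.Thick i) ∧ (c.Thick i → c.L = c'.L ∧ c.R = c'.R) := by
  cases h with
  | exit θ R => simp [Conf.Thick]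
  | basic θ y hy => simp [Conf.Thick, flat_basicWord, hy]
  | idle θ j z hj x hx L hL => simp
  | transition θ L => simp [Conf.Thick]

/-- Apart from the transition rules, every rule applicable to `p_i` or `p_i(θ, 3)` requires a left
word fixed by `flat`, and transitions keep the tape words. So a thick configuration is frozen. -/
theorem TripleStep.thick_iff {i : Fin n} {lk rk : Bool} {ρ : S.compZ.Rule} {c c' : Conf S}
    (h : TripleStep i lk rk ρ c c') :
    (c.Thick i ↔ c'.Thick i) ∧ (c.Thick i → c.L = c'.L ∧ c.R = c'.R) := by
  cases h with
  | counter θ σ L R hne test three =>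
    have h1 : ¬Conf.Thick i ⟨.pz i θ σ.source, L, R⟩ := by
      rintro ⟨h1 | ⟨θ', h1⟩, -, h2⟩
      · cases h1
      · exact h2 (three (CompState.pz.inj h1).2.2)
    have h2 : ¬Conf.Thick i ⟨.pz i θ σ.target, actL lk σ.left L, actR rk σ.left R⟩ := by
      rintro ⟨h2 | ⟨θ', h2⟩, -, h3⟩
      · cases h2
      · obtain ⟨h4, h5⟩ := ZStep.flat_left_three hne (CompState.pz.inj h2).2.2
        refine h3 ?_
        cases lk <;> simp [actL, three h4, h5]
    exact ⟨iff_of_false h1 h2, fun h => absurd h h1⟩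
  | pos r c c' h => exact h.thick_iff
  | neg r c c' h =>
    have := h.thick_iff
    exact ⟨this.1.symm, fun h => (this.2 (this.1.2 h)).imp Eq.symm Eq.symm⟩

theorem TripleComp.eq_of_thick {i : Fin n} {lk rk : Bool} {t : ℕ} {h : ℕ → S.compZ.Rule}
    {c : ℕ → Conf S} (H : TripleComp i lk rk t h c) {j : ℕ} (hj : j ≤ t) (hc : (c j).Thick i) :
    (c j).len = (c 0).len := by
  induction j with
  | zero => rfl
  | succ j ih =>
    obtain ⟨h1, h2⟩ := (H.step j hj).thick_iff
    have h3 := h2 (h1.2 hc)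
    rw [← ih (by omega) (h1.2 hc), Conf.len, Conf.len, h3.1, h3.2]

/-- When no counting takes place, one of the two words is trivial and the left one is fixed by
`flat`, so passing to the content loses no length. -/
theorem Special.len_content {i : Fin n} {lk : Bool} {r : CompRule S} {c c' : Conf S}
    (h : Special i lk r c c') (hc : ¬c.Thick i) (hL : lk = false → c.L ≠ 1) :
    FreeGroup.len (c.content lk) = c.len ∧ FreeGroup.len (c'.content lk) = c'.len := by
  cases h with
  | exit θ R =>
    cases lk
    · exact absurd rfl (hL rfl)
    · simp [Conf.content, Conf.len]
  | basic θ y hy => simp [Conf.content, Conf.len, flat_basicWord _ _ _ hy]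
  | idle θ j z hj x hx L hfl => simp [Conf.content, Conf.len, hfl]
  | transition θ L =>
    have : flat L = L := by
      by_contra h
      exact hc ⟨.inr ⟨θ, rfl⟩, rfl, h⟩
    simp [Conf.content, Conf.len, this]

theorem TripleStep.len_content {i : Fin n} {lk rk : Bool} {ρ : S.compZ.Rule} {c c' : Conf S}
    (h : TripleStep i lk rk ρ c c') (hρ : ¬IsCounter i ρ) (hc : ¬c.Thick i)
    (hL : lk = false → c.L ≠ 1) :
    FreeGroup.len (c.content lk) = c.len ∧ FreeGroup.len (c'.content lk) = c'.len := by
  have hc' := mt h.thick_iff.1.2 hc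
  cases h with
  | counter θ σ L R hne test three => exact absurd ⟨θ, σ, hne, rfl⟩ hρ
  | pos r c c' h => exact h.len_content hc hL
  | neg r c c' h =>
    cases h with
    | exit θ R =>
      cases lk
      · exact absurd rfl (hL rfl)
      · simp [Conf.content, Conf.len]
    | basic θ y hy => simp [Conf.content, Conf.len, flat_basicWord _ _ _ hy]
    | idle θ j z hj x hx L hfl => simp [Conf.content, Conf.len, hfl]
    | transition θ L => exact ((Special.transition θ L).len_content hc' hL).symm

/-- A positive rule of `S` whose application created the letter, if the letter is `p_i(θ, 1)` or
`p_i(θ, 2)` for a positive rule `θ`. -/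
def CompState.creator (q : CompState S) : Option S.R :=
  q.activeRule.bind fun θ => if θ.2 then some θ.1 else none

/-- The word on the left of a basic word. -/
def prefixWord (lk : Bool) (f : Fin (n + 1) → SPart S.Q S.A) (i : Fin n) :
    FreeGroup (S.A × Fin 2) :=
  if lk then lift0 (f i.castSucc).right else (lift0 (f i.succ).left)⁻¹

/-- The word on the right of a basic word. -/
def suffixWord (f : Fin (n + 1) → SPart S.Q S.A) (i : Fin n) : FreeGroup (S.A × Fin 2) :=
  lift0 (f i.succ).left

/-- The content before the application of the rule of `S` that created the `P`-letter. -/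
def Conf.origin (i : Fin n) (lk : Bool) (c : Conf S) : FreeGroup (S.A × Fin 2) :=
  match c.state.creator with
  | none => c.content lk
  | some θ => prefixWord lk (S.src θ) i * (prefixWord lk (S.tgt θ) i)⁻¹ * c.content lk *
      (suffixWord (S.tgt θ) i)⁻¹ * suffixWord (S.src θ) i

theorem exists_len_origin_le (S : SMachine n) (i : Fin n) (lk : Bool) :
    ∃ k : ℕ, ∀ c : Conf S, len (c.origin i lk) ≤ len (c.content lk) + k ∧
      len (c.content lk) ≤ len (c.origin i lk) + k := by
  have := S.finite_R
  let f : S.R → ℕ := fun θ => len (prefixWord lk (S.src θ) i) + len (prefixWord lk (S.tgt θ) i) +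
    len (suffixWord (S.tgt θ) i) + len (suffixWord (S.src θ) i)
  obtain ⟨k, hk⟩ := (Set.finite_range f).bddAbove
  have hmul : ∀ a b x d e : FreeGroup (S.A × Fin 2),
      len (a * b * x * d * e) ≤ len x + (len a + len b + len d + len e) := by
    intro a b x d e
    have h1 := len_mul_le (a * b * x * d) e
    have h2 := len_mul_le (a * b * x) d
    have h3 := len_mul_le (a * b) x
    have h4 := len_mul_le a b
    omega
  refine ⟨k, fun c => ?_⟩
  unfold Conf.origin
  cases hc : c.state.creator with
  | none => dsimp only; omega
  | some θ =>
    dsimp only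
    have h1 : f θ ≤ k := hk ⟨θ, rfl⟩
    simp only [f] at h1
    set a := prefixWord lk (S.src θ) i
    set b := prefixWord lk (S.tgt θ) i
    set d := suffixWord (S.tgt θ) i
    set e := suffixWord (S.src θ) i
    have h2 := hmul a b⁻¹ (c.content lk) d⁻¹ e
    have h3 := hmul b a⁻¹ (a * b⁻¹ * c.content lk * d⁻¹ * e) e⁻¹ d
    rw [show b * a⁻¹ * (a * b⁻¹ * c.content lk * d⁻¹ * e) * e⁻¹ * d = c.content lk by group] at h3
    simp only [len_inv] at h2 h3
    omega

/-- Each basic rule changes the content by bounded words, but such changes might accumulate. The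
letter `p_i(θ, 1)` remembers θ, and `origin` undoes its effect; without a switch the only way back
to `p_i` is the inverse of θ itself. -/
theorem Special.origin_eq {i : Fin n} {lk : Bool} {r : CompRule S} {c c' : Conf S}
    (h : Special i lk r c c') (hr : ¬∃ θ, r = .adding θ i .r13) :
    c.origin i lk = c'.origin i lk := by
  cases h with
  | exit θ R => exact absurd ⟨θ, rfl⟩ hr
  | basic θ y hy =>
    have h1 : ∀ (q : CompState S) (f : Fin (n + 1) → SPart S.Q S.A),
        Conf.content lk ⟨q, basicWord lk f i y, 1⟩ = prefixWord lk f i * y * suffixWord f i := by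
      intro q f
      simp only [Conf.content, flat_basicWord lk f i hy]
      cases lk <;> simp [basicWord, prefixWord, suffixWord]
    simp only [Conf.origin, CompState.creator, CompState.activeRule, h1, Option.bind_none,
      Option.bind_some, if_true]
    group
  | idle θ j z hj x hx L hL => rfl
  | transition θ L => rfl

theorem TripleStep.origin_eq {i : Fin n} {lk : Bool} {ρ : S.compZ.Rule} {c c' : Conf S}
    (h : TripleStep i lk true ρ c c') (hr : ¬IsExitRule i ρ) :
    c.origin i lk = c'.origin i lk := by
  cases h with
  | counter θ σ L R hne test three =>
    have h1 := activeRule_source (i := i) (θ := θ) hne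
    simp only [Conf.origin, CompState.creator, h1]
    rw [content_act lk _ (.pz i θ σ.source) σ.left L R]
  | pos r c c' h => exact h.origin_eq hr
  | neg r c c' h => exact (h.origin_eq hr).symm

theorem TripleComp.content_eq {i : Fin n} {lk : Bool} {t : ℕ} {h : ℕ → S.compZ.Rule}
    {c : ℕ → Conf S} (H : TripleComp i lk true t h c) (hc : ∀ j < t, IsCounter i (h j)) :
    (c 0).content lk = (c t).content lk := by
  rcases Nat.eq_zero_or_pos t with rfl | ht
  · rfl
  · obtain ⟨θ, σ, x, φ, -, -, -, hconf⟩ := H.exists_isRun hc ht 1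
    rw [hconf t le_rfl]
    exact (content_act lk _ _ _ _ _).symm

/-- A computation of the adding machine that moves the whole content from one side of the `P`-letter
to the other takes exponential time. -/
theorem TripleComp.pow_le_of_crossing {i : Fin n} {t : ℕ} {h : ℕ → S.compZ.Rule}
    {c : ℕ → Conf S} (H : TripleComp i true true t h c) (hc : ∀ j < t, IsCounter i (h j))
    {θ θ' : S.Rule} (h0 : (c 0).state = .pz i θ .one) (ht : (c t).state = .pz i θ' .one)
    (hx : ((c 0).R = 1 ∧ flat (c 0).L = (c 0).L ∧ (c t).L = 1) ∨
      ((c 0).L = 1 ∧ (c t).R = 1 ∧ flat (c t).L = (c t).L)) :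
    2 ^ len ((c 0).content true) ≤ 4 * t + 1 := by
  have hcont := H.content_eq hc
  rcases Nat.eq_zero_or_pos t with rfl | hpos
  · have : (c 0).content true = 1 := by
      rcases hx with ⟨h1, h2, h3⟩ | ⟨h1, h2, h3⟩ <;> simp [Conf.content, *]
    simp [this]
  obtain ⟨θ₁, σ, x, φ, hr, hx0, -, hconf⟩ := H.exists_isRun hc hpos (c 0).L
  have h1 := congrArg Conf.state (hconf 0 (by omega))
  have h2 := congrArg Conf.state (hconf t le_rfl)
  rw [h0] at h1
  rw [ht] at h2
  simp only [CompState.pz.injEq, true_and] at h1 h2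
  have h3 : (c t).L = x t := by
    have := congrArg Conf.L (hconf t le_rfl)
    simpa [actL] using this
  have e0 : (c 0).content true = flat (c 0).L * (c 0).R := rfl
  rw [e0]
  rcases hx with ⟨h4, h5, h6⟩ | ⟨h4, h5, h6⟩
  · refine hr.pow_le_of_crossing ?_ h1.2.symm h2.2.symm (.inl ⟨?_, ?_⟩)
    · rw [h4, mul_one, flat_flat]
    · rw [hx0, h4, mul_one, h5]
    · rw [← h3, h6]
  · have e1 : flat (c 0).L * (c 0).R = (c t).L := by
      rw [← e0, hcont, Conf.content, if_pos rfl, h5, mul_one, h6]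
    refine hr.pow_le_of_crossing ?_ h1.2.symm h2.2.symm (.inr ⟨?_, ?_⟩)
    · rw [e1, h6]
    · rw [hx0, h4]
    · rw [e1, h3]

/-- A run in the phases one and two that is bounded by a rule other than a switch has there phase
one, an empty right tape and a flat left tape. This is one of the two extreme positions in
`pow_le_of_crossing`. -/
theorem Special.boundary {i : Fin n} {lk : Bool} {r : CompRule S} {c c' d : Conf S}
    (h : Special i lk r c c') (hd : d = c ∨ d = c') {θ : S.Rule}
    (hθ : d.state.activeRule = some θ) :
    (∃ θ, d.state = .pz i θ .one) ∧ ((d.R = 1 ∧ flat d.L = d.L) ∨ ∃ θ, r = .adding θ i .r13) := by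
  cases h with
  | exit θ' R =>
    rcases hd with rfl | rfl
    · exact ⟨⟨θ', rfl⟩, .inr ⟨θ', rfl⟩⟩
    · cases hθ
  | basic θ' y hy =>
    rcases hd with rfl | rfl
    · cases hθ
    · exact ⟨⟨_, rfl⟩, .inl ⟨rfl, flat_basicWord _ _ _ hy⟩⟩
  | idle θ' j z hj x hx L hL =>
    have : d = ⟨.pz i θ' x, L, 1⟩ := by rcases hd with rfl | rfl <;> rfl
    subst this
    cases x with
    | one => exact ⟨⟨_, rfl⟩, .inl ⟨rfl, hL⟩⟩
    | two => exact absurd rfl hx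
    | three => cases hθ
  | transition θ' L => rcases hd with rfl | rfl <;> cases hθ

theorem TripleStep.boundary {i : Fin n} {lk rk : Bool} {ρ : S.compZ.Rule} {c c' d : Conf S}
    (h : TripleStep i lk rk ρ c c') (hρ : ¬IsCounter i ρ) (hd : d = c ∨ d = c') {θ : S.Rule}
    (hθ : d.state.activeRule = some θ) :
    (∃ θ, d.state = .pz i θ .one) ∧ ((d.R = 1 ∧ flat d.L = d.L) ∨ IsExitRule i ρ) := by
  cases h with
  | counter θ σ L R hne test three => exact absurd ⟨θ, σ, hne, rfl⟩ hρ
  | pos r c c' h => exact h.boundary hd hθ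
  | neg r c c' h => exact h.boundary hd.symm hθ

theorem le_log_of_pow_le {k m t : ℕ} (h : 2 ^ k ≤ 4 * m + 1) (hm : m ≤ t) :
    k ≤ Nat.log 2 (4 * t + 1) :=
  Nat.le_log_of_pow_le (by norm_num) (by omega)

/-- At a switch `L = 1`, so the whole content is on the right. The adjacent run on the side of phase
one either reaches an end of the computation, or at its other end the whole content is on the left.
In the latter case the run is a crossing and the content is logarithmic in `t`; another switch there
is excluded by `not_isolated`. -/
theorem TripleComp.len_content_le_of_exit {i : Fin n} {t : ℕ} {h : ℕ → S.compZ.Rule}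
    {c : ℕ → Conf S} (H : TripleComp i true true t h c) {e : ℕ} (he : e < t)
    (hexit : IsExitRule i (h e)) :
    (c e).content true = (c (e + 1)).content true ∧
    len ((c e).content true) ≤ 3 * ((c 0).len + (c t).len) + Nat.log 2 (4 * t + 1) := by
  obtain ⟨θ, R, hcase⟩ := (H.step e he).of_isExitRule hexit
  have hcont : (c e).content true = (c (e + 1)).content true := by
    rcases hcase with ⟨-, h1, h2⟩ | ⟨-, h1, h2⟩ <;> rw [h1, h2] <;> rfl
  refine ⟨hcont, ?_⟩
  have hlen := Conf.len_content_le (S := S) true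
  rcases hcase with ⟨-, h1, -⟩ | ⟨-, -, h1⟩
  · obtain ⟨a, b, hae, heb, hbe, hP, ha, -⟩ :=
      exists_maximal_interval (fun k => IsCounter i (h k)) (le_refl e)
    obtain rfl : b = e := by omega
    have H' := H.sub hae he.le
    have hc' : ∀ k < b - a, IsCounter i (h (a + k)) := fun k hk => hP _ (by omega) (by omega)
    have h2 := H'.content_eq hc'
    have h3 := H'.activeRule_eq hc'
    have e1 : a + (b - a) = b := by omega
    simp only [add_zero, e1] at h2 h3
    rcases Nat.eq_zero_or_pos a with rfl | ha0
    · rw [← h2]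
      have := hlen (c 0)
      omega
    · have h4 := H.step (a - 1) (by omega)
      rw [Nat.sub_add_cancel ha0] at h4
      rw [h1] at h3
      obtain ⟨⟨θ', h5⟩, h6 | h6⟩ := h4.boundary (ha ha0) (.inr rfl) h3
      · have := H'.pow_le_of_crossing hc' h5 (θ' := θ)
          (by simp only [e1]; rw [h1]) (.inl ⟨h6.1, h6.2, by simp only [e1]; rw [h1]⟩)
        simp only [add_zero] at this
        rw [← h2]
        have := le_log_of_pow_le this (t := t) (by omega)
        omega
      · exact (H.not_isolated (a := a - 1) (by omega) he
          (fun k h7 h8 => hP k (by omega) h8) h6 hexit).elim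
  -- The inverse switch enters phase one, so the run after it is used.
  · obtain ⟨a, b, hae, heb, hbt, hP, -, hb⟩ :=
      exists_maximal_interval (fun k => IsCounter i (h k)) (show e + 1 ≤ t by omega)
    have H' := H.sub heb hbt
    have hc' : ∀ k < b - (e + 1), IsCounter i (h (e + 1 + k)) :=
      fun k hk => hP _ (by omega) (by omega)
    have h2 := H'.content_eq hc'
    have h3 := H'.activeRule_eq hc'
    have e1 : e + 1 + (b - (e + 1)) = b := by omega
    simp only [add_zero, e1] at h2 h3
    rw [hcont]
    rcases eq_or_lt_of_le hbt with rfl | hb0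
    · rw [h2]
      have := hlen (c b)
      omega
    · rw [h1] at h3
      obtain ⟨⟨θ', h5⟩, h6 | h6⟩ := (H.step b hb0).boundary (hb hb0) (.inl rfl) h3.symm
      · have := H'.pow_le_of_crossing hc' (θ := θ) (θ' := θ') (by simp only [add_zero]; rw [h1])
          (by simp only [e1]; rw [h5])
          (.inr ⟨by simp only [add_zero]; rw [h1], by simp only [e1]; exact h6⟩)
        simp only [add_zero] at this
        have := le_log_of_pow_le this (t := t) (by omega)
        omega
      · exact (H.not_isolated heb hb0 (fun k h7 h8 => hP k (by omega) h8) hexit h6).elim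

/-- The bound for the right end `K`. -/
theorem exists_len_le_of_right_true (S : SMachine n) (i : Fin n) (lk : Bool) :
    ∃ C : ℕ, ∀ (t : ℕ) (h : ℕ → S.compZ.Rule) (c : ℕ → Conf S), TripleComp i lk true t h c →
      ∀ j ≤ t, (c j).len ≤ C * ((c 0).len + (c t).len + Nat.log 2 (4 * t + 1) + 1) := by
  obtain ⟨k, hk⟩ := exists_len_origin_le S i lk
  -- The ends of a counting interval will have length at most 3 X + 2 k each; with the factor 40 for
  -- counting this gives 240 X + 160 k.
  refine ⟨400 + 160 * k, fun t h c H j hj => ?_⟩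
  set X := (c 0).len + (c t).len + Nat.log 2 (4 * t + 1) with hX
  have hmul : 400 * X + 160 * k ≤ (400 + 160 * k) * (X + 1) := by nlinarith [Nat.zero_le (k * X)]
  by_cases hthick : (c j).Thick i
  · rw [H.eq_of_thick hj hthick]
    omega
  have hthin : ∀ m ≤ t, ¬(c m).Thick i := by
    have h1 : ∀ m ≤ t, ((c m).Thick i ↔ (c 0).Thick i) := by
      intro m
      induction m with
      | zero => exact fun _ => Iff.rfl
      | succ m ih => exact fun hm => (H.step m hm).thick_iff.1.symm.trans (ih (by omega))
    intro m hm
    rw [h1 m hm, ← h1 j hj]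
    exact hthick
  have hleft : ∀ m < t, IsExitRule i (h m) → lk = true := by
    intro m hm h1
    by_contra h2
    obtain ⟨θ, R, ⟨-, h3, -⟩ | ⟨-, h3, -⟩⟩ := (H.step m hm).of_isExitRule h1 <;>
      exact H.left_ne (by simpa using h2) m hm (by rw [h3])
  have horigin : ∀ m ≤ t, len ((c m).origin i lk) ≤ 3 * X + k := by
    intro m
    induction m with
    | zero =>
      intro _
      have h1 := (hk (c 0)).1
      have h2 := (c 0).len_content_le lk
      omega
    | succ m ih =>
      intro hm
      -- Nothing accumulates: a switch gives a fresh bound for the content, and all other steps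
      -- preserve the origin.
      by_cases h1 : IsExitRule i (h m)
      · obtain rfl := hleft m hm h1
        obtain ⟨h2, h3⟩ := H.len_content_le_of_exit hm h1
        have h4 := (hk (c (m + 1))).1
        rw [← h2] at h4
        omega
      · rw [← (H.step m hm).origin_eq h1]
        exact ih (by omega)
  have hcont : ∀ m ≤ t, len ((c m).content lk) ≤ 3 * X + 2 * k := by
    intro m hm
    have h1 := horigin m hm
    have h2 := (hk (c m)).2
    omega
  obtain ⟨a, b, haj, hjb, hbt, hP, ha, hb⟩ :=
    exists_maximal_interval (fun k => IsCounter i (h k)) hj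
  have hspecial : ∀ m < t, ¬IsCounter i (h m) →
      (c m).len ≤ 3 * X + 2 * k ∧ (c (m + 1)).len ≤ 3 * X + 2 * k := by
    intro m hm h1
    obtain ⟨h2, h3⟩ := (H.step m hm).len_content h1 (hthin m hm.le) (fun hl => H.left_ne hl m hm)
    have h4 := hcont m hm.le
    have h5 := hcont (m + 1) hm
    omega
  have hca : (c a).len ≤ 3 * X + 2 * k := by
    rcases Nat.eq_zero_or_pos a with rfl | ha0
    · omega
    · have := (hspecial (a - 1) (by omega) (ha ha0)).2
      rwa [Nat.sub_add_cancel ha0] at this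
  have hcb : (c b).len ≤ 3 * X + 2 * k := by
    rcases eq_or_lt_of_le hbt with rfl | hb0
    · omega
    · exact (hspecial b hb0 (hb hb0)).1
  have hrun := (H.sub (haj.trans hjb) hbt).len_le_of_isCounter
    (fun k hk => hP _ (by omega) (by omega)) (j := j - a) (by omega)
  simp only [add_zero] at hrun
  rw [show a + (j - a) = j by omega, show a + (b - a) = b by omega] at hrun
  omega

/-- The bound for the words next to a `P`-letter. -/
theorem exists_tripleComp_len_le (S : SMachine n) (i : Fin n) (lk rk : Bool) :
    ∃ C : ℕ, ∀ (t : ℕ) (h : ℕ → S.compZ.Rule) (c : ℕ → Conf S), TripleComp i lk rk t h c →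
      ∀ j ≤ t, (c j).len ≤ C * ((c 0).len + (c t).len + Nat.log 2 (4 * t + 1) + 1) := by
  cases rk
  · refine ⟨160, fun t h c H j hj => ?_⟩
    have := H.len_le_of_right_false hj
    omega
  · exact exists_len_le_of_right_true S i lk

end SMachine

/-! ### From computations with a fixed base to its gaps; gaps next to P-letters. -/

namespace SMachine

open FreeGroup Counter

section General

variable {n : ℕ} {M : SMachine n}

theorem TailStep.map_base {ρ : M.Rule} {a : M.Letter} {l l' : List (FreeGroup M.A × M.Letter)}
    (h : TailStep ρ a l l') : (l'.map fun x => x.2.base) = l.map fun x => x.2.base := by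
  induction h with
  | nil a => rfl
  | cons a b b' y w w' l l' _ _ _ _ hb _ _ ih => simp [ih, hb.base_eq]

theorem Step.base_eq {ρ : M.Rule} {W W' : M.Word} (h : Step ρ W W') : W'.base = W.base := by
  rw [Word.base, Word.base, h.1.base_eq, h.2.map_base]

/-- `W 0 → ⋯ → W t` is a computation with base `b`. -/
structure CompWithBase (b : List (BaseLetter n)) (t : ℕ) (W : ℕ → M.Word) (h : ℕ → M.Rule) :
    Prop where
  isComputation : IsComputation t W h
  base : (W 0).base = b

variable {b : List (BaseLetter n)} {t : ℕ} {W : ℕ → M.Word} {h : ℕ → M.Rule}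

theorem CompWithBase.base_eq (H : CompWithBase b t W h) {j : ℕ} (hj : j ≤ t) : (W j).base = b := by
  induction j with
  | zero => exact H.base
  | succ j ih => rw [(H.isComputation.1 j hj).base_eq, ih (by omega)]

theorem CompWithBase.tail_length (H : CompWithBase b t W h) {j : ℕ} (hj : j ≤ t) :
    (W j).tail.length + 1 = b.length := by
  rw [← H.base_eq hj, Word.length_base]

theorem CompWithBase.letter_base (H : CompWithBase b t W h) {j : ℕ} (hj : j ≤ t) {k : ℕ}
    {x : BaseLetter n} (hx : b[k]? = some x) : ((W j).letter k).base = x := by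
  have h1 := H.tail_length hj
  have h2 : k < b.length := (List.getElem?_eq_some_iff.1 hx).1
  have h3 := (W j).base_getElem? (k := k) (by omega)
  rw [H.base_eq hj, hx] at h3
  exact (Option.some.inj h3).symm

theorem CompWithBase.gapStep (H : CompWithBase b t W h) {j : ℕ} (hj : j < t) {k : ℕ}
    (hk : k + 1 < b.length) :
    GapStep (h j) ((W j).letter k) ((W j).gap k) ((W j).letter (k + 1)) ((W (j + 1)).gap k) := by
  have h1 := H.tail_length hj.le
  exact (H.isComputation.1 j hj).gapStep (by omega)

theorem CompWithBase.letterStep (H : CompWithBase b t W h) {j : ℕ} (hj : j < t) {k : ℕ}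
    (hk : k < b.length) : LetterStep (h j) ((W j).letter k) ((W (j + 1)).letter k) := by
  have h1 := H.tail_length hj.le
  exact (H.isComputation.1 j hj).letterStep (by omega)

theorem CompWithBase.len_gap_le (H : CompWithBase b t W h) {j : ℕ} (hj : j ≤ t) {k : ℕ}
    (hk : k + 1 < b.length) : len ((W j).gap k) ≤ (W j).length := by
  have h1 := H.tail_length hj
  exact ((W j).len_gap_lt (by omega)).le

/-- The rule prescribes the state letter of each part, so the two letters are mutually inverse, and
the word is reduced. -/
theorem GapStep.ne_one {ρ : M.Rule} {a b : M.Letter} {w w' : FreeGroup M.A}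
    (h : GapStep ρ a w b w') {i : Fin (n + 1)} {ε : Bool} (ha : a.base = (i, ε))
    (hb : b.base = (i, !ε)) : w ≠ 1 := by
  intro hw
  refine h.reduced ⟨hw, ?_⟩
  have h1 : M.part a.1 = i := congrArg Prod.fst ha
  have h2 : M.part b.1 = i := congrArg Prod.fst hb
  have h3 : a.2 = ε := congrArg Prod.snd ha
  have h4 : b.2 = !ε := congrArg Prod.snd hb
  have h5 := h.left
  have h6 := h.right
  rw [h1] at h5
  rw [h2] at h6
  exact Prod.ext (h6.trans h5.symm) (by rw [h4, Letter.inv, h3])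

/-- Any two consecutive letters refer to the same tape alphabet. -/
def WellFormed (b : List (BaseLetter n)) : Prop :=
  ∀ k x y, b[k]? = some x → b[k + 1]? = some y → x.gapAfter = y.gapBefore

theorem CompWithBase.eq_zero_of_not_wellFormed (H : CompWithBase b t W h) (hb : ¬WellFormed b) :
    t = 0 := by
  by_contra ht
  refine hb fun k x y hx hy => ?_
  have h1 := (H.gapStep (j := 0) (by omega) (List.getElem?_eq_some_iff.1 hy).1).adjacent
  rwa [H.letter_base (by omega) hx, H.letter_base (by omega) hy] at h1

/-- The words in the gap number `k` are bounded in computations with base `b`. -/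
def GapGood (M : SMachine n) (b : List (BaseLetter n)) (k : ℕ) : Prop :=
  ∃ C : ℕ, ∀ (t : ℕ) (W : ℕ → M.Word) (h : ℕ → M.Rule), CompWithBase b t W h → ∀ j ≤ t,
    len ((W j).gap k) ≤ C * ((W 0).length + (W t).length + Nat.log 2 (4 * t + 1) + 1)

/-- The words of computations with base `b` are bounded. -/
def Good (M : SMachine n) (b : List (BaseLetter n)) : Prop :=
  ∃ C : ℕ, ∀ (t : ℕ) (W : ℕ → M.Word) (h : ℕ → M.Rule), CompWithBase b t W h → ∀ j ≤ t,
    (W j).length ≤ C * ((W 0).length + (W t).length + Nat.log 2 (4 * t + 1) + 1)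

theorem good_of_gapGood (h : ∀ k, k + 1 < b.length → GapGood M b k) : Good M b := by
  have h' : ∀ k, ∃ C : ℕ, k + 1 < b.length →
      ∀ (t : ℕ) (W : ℕ → M.Word) (h : ℕ → M.Rule), CompWithBase b t W h → ∀ j ≤ t,
      len ((W j).gap k) ≤ C * ((W 0).length + (W t).length + Nat.log 2 (4 * t + 1) + 1) := by
    intro k
    by_cases hk : k + 1 < b.length
    · obtain ⟨C, hC⟩ := h k hk
      exact ⟨C, fun _ => hC⟩
    · exact ⟨0, fun hk' => absurd hk' hk⟩
  choose C hC using h'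
  refine ⟨1 + ∑ k ∈ Finset.range (b.length - 1), (C k + 1), fun t W h H j hj => ?_⟩
  have h1 := H.tail_length hj
  rw [Word.length_eq, show (W j).tail.length = b.length - 1 by omega]
  set X := (W 0).length + (W t).length + Nat.log 2 (4 * t + 1) + 1 with hX
  rw [add_mul, Finset.sum_mul]
  refine add_le_add (by omega) (Finset.sum_le_sum fun k hk => ?_)
  have h2 := hC k (by have := Finset.mem_range.1 hk; omega) t W h H j hj
  rw [← hX] at h2
  rw [add_mul]
  omega

theorem good_of_not_wellFormed (hb : ¬WellFormed b) : Good M b := by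
  refine ⟨1, fun t W h H j hj => ?_⟩
  obtain rfl := H.eq_zero_of_not_wellFormed hb
  obtain rfl : j = 0 := by omega
  omega

theorem gapGood_of_le (c : ℕ) (h : ∀ (t : ℕ) (W : ℕ → M.Word) (h : ℕ → M.Rule),
    CompWithBase b t W h → ∀ j ≤ t, len ((W j).gap k) ≤ len ((W 0).gap k) + c)
    (hk : k + 1 < b.length) : GapGood M b k := by
  refine ⟨1 + c, fun t W g H j hj => ?_⟩
  have h1 := h t W g H j hj
  have h2 := H.len_gap_le (Nat.zero_le t) hk
  nlinarith [Nat.zero_le (c * ((W 0).length + (W t).length + Nat.log 2 (4 * t + 1)))]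

end General

variable {n : ℕ} {S : SMachine n}

theorem kPlace_ne_pPlace (i : Fin (n + 1)) (j : Fin n) : kPlace i ≠ pPlace j := by
  intro h
  have := congrArg Fin.val h
  simp only [kPlace, pPlace] at this
  omega

theorem exists_left_kind {i : Fin n} {x : BaseLetter (2 * n)}
    (h : x.gapAfter = (pPlace i : Fin (2 * n + 1)) - 1) :
    ∃ lk : Bool, x = if lk then (kPlace i.castSucc, true) else (pPlace i, false) := by
  obtain ⟨a, ε⟩ := x
  cases ε
  · exact ⟨false, by simpa [BaseLetter.gapAfter] using h⟩
  · refine ⟨true, ?_⟩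
    rw [pPlace_sub_one] at h
    simpa [BaseLetter.gapAfter] using h

theorem exists_right_kind {i : Fin n} {x : BaseLetter (2 * n)}
    (h : x.gapBefore = (pPlace i : Fin (2 * n + 1))) :
    ∃ rk : Bool, x = if rk then (kPlace i.succ, true) else (pPlace i, false) := by
  obtain ⟨a, ε⟩ := x
  cases ε
  · exact ⟨false, by simpa [BaseLetter.gapBefore] using h⟩
  · refine ⟨true, ?_⟩
    rw [← sub_one_eq_pPlace] at h
    simpa [BaseLetter.gapBefore] using h

theorem tripleComp_of_gapStep {i : Fin n} {lk rk : Bool} {t : ℕ} {h : ℕ → S.compZ.Rule}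
    {a p b : ℕ → S.compZ.Letter} {L R : ℕ → FreeGroup (S.A × Fin 2)}
    (hL : ∀ j < t, GapStep (M := S.compZ) (h j) (a j) (L j) (p j) (L (j + 1)))
    (hR : ∀ j < t, GapStep (M := S.compZ) (h j) (p j) (R j) (b j) (R (j + 1)))
    (hp : ∀ j < t, LetterStep (h j) (p j) (p (j + 1)))
    (ha : ∀ j < t, (a j).base = if lk then (kPlace i.castSucc, true) else (pPlace i, false))
    (hpb : ∀ j < t, (p j).base = (pPlace i, true))
    (hb : ∀ j < t, (b j).base = if rk then (kPlace i.succ, true) else (pPlace i, false))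
    (hred : ∀ j, j + 1 < t → h (j + 1) ≠ (h j).inv) :
    TripleComp i lk rk t h (fun j => ⟨(p j).1, L j, R j⟩) where
  step j hj := tripleStep_of_gapStep (hL j hj) (hR j hj) (hp j hj) (ha j hj) (hpb j hj) (hb j hj)
  left_ne hl j hj := by
    subst hl
    exact (hL j hj).ne_one (ha j hj) (hpb j hj)
  right_ne hr j hj := by
    subst hr
    exact (hR j hj).ne_one (hpb j hj) (hb j hj)
  reduced := hred

theorem LetterStep.inv {n : ℕ} {M : SMachine n} {ρ : M.Rule} {a b : M.Letter}
    (h : LetterStep ρ a b) : LetterStep ρ a.inv b.inv :=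
  ⟨h.1, by rw [h.2]; rfl⟩

theorem gapGood_of_interior {b : List (BaseLetter (2 * n))} (hb : WellFormed b) {k : ℕ}
    {x z : BaseLetter (2 * n)} {i : Fin n} {ε : Bool} (hx : b[k]? = some x)
    (hy : b[k + 1]? = some (pPlace i, ε)) (hz : b[k + 2]? = some z) :
    GapGood S.compZ b k ∧ GapGood S.compZ b (k + 1) := by
  have hlen : k + 2 < b.length := (List.getElem?_eq_some_iff.1 hz).1
  suffices h : ∃ C : ℕ, ∀ (t : ℕ) (W : ℕ → S.compZ.Word) (h : ℕ → S.compZ.Rule),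
      CompWithBase b t W h → ∀ j ≤ t, len ((W j).gap k) + len ((W j).gap (k + 1)) ≤
        C * ((len ((W 0).gap k) + len ((W 0).gap (k + 1))) +
          (len ((W t).gap k) + len ((W t).gap (k + 1))) + Nat.log 2 (4 * t + 1) + 1) by
    obtain ⟨C, hC⟩ := h
    have : ∀ (t : ℕ) (W : ℕ → S.compZ.Word) (h : ℕ → S.compZ.Rule),
      CompWithBase b t W h → ∀ j ≤ t, len ((W j).gap k) + len ((W j).gap (k + 1)) ≤
        (2 * C) * ((W 0).length + (W t).length + Nat.log 2 (4 * t + 1) + 1) := by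
      intro t W h H j hj
      have h1 := H.len_gap_le (Nat.zero_le t) (k := k) (by omega)
      have h2 := H.len_gap_le (Nat.zero_le t) (k := k + 1) (by omega)
      have h3 := H.len_gap_le le_rfl (k := k) (by omega)
      have h4 := H.len_gap_le le_rfl (k := k + 1) (by omega)
      refine (hC t W h H j hj).trans ?_
      rw [mul_comm 2 C, mul_assoc]
      exact Nat.mul_le_mul_left C (by omega)
    exact ⟨⟨2 * C, fun t W h H j hj => (Nat.le_add_right _ _).trans (this t W h H j hj)⟩,
      ⟨2 * C, fun t W h H j hj => (Nat.le_add_left _ _).trans (this t W h H j hj)⟩⟩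
  have hxy := hb k x _ hx hy
  have hyz := hb (k + 1) _ z hy hz
  cases ε
  -- For exponent -1 the inverse word is read: the two neighbours change places and the gaps are
  -- inverted.
  · obtain ⟨lk, hlk⟩ := exists_left_kind (i := i) (x := (z.1, !z.2)) (by
      obtain ⟨z, δ⟩ := z
      cases δ <;> exact hyz.symm)
    obtain ⟨rk, hrk⟩ := exists_right_kind (i := i) (x := (x.1, !x.2)) (by
      obtain ⟨x, δ⟩ := x
      cases δ <;> exact hxy)
    obtain ⟨C, hC⟩ := exists_tripleComp_len_le S i lk rk
    refine ⟨C, fun t W h H j hj => ?_⟩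
    have hinv : ∀ a : S.compZ.Letter, a.inv.base = (a.base.1, !a.base.2) := fun a => rfl
    have := hC t h _ (tripleComp_of_gapStep (i := i) (lk := lk) (rk := rk) (t := t) (h := h)
      (a := fun j => ((W j).letter (k + 2)).inv) (p := fun j => ((W j).letter (k + 1)).inv)
      (b := fun j => ((W j).letter k).inv) (L := fun j => ((W j).gap (k + 1))⁻¹)
      (R := fun j => ((W j).gap k)⁻¹) (fun j hj => (H.gapStep hj (by omega)).inv)
      (fun j hj => (H.gapStep hj (by omega)).inv)
      (fun j hj => (H.letterStep hj (by omega)).inv)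
      (fun j hj => by rw [hinv, H.letter_base hj.le hz, hlk])
      (fun j hj => by rw [hinv, H.letter_base hj.le hy]; rfl)
      (fun j hj => by rw [hinv, H.letter_base hj.le hx, hrk]) H.isComputation.2) j hj
    have e : ∀ (q : CompState S) (y z : FreeGroup S.compZ.A),
        len z + len y = Conf.len (⟨q, y⁻¹, z⁻¹⟩ : Conf S) := fun q y z => by
      change _ = len y⁻¹ + len z⁻¹
      rw [len_inv, len_inv, add_comm]
    rw [e ((W j).letter (k + 1)).1, e ((W 0).letter (k + 1)).1, e ((W t).letter (k + 1)).1]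
    exact this
  · obtain ⟨lk, hlk⟩ := exists_left_kind (i := i) (x := x) hxy
    obtain ⟨rk, hrk⟩ := exists_right_kind (i := i) (x := z) hyz.symm
    obtain ⟨C, hC⟩ := exists_tripleComp_len_le S i lk rk
    refine ⟨C, fun t W h H j hj => ?_⟩
    exact hC t h _ (tripleComp_of_gapStep (i := i) (lk := lk) (rk := rk) (t := t) (h := h)
      (a := fun j => (W j).letter k) (p := fun j => (W j).letter (k + 1))
      (b := fun j => (W j).letter (k + 2)) (L := fun j => (W j).gap k)
      (R := fun j => (W j).gap (k + 1)) (fun j hj => H.gapStep hj (by omega))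
      (fun j hj => H.gapStep hj (by omega))
      (fun j hj => H.letterStep hj (by omega))
      (fun j hj => by rw [H.letter_base hj.le hx, hlk])
      (fun j hj => by rw [H.letter_base hj.le hy])
      (fun j hj => by rw [H.letter_base hj.le hz, hrk]) H.isComputation.2) j hj

end SMachine

/-! ### Gaps between K-letters. -/

namespace SMachine

open FreeGroup Counter

section General

variable {n : ℕ} {M : SMachine n}

theorem Rule.lhs_fits (ρ : M.Rule) (i : Fin (n + 1)) : (ρ.lhs i).Fits M.part M.tape i := by
  unfold Rule.lhs
  split_ifs
  · exact M.src_fits _ _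
  · exact M.tgt_fits _ _

theorem Rule.rhs_fits (ρ : M.Rule) (i : Fin (n + 1)) : (ρ.rhs i).Fits M.part M.tape i := by
  unfold Rule.rhs
  split_ifs
  · exact M.tgt_fits _ _
  · exact M.src_fits _ _

theorem after_mem {P : SPart M.Q M.A} {x : BaseLetter n} (h : P.Fits M.part M.tape x.1) :
    P.after x.2 ∈ wordsOver (M.tape x.gapAfter) := by
  obtain ⟨i, ε⟩ := x
  cases ε
  · exact inv_mem h.2.1
  · exact h.2.2

theorem before_mem {P : SPart M.Q M.A} {x : BaseLetter n} (h : P.Fits M.part M.tape x.1) :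
    P.before x.2 ∈ wordsOver (M.tape x.gapBefore) := by
  obtain ⟨i, ε⟩ := x
  cases ε
  · exact inv_mem h.2.2
  · exact h.2.1

theorem wordsOver_mono {A : Type} {s s' : Set A} (h : s ⊆ s') : wordsOver s ≤ wordsOver s' :=
  Subgroup.closure_mono (Set.image_mono h)

theorem GapStep.mem {ρ : M.Rule} {a b : M.Letter} {w w' : FreeGroup M.A}
    (h : GapStep ρ a w b w') :
    w ∈ wordsOver (M.tape a.base.gapAfter) ∧ w' ∈ wordsOver (M.tape a.base.gapAfter) := by
  obtain ⟨y, hy, rfl, rfl⟩ := h.exists_word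
  have h0 := wordsOver_mono (M.dom_subset _ _) hy
  constructor
  · refine mul_mem (mul_mem (after_mem (x := a.base) (ρ.lhs_fits _)) h0) ?_
    rw [h.adjacent]
    exact before_mem (x := b.base) (ρ.lhs_fits _)
  · refine mul_mem (mul_mem (after_mem (x := a.base) (ρ.rhs_fits _)) h0) ?_
    rw [h.adjacent]
    exact before_mem (x := b.base) (ρ.rhs_fits _)

variable {b : List (BaseLetter n)}

theorem gapGood_of_tape {k : ℕ} {x : BaseLetter n} (hk : k + 1 < b.length) (hx : b[k]? = some x)
    (h : M.tape x.gapAfter = ∅) : GapGood M b k := by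
  refine gapGood_of_le 0 (fun t W g H j hj => ?_) hk
  cases j with
  | zero => omega
  | succ j =>
    have h1 := (H.gapStep hj hk).mem.2
    rw [H.letter_base (by omega) hx, h] at h1
    rw [wordsOver_empty h1, len_one]
    omega

/-- If nothing is permitted between x⁻¹ and x, the word there is v⁻¹ v = 1. So such a pair in the
base blocks every rule that locks this gap. -/
theorem GapStep.dom_ne {ρ : M.Rule} {a b : M.Letter} {w w' : FreeGroup M.A}
    (h : GapStep ρ a w b w') {i : Fin (n + 1)} (ha : a.base = (i, false))
    (hb : b.base = (i, true)) : M.dom ρ.1 (i - 1) ≠ ∅ := by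
  intro h1
  obtain ⟨y, hy, hw, -⟩ := h.exists_word_of_base ha hb
  refine h.ne_one ha hb ?_
  change y ∈ wordsOver (M.dom ρ.1 (i - 1)) at hy
  rw [h1] at hy
  rw [hw, wordsOver_empty hy]
  simp [SPart.after, SPart.before]

end General

variable {n : ℕ} {S : SMachine n}

theorem kPlace_add_one_eq {i j : Fin (n + 1)}
    (h : (kPlace i : Fin (2 * n + 1)) + 1 = kPlace j) : i = Fin.last n := by
  have h0 := i.isLt
  have h1 := j.isLt
  by_contra hi
  have hi' : i.1 ≠ n := fun h => hi (Fin.ext h)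
  have h2 := congrArg Fin.val h
  have h3 : 1 % (2 * n + 1) = 1 := Nat.mod_eq_of_lt (by omega)
  rw [Fin.val_add, Fin.val_one', h3] at h2
  simp only [kPlace] at h2
  rw [Nat.mod_eq_of_lt (by omega)] at h2
  omega

theorem compTape_kPlace_last : S.compZ.tape (kPlace (Fin.last n)) = ∅ := S.compZ.tape_last

/-- Two K-parts are cyclic neighbours only at the passage from the last part to the first one, where
the tape alphabet is empty. -/
theorem gapGood_of_same_sign {b : List (BaseLetter (2 * n))} (hb : WellFormed b) {k : ℕ}
    {i j : Fin (n + 1)} {ε : Bool} (hx : b[k]? = some (kPlace i, ε))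
    (hy : b[k + 1]? = some (kPlace j, ε)) : GapGood S.compZ b k := by
  have hk : k + 1 < b.length := (List.getElem?_eq_some_iff.1 hy).1
  refine gapGood_of_tape hk hx ?_
  have h1 := hb k _ _ hx hy
  cases ε
  · change kPlace i - 1 = kPlace j at h1
    change S.compZ.tape (kPlace i - 1) = ∅
    rw [h1, kPlace_add_one_eq (sub_eq_iff_eq_add.1 h1).symm]
    exact compTape_kPlace_last
  · change kPlace i = kPlace j - 1 at h1
    change S.compZ.tape (kPlace i) = ∅
    rw [kPlace_add_one_eq (eq_sub_iff_add_eq.1 h1)]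
    exact compTape_kPlace_last

theorem side_eq (ρ : S.compZ.Rule) (j : Fin (2 * n + 1)) :
    ρ.lhs j = CompRule.side ρ.1 ρ.2 j ∧ ρ.rhs j = CompRule.side ρ.1 (!ρ.2) j := by
  obtain ⟨r, ε⟩ := ρ
  cases ε <;> exact ⟨rfl, rfl⟩

theorem CompRule.side_kPlace_left (r : CompRule S) (ε : Bool) (i : Fin (n + 1)) :
    (r.side ε (kPlace i)).left = 1 := by
  cases r <;> cases ε <;> simp [side, src, tgt, interleave_kPlace, bare]

theorem CompRule.side_kPlace_right (r : CompRule S) (hr : ∀ θ, r ≠ .basic θ) (ε : Bool)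
    (i : Fin (n + 1)) : (r.side ε (kPlace i)).right = 1 := by
  cases r with
  | basic θ => exact absurd rfl (hr θ)
  | adding => cases ε <;> simp [side, src, tgt, interleave_kPlace, bare]
  | transition => cases ε <;> simp [side, src, tgt, interleave_kPlace, bare]

/-- No rule of the composition has a tape word on the left of a K-letter. -/
theorem gap_eq_of_neg_pos {ρ : S.compZ.Rule} {a b : S.compZ.Letter} {w w' : FreeGroup (S.A × Fin 2)}
    (h : GapStep (M := S.compZ) ρ a w b w') {i : Fin (n + 1)} (ha : a.base = (kPlace i, false))
    (hb : b.base = (kPlace i, true)) : w' = w := by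
  obtain ⟨(y : FreeGroup (S.A × Fin 2)), -, h1, h2⟩ := h.exists_word_of_base ha hb
  have h3 : w = (CompRule.side ρ.1 ρ.2 (kPlace i)).left⁻¹ * y *
      (CompRule.side ρ.1 ρ.2 (kPlace i)).left := by rw [h1, (side_eq ρ _).1]; rfl
  have h4 : w' = (CompRule.side ρ.1 (!ρ.2) (kPlace i)).left⁻¹ * y *
      (CompRule.side ρ.1 (!ρ.2) (kPlace i)).left := by rw [h2, (side_eq ρ _).2]; rfl
  rw [h3, h4, CompRule.side_kPlace_left ρ.1 ρ.2, CompRule.side_kPlace_left ρ.1 (!ρ.2)]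

theorem exists_word_of_pos_neg {ρ : S.compZ.Rule} {a b : S.compZ.Letter}
    {w w' : FreeGroup (S.A × Fin 2)} (h : GapStep (M := S.compZ) ρ a w b w') {i : Fin (n + 1)}
    (ha : a.base = (kPlace i, true)) (hb : b.base = (kPlace i, false)) :
    ∃ y : FreeGroup (S.A × Fin 2), w = (CompRule.side ρ.1 ρ.2 (kPlace i)).right * y *
      (CompRule.side ρ.1 ρ.2 (kPlace i)).right⁻¹ ∧
      w' = (CompRule.side ρ.1 (!ρ.2) (kPlace i)).right * y *
      (CompRule.side ρ.1 (!ρ.2) (kPlace i)).right⁻¹ := by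
  obtain ⟨y, -, h1, h2⟩ := h.exists_word_of_base ha hb
  exact ⟨y, by rw [h1, (side_eq ρ _).1]; rfl, by rw [h2, (side_eq ρ _).2]; rfl⟩

theorem gapGood_of_eq {M : SMachine n} {b : List (BaseLetter n)} {k : ℕ} (hk : k + 1 < b.length)
    (h : ∀ (t : ℕ) (W : ℕ → M.Word) (h : ℕ → M.Rule), CompWithBase b t W h → ∀ j < t,
      (W (j + 1)).gap k = (W j).gap k) : GapGood M b k := by
  refine gapGood_of_le 0 (fun t W g H j hj => ?_) hk
  suffices h1 : (W j).gap k = (W 0).gap k by rw [h1]; omega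
  induction j with
  | zero => rfl
  | succ j ih => rw [h t W g H j hj, ih (by omega)]

theorem gapGood_of_neg_pos {b : List (BaseLetter (2 * n))} {k : ℕ} {i : Fin (n + 1)}
    (hx : b[k]? = some (kPlace i, false)) (hy : b[k + 1]? = some (kPlace i, true)) :
    GapGood S.compZ b k := by
  have hk : k + 1 < b.length := (List.getElem?_eq_some_iff.1 hy).1
  exact gapGood_of_eq hk fun t W g H j hj => gap_eq_of_neg_pos (H.gapStep hj hk)
    (H.letter_base hj.le hx) (H.letter_base hj.le hy)

/-- This gap follows a P-part, where basic rules lock it, or else the last part. -/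
theorem CompRule.dom_basic_kPlace_sub_one (θ : S.R) (i : Fin (n + 1)) :
    (CompRule.basic θ).dom (kPlace i - 1 : Fin (2 * n + 1)) = ∅ := by
  refine Fin.cases ?_ (fun i => ?_) i
  · have h1 : (kPlace 0 - 1 : Fin (2 * n + 1)) = Fin.last (2 * n) := by
      rw [sub_eq_iff_eq_add, Fin.last_add_one]
      rfl
    rw [h1]
    exact Set.subset_eq_empty (S.compZ.dom_subset (CompRule.basic θ) _) S.compZ.tape_last
  · rw [sub_one_eq_pPlace, CompRule.dom, interleave_pPlace]

/-- The pair K_a⁻¹ K_a blocks all basic rules, and only these have tape words next to K-letters. -/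
theorem gapGood_of_kPlace_anchor {b : List (BaseLetter (2 * n))} {k m : ℕ} {i a : Fin (n + 1)}
    (hx : b[k]? = some (kPlace i, true)) (hy : b[k + 1]? = some (kPlace i, false))
    (hu : b[m]? = some (kPlace a, false)) (hv : b[m + 1]? = some (kPlace a, true)) :
    GapGood S.compZ b k := by
  have hk : k + 1 < b.length := (List.getElem?_eq_some_iff.1 hy).1
  have hm : m + 1 < b.length := (List.getElem?_eq_some_iff.1 hv).1
  refine gapGood_of_eq hk fun t W g H j hj => ?_
  have hbasic : ∀ θ, (g j).1 ≠ .basic θ := by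
    intro θ hθ
    refine (H.gapStep hj hm).dom_ne (H.letter_base hj.le hu) (H.letter_base hj.le hv) ?_
    rw [hθ]
    exact CompRule.dom_basic_kPlace_sub_one θ a
  obtain ⟨y, h1, h2⟩ := exists_word_of_pos_neg (H.gapStep hj hk) (H.letter_base hj.le hx)
    (H.letter_base hj.le hy)
  rw [CompRule.side_kPlace_right _ hbasic] at h1 h2
  exact h2.trans h1.symm

/-- The tape word between `K_i` and `K_i⁻¹` before the application of the rule of `S` that created
the `P`-letter `q`. -/
def pairOrigin (i : Fin (n + 1)) (q : CompState S) (w : FreeGroup (S.A × Fin 2)) :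
    FreeGroup (S.A × Fin 2) :=
  match q.creator with
  | none => w
  | some θ => lift0 (S.src θ i).right * (lift0 (S.tgt θ i).right)⁻¹ * w *
      lift0 (S.tgt θ i).right * (lift0 (S.src θ i).right)⁻¹

theorem exists_len_pairOrigin_le (S : SMachine n) (i : Fin (n + 1)) :
    ∃ k : ℕ, ∀ (q : CompState S) (w : FreeGroup (S.A × Fin 2)),
      len (pairOrigin i q w) ≤ len w + k ∧ len w ≤ len (pairOrigin i q w) + k := by
  have := S.finite_R
  let f : S.R → ℕ := fun θ =>
    2 * len (lift0 (S.src θ i).right) + 2 * len (lift0 (S.tgt θ i).right)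
  obtain ⟨k, hk⟩ := (Set.finite_range f).bddAbove
  refine ⟨k, fun q w => ?_⟩
  unfold pairOrigin
  cases hc : q.creator with
  | none => dsimp only; omega
  | some θ =>
    dsimp only
    have h1 : f θ ≤ k := hk ⟨θ, rfl⟩
    simp only [f] at h1
    set a := lift0 (S.src θ i).right
    set d := lift0 (S.tgt θ i).right
    have h2 := len_conj_le d w
    have h3 := len_conj_le a⁻¹ (d⁻¹ * w * d)
    have h4 := len_conj_le a (a * d⁻¹ * w * d * a⁻¹)
    have h5 := len_conj_le d⁻¹ (d⁻¹ * w * d)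
    rw [show a⁻¹⁻¹ * (d⁻¹ * w * d) * a⁻¹ = a * d⁻¹ * w * d * a⁻¹ by group] at h3
    rw [show a⁻¹ * (a * d⁻¹ * w * d * a⁻¹) * a = d⁻¹ * w * d by group] at h4
    rw [show d⁻¹⁻¹ * (d⁻¹ * w * d) * d⁻¹ = w by group] at h5
    simp only [len_inv] at h3 h5
    omega

theorem pairOrigin_side {r : CompRule S} {j : Fin n} (hr : ∀ θ, r ≠ .adding θ j .r13)
    (i : Fin (n + 1)) (y : FreeGroup (S.A × Fin 2)) (ε ε' : Bool) :
    pairOrigin i (r.side ε (pPlace j)).state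
      ((r.side ε (kPlace i)).right * y * (r.side ε (kPlace i)).right⁻¹) =
    pairOrigin i (r.side ε' (pPlace j)).state
      ((r.side ε' (kPlace i)).right * y * (r.side ε' (kPlace i)).right⁻¹) := by
  suffices h : pairOrigin i (r.src (pPlace j)).state
      ((r.src (kPlace i)).right * y * (r.src (kPlace i)).right⁻¹) =
      pairOrigin i (r.tgt (pPlace j)).state
      ((r.tgt (kPlace i)).right * y * (r.tgt (kPlace i)).right⁻¹) by
    cases ε <;> cases ε'
    exacts [rfl, h.symm, h, rfl]
  cases r with
  | basic θ =>
    simp only [CompRule.src, CompRule.tgt, interleave_kPlace, interleave_pPlace, pairOrigin,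
      CompState.creator, CompState.activeRule, Option.bind_none, Option.bind_some, if_true]
    group
  | transition θ =>
    simp [CompRule.src, CompRule.tgt, interleave_kPlace, interleave_pPlace, pairOrigin,
      CompState.creator, CompState.activeRule, bare]
  | adding θ l z =>
    by_cases hl : l = j
    · subst hl
      have h1 := activeRule_source (i := l) (θ := θ) (σ := (z, true))
        (fun h => hr θ (congrArg (CompRule.adding θ l) h))
      simp only [ZStep.source, ZStep.target, if_true] at h1
      simp [CompRule.src, CompRule.tgt, interleave_kPlace, interleave_pPlace, pairOrigin,
        CompState.creator, bare, CompState.working, h1]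
    · simp [CompRule.src, CompRule.tgt, interleave_kPlace, interleave_pPlace, bare,
        CompState.working_of_ne z.source z.target hl]

/-- The pair P_a⁻¹ P_a blocks the switch of the a-th adding machine. Hence P_a keeps the record of
the positive rule of S in force until that rule is undone, and the gap with the effect of this rule
removed is constant. The bound `2 * c` comes from comparing the gap with this constant at two times.
-/
theorem gapGood_of_pPlace_anchor {b : List (BaseLetter (2 * n))} {k m : ℕ} {i : Fin (n + 1)}
    {a : Fin n} (hx : b[k]? = some (kPlace i, true)) (hy : b[k + 1]? = some (kPlace i, false))
    (hu : b[m]? = some (pPlace a, false)) (hv : b[m + 1]? = some (pPlace a, true)) :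
    GapGood S.compZ b k := by
  have hk : k + 1 < b.length := (List.getElem?_eq_some_iff.1 hy).1
  have hm : m + 1 < b.length := (List.getElem?_eq_some_iff.1 hv).1
  obtain ⟨c, hc⟩ := exists_len_pairOrigin_le S i
  refine gapGood_of_le (2 * c) (fun t W g H j hj => ?_) hk
  have key : ∀ j ≤ t, pairOrigin i ((W j).letter (m + 1)).1 ((W j).gap k) =
      pairOrigin i ((W 0).letter (m + 1)).1 ((W 0).gap k) := by
    intro j
    induction j with
    | zero => exact fun _ => rfl
    | succ j ih =>
      intro hj
      rw [← ih (by omega)]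
      have hj' : j ≤ t := by omega
      have hexit : ∀ θ, (g j).1 ≠ .adding θ a .r13 := by
        intro θ hθ
        refine (H.gapStep hj hm).dom_ne (H.letter_base hj' hu) (H.letter_base hj' hv) ?_
        rw [hθ, pPlace_sub_one]
        change (CompRule.adding θ a .r13).dom _ = ∅
        rw [CompRule.dom, interleave_kPlace, if_pos rfl]
        rfl
      obtain ⟨y, h1, h2⟩ := exists_word_of_pos_neg (H.gapStep hj hk) (H.letter_base hj' hx)
        (H.letter_base hj' hy)
      have h3 := H.letterStep hj hm
      have h4 : S.compZ.part ((W j).letter (m + 1)).1 = pPlace a :=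
        congrArg Prod.fst (H.letter_base hj' hv)
      have h5 := h3.1
      have h6 := congrArg Prod.fst h3.2
      rw [h4, (side_eq _ _).1] at h5
      rw [h4] at h6
      dsimp only at h6
      rw [(side_eq _ _).2] at h6
      rw [h1, h2, h5, h6]
      exact pairOrigin_side hexit i y _ _
  have h1 := key j hj
  have h2 := (hc ((W j).letter (m + 1)).1 ((W j).gap k)).2
  have h3 := (hc ((W 0).letter (m + 1)).1 ((W 0).gap k)).1
  rw [h1] at h2
  change FreeGroup.len (α := S.A × Fin 2) _ ≤ FreeGroup.len (α := S.A × Fin 2) _ + _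
  omega

/-- A criterion for the width of computations with base `b` to be bounded. -/
theorem good_of_ends {b : List (BaseLetter (2 * n))} (h3 : 3 ≤ b.length)
    (hfirst : ∀ i ε, b[0]? = some (pPlace i, ε) → ∃ j δ, b[1]? = some (pPlace j, δ))
    (hlast : ∀ i ε, b[b.length - 1]? = some (pPlace i, ε) →
      ∃ j δ, b[b.length - 2]? = some (pPlace j, δ))
    (hanchor : ∀ (k : ℕ) (i : Fin (n + 1)), b[k]? = some (kPlace i, true) →
      b[k + 1]? = some (kPlace i, false) →
      ∃ m x y, b[m]? = some (x, false) ∧ b[m + 1]? = some (y, true)) : Good S.compZ b := by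
  by_cases hb : WellFormed b
  swap
  · exact good_of_not_wellFormed hb
  have hget : ∀ k < b.length, ∃ x, b[k]? = some x := fun k hk => ⟨b[k], List.getElem?_eq_getElem hk⟩
  refine good_of_gapGood fun k hk => ?_
  obtain ⟨⟨x, ε⟩, hx⟩ := hget k (by omega)
  obtain ⟨⟨y, δ⟩, hy⟩ := hget (k + 1) hk
  have hleft : ∀ i, x = pPlace i → 1 ≤ k → GapGood S.compZ b k := by
    rintro i rfl h1
    obtain ⟨k, rfl⟩ : ∃ l, k = l + 1 := ⟨k - 1, by omega⟩
    obtain ⟨z, hz⟩ := hget k (by omega)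
    exact (gapGood_of_interior hb hz hx hy).2
  have hright : ∀ i, y = pPlace i → k + 2 < b.length → GapGood S.compZ b k := by
    rintro i rfl h1
    obtain ⟨z, hz⟩ := hget (k + 2) h1
    exact (gapGood_of_interior hb hx hy hz).1
  rcases place_cases x with ⟨i, rfl⟩ | ⟨i, rfl⟩
  swap
  -- A P-letter at the beginning of the base is not interior, but then the next letter is a P-letter
  -- and is interior, since there are at least three letters.
  · rcases Nat.eq_zero_or_pos k with rfl | h0
    · obtain ⟨j, ε', hj⟩ := hfirst i ε hx
      rw [zero_add, hj, Option.some.injEq, Prod.mk.injEq] at hy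
      exact hright j hy.1.symm (by omega)
    · exact hleft i rfl h0
  rcases place_cases y with ⟨j, rfl⟩ | ⟨j, rfl⟩
  swap
  · by_cases h1 : k + 2 < b.length
    · exact hright j rfl h1
    · obtain ⟨l, ε', hl⟩ := hlast j δ (by rw [show b.length - 1 = k + 1 by omega]; exact hy)
      rw [show b.length - 2 = k by omega, hx, Option.some.injEq, Prod.mk.injEq] at hl
      exact absurd hl.1 (kPlace_ne_pPlace i l)
  by_cases hεδ : ε = δ
  · subst hεδ
    exact gapGood_of_same_sign hb hx hy
  have hcons : ∀ (k : ℕ) (x y : Fin (2 * n + 1)) (ε : Bool), b[k]? = some (x, ε) →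
      b[k + 1]? = some (y, !ε) → x = y := by
    intro k x y ε hx hy
    have h1 := hb k _ _ hx hy
    cases ε
    · exact sub_left_injective h1
    · exact h1
  obtain rfl : δ = !ε := by cases ε <;> cases δ <;> simp_all
  obtain rfl : i = j := by
    have h1 := congrArg Fin.val (hcons k _ _ ε hx hy)
    simp only [kPlace] at h1
    exact Fin.ext (by omega)
  cases ε
  · exact gapGood_of_neg_pos hx hy
  · obtain ⟨m, u, v, hu, hv⟩ := hanchor k i hx hy
    obtain rfl := hcons m u v false hu hv
    rcases place_cases u with ⟨a, rfl⟩ | ⟨a, rfl⟩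
    · exact gapGood_of_kPlace_anchor hx hy hu hv
    · exact gapGood_of_pPlace_anchor hx hy hu hv

end SMachine

/-! ### Combinatorics of base words. -/

namespace SMachine

open FreeGroup Counter

variable {n : ℕ} {S : SMachine n}

/-- The letter belongs to a `P`-part. -/
def IsPLetter (x : BaseLetter (2 * n)) : Prop := ∃ i, x.1 = pPlace i

/-- A subword that begins or ends at position `z` begins or ends with a `K`-letter or with two
`P`-letters. -/
def IsEndPosition (w : List (BaseLetter (2 * n))) (z : ℕ) : Prop :=
  ∃ x, w[z]? = some x ∧ (IsPLetter x → 1 ≤ z ∧ (∃ y, w[z - 1]? = some y ∧ IsPLetter y) ∧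
    ∃ y, w[z + 1]? = some y ∧ IsPLetter y)

/-- If neither of the outer two of three consecutive letters is a K-letter, both are P-letters and
the middle position qualifies. -/
theorem exists_isEndPosition {w : List (BaseLetter (2 * n))} {m : ℕ} (hm : m + 2 < w.length) :
    ∃ z, m ≤ z ∧ z ≤ m + 2 ∧ IsEndPosition w z := by
  have hget : ∀ k < w.length, ∃ x, w[k]? = some x := fun k hk => ⟨w[k], List.getElem?_eq_getElem hk⟩
  obtain ⟨x, hx⟩ := hget m (by omega)
  obtain ⟨y, hy⟩ := hget (m + 1) (by omega)
  obtain ⟨z, hz⟩ := hget (m + 2) (by omega)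
  by_cases h1 : IsPLetter x
  · by_cases h2 : IsPLetter z
    · exact ⟨m + 1, by omega, by omega, y, hy, fun _ => ⟨by omega, ⟨x, hx, h1⟩, z, hz, h2⟩⟩
    · exact ⟨m + 2, by omega, by omega, z, hz, fun h => absurd h h2⟩
  · exact ⟨m, by omega, by omega, x, hx, fun h => absurd h h1⟩

/-- The subword of `w` between the positions `a` and `b`. -/
def segment {α : Type} (w : List α) (a b : ℕ) : List α := (w.drop a).take (b - a + 1)

theorem segment_infix {α : Type} (w : List α) (a b : ℕ) : segment w a b <:+: w :=
  (List.take_prefix _ _).isInfix.trans (List.drop_suffix _ _).isInfix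

theorem segment_getElem? {α : Type} (w : List α) {a b k : ℕ} (hk : a + k ≤ b) :
    (segment w a b)[k]? = w[a + k]? := by
  rw [segment, List.getElem?_take_of_lt (by omega), List.getElem?_drop]

theorem length_segment {α : Type} {w : List α} {a b : ℕ} (hab : a ≤ b) (hb : b < w.length) :
    (segment w a b).length = b - a + 1 := by
  simp only [segment, List.length_take, List.length_drop]
  omega

theorem exists_eq_cons_append {α : Type} {u : List α} {x : α} (hu : 2 ≤ u.length)
    (h0 : u[0]? = some x) (h1 : u[u.length - 1]? = some x) : ∃ v, u = x :: (v ++ [x]) := by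
  obtain ⟨y, l, rfl⟩ : ∃ y l, u = y :: l := by
    cases u with
    | nil => simp at hu
    | cons y l => exact ⟨y, l, rfl⟩
  obtain rfl : y = x := by simpa using h0
  rcases List.eq_nil_or_concat l with rfl | ⟨v, z, rfl⟩
  · simp at hu
  · refine ⟨v, ?_⟩
    simp at h1
    rw [h1, List.concat_eq_append]

/-- An occurrence of `K_i K_i⁻¹`. -/
def IsTurn (w : List (BaseLetter (2 * n))) (k : ℕ) : Prop :=
  ∃ i : Fin (n + 1), w[k]? = some (kPlace i, true) ∧ w[k + 1]? = some (kPlace i, false)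

theorem good_segment {w : List (BaseLetter (2 * n))} {a b : ℕ} (hab : a + 2 ≤ b)
    (ha : IsEndPosition w a) (hb : IsEndPosition w b)
    (h : ∀ k, a ≤ k → k + 1 ≤ b → IsTurn w k →
      ∃ m x y, a ≤ m ∧ m + 1 ≤ b ∧ w[m]? = some (x, false) ∧ w[m + 1]? = some (y, true)) :
    Good S.compZ (segment w a b) := by
  obtain ⟨xa, hxa, ha⟩ := ha
  obtain ⟨xb, hxb, hb⟩ := hb
  have hbl : b < w.length := (List.getElem?_eq_some_iff.1 hxb).1
  have hlen := length_segment (a := a) (by omega) hbl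
  refine good_of_ends (by omega) ?_ ?_ ?_
  · intro i ε h1
    rw [segment_getElem? w (by omega), add_zero, hxa, Option.some.injEq] at h1
    obtain ⟨-, -, y, hy, j, hj⟩ := ha ⟨i, congrArg Prod.fst h1⟩
    refine ⟨j, y.2, ?_⟩
    rw [segment_getElem? w (by omega), hy, ← hj]
  · intro i ε h1
    rw [hlen, segment_getElem? w (by omega), show a + (b - a + 1 - 1) = b by omega, hxb,
      Option.some.injEq] at h1
    obtain ⟨-, ⟨y, hy, j, hj⟩, -⟩ := hb ⟨i, congrArg Prod.fst h1⟩
    refine ⟨j, y.2, ?_⟩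
    rw [hlen, segment_getElem? w (by omega), show a + (b - a + 1 - 2) = b - 1 by omega, hy, ← hj]
  · intro k i h1 h2
    have hk : k + 1 < (segment w a b).length := (List.getElem?_eq_some_iff.1 h2).1
    rw [hlen] at hk
    rw [segment_getElem? w (by omega)] at h1 h2
    obtain ⟨m, x, y, h3, h4, h5, h6⟩ := h (a + k) (by omega) (by omega) ⟨i, h1, h2⟩
    refine ⟨m - a, x, y, ?_, ?_⟩
    · rw [segment_getElem? w (by omega), show a + (m - a) = m by omega, h5]
    · rw [segment_getElem? w (by omega), show a + (m - a + 1) = m + 1 by omega, h6]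

theorem exists_neg_pos {w : List (BaseLetter (2 * n))} {k l : ℕ} {x y : Fin (2 * n + 1)}
    (hkl : k < l) (hx : w[k]? = some (x, false)) (hy : w[l]? = some (y, true)) :
    ∃ m x y, k ≤ m ∧ m + 1 ≤ l ∧ w[m]? = some (x, false) ∧ w[m + 1]? = some (y, true) := by
  have hl : l < w.length := (List.getElem?_eq_some_iff.1 hy).1
  induction l, hkl using Nat.le_induction generalizing y with
  | base => exact ⟨k, x, y, le_rfl, le_rfl, hx, hy⟩
  | succ l hkl ih =>
    obtain ⟨⟨z, ε⟩, hz⟩ : ∃ z, w[l]? = some z := ⟨w[l], List.getElem?_eq_getElem (by omega)⟩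
    cases ε
    · exact ⟨l, z, y, by omega, le_rfl, hz, hy⟩
    · obtain ⟨m, u, v, h1, h2, h3⟩ := ih hz (by omega)
      exact ⟨m, u, v, h1, by omega, h3⟩

/-- Of three occurrences of the same letter, two are the ends of a subword for which the width of
computations is bounded. -/
theorem exists_good_segment {w : List (BaseLetter (2 * n))} {a b c : ℕ} (hab : a + 2 ≤ b)
    (hbc : b + 2 ≤ c) (ha : IsEndPosition w a) (hb : IsEndPosition w b)
    (hc : IsEndPosition w c) :
    Good S.compZ (segment w a b) ∨ Good S.compZ (segment w b c) ∨
      Good S.compZ (segment w a c) := by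
  by_cases h1 : ∃ k, a ≤ k ∧ k + 1 ≤ b ∧ IsTurn w k
  swap
  · exact .inl (good_segment hab ha hb fun k h2 h3 h4 => absurd ⟨k, h2, h3, h4⟩ h1)
  by_cases h2 : ∃ k, b ≤ k ∧ k + 1 ≤ c ∧ IsTurn w k
  swap
  · exact .inr (.inl (good_segment hbc hb hc fun k h3 h4 h5 => absurd ⟨k, h3, h4, h5⟩ h2))
  obtain ⟨k, hk1, hk2, i, -, hk3⟩ := h1
  obtain ⟨l, hl1, hl2, j, hl3, -⟩ := h2
  have hkl : k + 1 < l := by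
    rcases eq_or_lt_of_le (hk2.trans hl1) with h | h
    · rw [h, hl3] at hk3
      simp at hk3
    · exact h
  -- The first turn ends with a negative letter and the second begins with a positive one. The
  -- change of sign between them serves as the anchor for all turns of the long segment.
  obtain ⟨m, x, y, h3, h4, h5⟩ := exists_neg_pos hkl hk3 hl3
  exact .inr (.inr (good_segment (by omega) ha hc fun _ _ _ _ => ⟨m, x, y, by omega, by omega, h5⟩))

theorem exists_three_of_card {α : Type} [Fintype α] (f : ℕ → α) :
    ∃ a b c, a < b ∧ b < c ∧ c < 2 * Fintype.card α + 1 ∧ f a = f b ∧ f b = f c := by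
  classical
  obtain ⟨y, -, hy⟩ := Finset.exists_lt_card_fiber_of_mul_lt_card_of_maps_to
    (s := Finset.range (2 * Fintype.card α + 1)) (t := Finset.univ) (f := f) (n := 2)
    (fun _ _ => Finset.mem_univ _) (by simp; omega)
  obtain ⟨s, hs, hcard⟩ := Finset.exists_subset_card_eq (Nat.succ_le_of_lt hy)
  let e := s.orderEmbOfFin hcard
  have he : ∀ k, e k < 2 * Fintype.card α + 1 ∧ f (e k) = y := by
    intro k
    simpa using hs (s.orderEmbOfFin_mem hcard k)
  refine ⟨e 0, e 1, e 2, ?_, ?_, (he 2).1, ?_, ?_⟩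
  · exact e.strictMono (by decide)
  · exact e.strictMono (by decide)
  · rw [(he 0).2, (he 1).2]
  · rw [(he 1).2, (he 2).2]

/-- Every long base word has a subword `x v x` for which the width of computations is bounded. -/
theorem exists_good_infix {w : List (BaseLetter (2 * n))}
    (hw : 4 * (2 * Fintype.card (BaseLetter (2 * n)) + 1) ≤ w.length) :
    ∃ c, c <:+: w ∧ Good S.compZ c ∧ (∃ x v, c = x :: (v ++ [x])) ∧
      c.length ≤ 4 * (2 * Fintype.card (BaseLetter (2 * n)) + 1) := by
  set N := 2 * Fintype.card (BaseLetter (2 * n)) + 1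
  -- One end position is taken from the first three places of each block of four, so different ones
  -- are at least two apart. The number `N` of blocks exceeds twice the number of letters, and the
  -- pigeonhole principle gives the same letter three times.
  have h1 : ∀ m, ∃ z, m < N → 4 * m ≤ z ∧ z ≤ 4 * m + 2 ∧ IsEndPosition w z := by
    intro m
    by_cases hm : m < N
    · obtain ⟨z, hz⟩ := exists_isEndPosition (w := w) (m := 4 * m) (by omega)
      exact ⟨z, fun _ => hz⟩
    · exact ⟨0, fun h => absurd h hm⟩
  choose z hz using h1
  obtain ⟨a, b, c, hab, hbc, hc, e1, e2⟩ := exists_three_of_card (fun m => w.getD (z m) (0, true))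
  have hza := hz a (by omega)
  have hzb := hz b (by omega)
  have hzc := hz c hc
  have hget : ∀ m < N, w[z m]? = some (w.getD (z m) (0, true)) := by
    intro m hm
    obtain ⟨x, hx, -⟩ := (hz m hm).2.2
    rw [List.getD_eq_getElem?_getD, hx]
    rfl
  have key : ∀ i j, i < j → j < N → w.getD (z i) (0, true) = w.getD (z j) (0, true) →
      Good S.compZ (segment w (z i) (z j)) →
      ∃ c, c <:+: w ∧ Good S.compZ c ∧ (∃ x v, c = x :: (v ++ [x])) ∧ c.length ≤ 4 * N := by
    intro i j hij hj heq hgood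
    have hi := hz i (by omega)
    have hj' := hz j hj
    have hlen := length_segment (w := w) (a := z i) (b := z j) (by omega) (by omega)
    refine ⟨segment w (z i) (z j), segment_infix _ _ _, hgood, ⟨w.getD (z i) (0, true), ?_⟩, ?_⟩
    · refine exists_eq_cons_append (by omega) ?_ ?_
      · rw [segment_getElem? w (by omega), add_zero, hget i (by omega)]
      · rw [hlen, segment_getElem? w (by omega), show z i + (z j - z i + 1 - 1) = z j by omega,
          hget j hj, heq]
    · omega
  rcases exists_good_segment (S := S) (w := w) (a := z a) (b := z b) (c := z c) (by omega)
    (by omega) hza.2.2 hzb.2.2 hzc.2.2 with h | h | h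
  · exact key a b hab (by omega) e1 h
  · exact key b c hbc hc e2 h
  · exact key a c (hab.trans hbc) hc (e1.trans e2) h

/-! ### Real logarithms and the conclusion. -/

theorem natLog_le_logb {t : ℕ} (ht : 0 < t) :
    (Nat.log 2 (4 * t + 1) : ℝ) ≤ 3 + Real.logb 2 t := by
  have h1 : Nat.log 2 (4 * t + 1) ≤ Nat.log 2 (2 ^ 3 * t) := Nat.log_mono_right (by omega)
  have h2 := Real.natLog_le_logb (2 ^ 3 * t) 2
  have h3 : Real.logb 2 ((2 ^ 3 * t : ℕ) : ℝ) = 3 + Real.logb 2 t := by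
    rw [Nat.cast_mul, Nat.cast_pow, Real.logb_mul (by norm_num) (by positivity), Real.logb_pow,
      show ((2 : ℕ) : ℝ) = 2 from rfl, Real.logb_self_eq_one (by norm_num)]
    norm_num
  have h4 : (Nat.log 2 (4 * t + 1) : ℝ) ≤ Nat.log 2 (2 ^ 3 * t) := by exact_mod_cast h1
  push_cast at h2 h3 h4 ⊢
  linarith

theorem Word.length_pos {n : ℕ} {M : SMachine n} (W : M.Word) : 1 ≤ W.length := by
  rw [Word.length_eq]; omega

/-- Every word has at least one letter, so the additive constant 3 + 1 is at most twice the sum of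
the two lengths, and the factor 4 absorbs it. For t = 0 both logarithms vanish. -/
theorem width_le {n : ℕ} {M : SMachine n} {C t : ℕ} {W : ℕ → M.Word}
    (h : ∀ j ≤ t, (W j).length ≤
      C * ((W 0).length + (W t).length + Nat.log 2 (4 * t + 1) + 1)) :
    (width t W : ℝ) ≤
      (4 * C : ℕ) * (((W 0).length : ℝ) + (W t).length + Real.logb 2 t) := by
  have h1 : width t W ≤ C * ((W 0).length + (W t).length + Nat.log 2 (4 * t + 1) + 1) :=
    Finset.sup_le fun j hj => h j (by simpa [Nat.lt_succ_iff] using hj)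
  have h2 : (width t W : ℝ) ≤
      C * ((W 0).length + (W t).length + Nat.log 2 (4 * t + 1) + 1 : ℕ) := by exact_mod_cast h1
  refine h2.trans ?_
  have h3 : (1 : ℝ) ≤ (W 0).length := by exact_mod_cast (W 0).length_pos
  have h4 : (1 : ℝ) ≤ (W t).length := by exact_mod_cast (W t).length_pos
  have h5 : (Nat.log 2 (4 * t + 1) : ℝ) ≤ 3 + Real.logb 2 t ∧ 0 ≤ Real.logb 2 t := by
    rcases Nat.eq_zero_or_pos t with rfl | ht
    · simp
    · exact ⟨natLog_le_logb ht, Real.logb_nonneg (by norm_num) (by exact_mod_cast ht)⟩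
  push_cast
  rw [mul_comm 4 (C : ℝ), mul_assoc]
  refine mul_le_mul_of_nonneg_left ?_ (by positivity)
  linarith

end SMachine

theorem mainTheorem8 {n : ℕ} (S : SMachine n) :
    ∃ (B : Set (List (BaseLetter (2 * n)))) (K₀ : ℕ) (C : ℝ),
      B.Finite ∧
      (∀ w : List (BaseLetter (2 * n)), IsNarrow B w → w.length < K₀) ∧
      (∀ w : List (BaseLetter (2 * n)), K₀ ≤ w.length →
        ∃ c, c <:+: w ∧ IsCovered B c ∧ ∀ i, i + 1 < c.length → CoveredAt B c i (i + 1)) ∧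
      ∀ (t : ℕ) (W : ℕ → S.compZ.Word) (h : ℕ → S.compZ.Rule),
        SMachine.Admissible (W 0) → (W 0).base ∈ B → SMachine.IsComputation t W h →
          (SMachine.width t W : ℝ) ≤
            C * (((W 0).length : ℝ) + ((W t).length : ℝ) + Real.logb 2 (t : ℝ)) := by
  let K₀ := 4 * (2 * Fintype.card (BaseLetter (2 * n)) + 1)
  let B : Set (List (BaseLetter (2 * n))) := {c | c.length ≤ K₀ ∧ SMachine.Good S.compZ c}
  have hB : B.Finite := (List.finite_length_le (BaseLetter (2 * n)) K₀).subset fun c hc => hc.1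
  have hcover : ∀ w : List (BaseLetter (2 * n)), K₀ ≤ w.length →
      ∃ c, c <:+: w ∧ IsCovered B c ∧ ∀ i, i + 1 < c.length → CoveredAt B c i (i + 1) := by
    intro w hw
    obtain ⟨c, h1, h2, h3, h4⟩ := SMachine.exists_good_infix (S := S) hw
    -- The word c itself is in `B`, so the single subword c covers all letters and all pairs at
    -- once.
    have h5 : ∀ i j, j < c.length → CoveredAt B c i j := fun i j hj =>
      ⟨[], c, [], by simp, ⟨h4, h2⟩, by simp, by simpa using hj⟩
    exact ⟨c, h1, ⟨fun i hi => h5 i i hi, h3⟩, fun i hi => h5 i (i + 1) hi⟩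
  have hgood : ∀ c : List (BaseLetter (2 * n)), ∃ C : ℕ, c ∈ B →
      ∀ (t : ℕ) (W : ℕ → S.compZ.Word) (h : ℕ → S.compZ.Rule), SMachine.CompWithBase c t W h → ∀ j ≤ t,
        (W j).length ≤ C * ((W 0).length + (W t).length + Nat.log 2 (4 * t + 1) + 1) := by
    intro c
    by_cases hc : c ∈ B
    · obtain ⟨C, hC⟩ := hc.2
      exact ⟨C, fun _ => hC⟩
    · exact ⟨0, fun h => absurd h hc⟩
  choose C hC using hgood
  obtain ⟨D, hD⟩ := (hB.image C).bddAbove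
  refine ⟨B, K₀, (4 * D : ℕ), hB, ?_, hcover, ?_⟩
  · intro w hw
    by_contra h
    obtain ⟨c, h1, h2, -⟩ := hcover w (not_lt.1 h)
    exact hw c h1 h2
  · intro t W h _ hbase hcomp
    refine SMachine.width_le fun j hj => (hC _ hbase t W h ⟨hcomp, rfl⟩ j hj).trans ?_
    exact Nat.mul_le_mul_right _ (hD ⟨_, hbase, rfl⟩)
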